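/- **Setting.** All manifolds, tensor fields and maps are smooth, and $r\ge 1$. An *indefinite metric g.f.f-manifold* $(\bar M,\bar\varphi,\bar\xi_\alpha,\bar\eta^\alpha,\bar g)$, $\alpha=1,\dots,r$, is a manifold with a nowhere vanishing $(1,1)$-tensor field $\bar\varphi$, vector fields $\bar\xi_\alpha$ that trivialize $\ker\bar\varphi$, $1$-forms $\bar\eta^\alpha$ with $\bar\varphi^2=-I+\sum_\alpha\bar\eta^\alpha\otimes\bar\xi_\alpha$ and $\bar\eta^\alpha(\bar\xi_\beta)=\delta^\alpha_\beta$, and a semi-Riemannian metric $\bar g$ of index $\nu$, $0<\nu<\dim\bar M$, such that $\bar g(\bar\varphi X,\bar\varphi Y)=\bar g(X,Y)-\sum_\alpha\varepsilon_\alpha\bar\eta^\alpha(X)\bar\eta^\alpha(Y)$, where $\varepsilon_\alpha=\bar g(\bar\xi_\alpha,\bar\xi_\alpha)=\pm1$. It is an *indefinite $\mathcal S$-manifold* if $N_{\bar\varphi}+2\sum_\alpha d\bar\eta^\alpha\otimes\bar\xi_\alpha=0$ ($N_{\bar\varphi}$ the Nijenhuis torsion) and $d\bar\eta^\alpha(X,Y)=\bar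 g(X,\bar\varphi Y)$ for all $\alpha$, with the convention $2\,d\eta(X,Y)=X\eta(Y)-Y\eta(X)-\eta([X,Y])$. Let $\bar M$ be an indefinite $\mathcal S$-manifold with Levi-Civita connection $\bar\nabla$, and let $M$ be a *characteristic lightlike hypersurface*: an immersed hypersurface whose induced metric $g$ is degenerate at every point, and to which all $\bar\xi_\alpha$ are tangent. Let $\mathrm{Rad}(TM)=TM\cap TM^\perp$, and let $S(TM)$ be a *characteristic screen distribution*: a smooth complement of $\mathrm{Rad}(TM)$ in $TM$ that contains $\ker\bar\varphi$ and $\bar\varphi(\mathrm{Rad}(TM))$. Let $\mathrm{ltr}(M)$ be the lightlike transversal line bundle, spanned at each point by the vector $N$ with $\bar g(N,E)=1$, $\bar g(N,N)=0$ and $N\perp S(TM)$, where $0\ne E\in\mathrm{Rad}(TM)$. Then $T\bar M|_M=TM\oplus\mathrm{ltr}(M)$, and the *induced connection* $\nabla$ on $M$ is defined by taking $\nabla_XY$ to be the $TM$-component of $\bar\nabla_XY$. Let $D_0$ be the orthogonal complement of $\bar\varphi(\mathrm{Rad}(TM))\oplus\bar\varphi(\mathrm{ltr}(M))$ in $S(TM)$,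 and put $$\mathcal F=\big(\bar\varphi(\mathrm{Rad}(TM))\oplus\bar\varphi(\mathrm{ltr}(M))\big)\perp\mathrm{Rad}(TM),\qquad \mathcal E=\big(\bar\varphi(\mathrm{Rad}(TM))\oplus\bar\varphi(\mathrm{ltr}(M))\big)\perp\big(\mathrm{Rad}(TM)\oplus\mathrm{ltr}(M)\big).$$ Then $TM=D_0\oplus\mathcal F$, $T\bar M|_M=D_0\oplus\mathcal E$, and $g$ is nondegenerate on $D_0$. For $X,Y\in\Gamma(TM)$ with $D_0$-components $X_0,Y_0$ let $A_XY$ be the $\mathcal F$-component of $\nabla_{X_0}Y_0$ and $B^{D_0}(X,Y)=\frac12(A_XY+A_YX)$. The distribution $D_0$ is *minimal* with respect to $\nabla$ if its mean curvature vector $\mu^{D_0}=\frac1{\operatorname{rank}D_0}\operatorname{trace}_{g|_{D_0}}B^{D_0}$ vanishes. An integral manifold $L$ of $D_0$ is a minimal submanifold of $M$ with respect to $\nabla$ if the trace, with respect to the metric induced on $L$, of its second fundamental form ($\mathcal F$-component of $\nabla_XY$, $X,Y\in\Gamma(TL)$) vanishes. For $X,Y\in\Gamma(D_0)$, let $\tilde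 h(X,Y)$ be the $\mathcal E$-component of $\bar\nabla_XY$. **Proposition.** Suppose that $D_0$ is integrable, i.e. $[X,Y]\in\Gamma(D_0)$ for all (local) $X,Y\in\Gamma(D_0)$. Then: 1. $D_0$ is minimal with respect to the induced connection $\nabla$ on $M$, and all its integral manifolds are minimal submanifolds of $M$ with respect to $\nabla$. 2. $\operatorname{trace}_{g|_{D_0}}(\tilde h)=0$, and all integral manifolds of $D_0$ are minimal submanifolds of $\bar M$ (with respect to $\bar\nabla$ and $\bar g$). -/

import Mathlib

open scoped Manifold ContDiff
open Bundle

noncomputable section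

namespace LightlikeGeometry

/-! ## Linear algebra -/

section LinearAlgebra

variable {X Y : Type*} [AddCommGroup X] [Module ℝ X] [AddCommGroup Y] [Module ℝ Y]

open Classical in
/-- The projection of `X = A ⊕ B` onto `A` along `B`. -/
def projAlong (A B : Submodule ℝ X) : X →ₗ[ℝ] X :=
  if h : IsCompl A B then A.projection B h else 0

open Classical in
/-- For an injective linear map `f : X → Y` and `Y = f(X) ⊕ B`, the linear map that sends
`f x + b` to `x`. -/
def tangentialPart (f : X →ₗ[ℝ] Y) (B : Submodule ℝ Y) : Y →ₗ[ℝ] X :=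
  if h : Function.Injective f ∧ IsCompl (LinearMap.range f) B then
    (LinearEquiv.ofInjective f h.1).symm.toLinearMap ∘ₗ (LinearMap.range f).projectionOnto B h.2
  else 0

/-- The trace of the bilinear map `b` with respect to the nondegenerate symmetric bilinear form
`G`: it is `∑ Gⁱʲ b(eᵢ, eⱼ)` for a basis `e`, where `Gⁱʲ` is the inverse of the Gram matrix
of `e`; in a `G`-orthonormal basis this is `∑ εᵢ b(eᵢ, eᵢ)`. -/
def metricTrace [FiniteDimensional ℝ X] (G : X → X → ℝ) (b : X → X → Y) : Y :=
  let e := Module.finBasis ℝ X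
  ∑ i, ∑ j, (Matrix.of fun i j => G (e i) (e j))⁻¹ i j • b (e i) (e j)

/-- Nondegeneracy of the bilinear form `G` on the subspace `A`. -/
def NondegenerateOn (G : X → X → ℝ) (A : Submodule ℝ X) : Prop :=
  ∀ a ∈ A, (∀ b ∈ A, G a b = 0) → a = 0

end LinearAlgebra

/-! ## Vector fields, distributions, connections

All manifolds are modelled on a finite-dimensional real vector space, without boundary. -/

section Basics

variable {V : Type*} [NormedAddCommGroup V] [NormedSpace ℝ V]
  {N : Type*} [TopologicalSpace N] [ChartedSpace V N]
  {W : Type*} [NormedAddCommGroup W] [NormedSpace ℝ W]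
  {M : Type*} [TopologicalSpace M] [ChartedSpace W M]

instance tangentSpace_finiteDimensional [FiniteDimensional ℝ V] (x : N) :
    FiniteDimensional ℝ (TangentSpace 𝓘(ℝ, V) x) :=
  inferInstanceAs (FiniteDimensional ℝ V)

variable (V N) in
/-- (Not necessarily smooth) vector fields. -/
abbrev VField := ∀ x : N, TangentSpace 𝓘(ℝ, V) x

variable (V N) in
/-- (Not necessarily smooth) `(0,2)`-tensor fields. -/
abbrev Tensor02 := ∀ x : N, LinearMap.BilinForm ℝ (TangentSpace 𝓘(ℝ, V) x)

variable (V N) in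
/-- Distributions (fields of subspaces of the tangent spaces). -/
abbrev TangentDistribution := ∀ x : N, Submodule ℝ (TangentSpace 𝓘(ℝ, V) x)

variable (V N) in
/-- Operators `Y ↦ (x, v ↦ ∇_v Y (x))` on vector fields. -/
abbrev DiffOp := VField V N → ∀ x : N, TangentSpace 𝓘(ℝ, V) x →ₗ[ℝ] TangentSpace 𝓘(ℝ, V) x

/-- The vector field `Y` is smooth on the set `s`. -/
def SmoothOn [IsManifold 𝓘(ℝ, V) 1 N] (Y : VField V N) (s : Set N) : Prop :=
  ContMDiffOn 𝓘(ℝ, V) 𝓘(ℝ, V).tangent ∞ (fun x => (⟨x, Y x⟩ : TangentBundle 𝓘(ℝ, V) N)) s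

/-- The vector field `Y` is differentiable at `x`. -/
def DiffAt [IsManifold 𝓘(ℝ, V) 1 N] (Y : VField V N) (x : N) : Prop :=
  MDifferentiableAt 𝓘(ℝ, V) 𝓘(ℝ, V).tangent (fun y => (⟨y, Y y⟩ : TangentBundle 𝓘(ℝ, V) N)) x

/-- A distribution is smooth if locally it has a frame of smooth vector fields. -/
def IsSmoothDistribution [IsManifold 𝓘(ℝ, V) 1 N] (D : TangentDistribution V N) : Prop :=
  ∀ x : N, ∃ s : Set N, IsOpen s ∧ x ∈ s ∧ ∃ (k : ℕ) (X : Fin k → VField V N),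
    (∀ a, SmoothOn (X a) s) ∧
    ∀ y ∈ s, LinearIndependent ℝ (fun a => X a y) ∧
      Submodule.span ℝ (Set.range fun a => X a y) = D y

/-- A distribution is integrable (involutive) if the bracket of any two (locally defined) smooth
sections of it is again a section of it. -/
def IsIntegrable [IsManifold 𝓘(ℝ, V) 1 N] (D : TangentDistribution V N) : Prop :=
  ∀ s : Set N, IsOpen s → ∀ X Y : VField V N, SmoothOn X s → SmoothOn Y s →
    (∀ x ∈ s, X x ∈ D x ∧ Y x ∈ D x) →
    ∀ x ∈ s, VectorField.mlieBracket 𝓘(ℝ, V) X Y x ∈ D x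

/-- `∇` is the Levi-Civita connection of the semi-Riemannian metric `g`: it is torsion-free and
`g` is parallel. -/
structure IsLeviCivita [IsManifold 𝓘(ℝ, V) 1 N] (g : Tensor02 V N)
    (nab : CovariantDerivative 𝓘(ℝ, V) V (TangentSpace 𝓘(ℝ, V) : N → Type _)) : Prop where
  torsion_free : ∀ (x : N) (X Y : VField V N), DiffAt X x → DiffAt Y x →
    nab Y x (X x) - nab X x (Y x) = VectorField.mlieBracket 𝓘(ℝ, V) X Y x
  metric : ∀ (x : N) (v : TangentSpace 𝓘(ℝ, V) x) (Y Z : VField V N), DiffAt Y x → DiffAt Z x →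
    mvfderiv 𝓘(ℝ, V) (fun y => g y (Y y) (Z y)) x v = g x (nab Y x v) (Z x) + g x (Y x) (nab Z x v)

/-- The operator on vector fields given by a covariant derivative. -/
def opOf [IsManifold 𝓘(ℝ, V) 1 N]
    (nab : CovariantDerivative 𝓘(ℝ, V) V (TangentSpace 𝓘(ℝ, V) : N → Type _)) :
    DiffOp V N :=
  fun Y x => (nab Y x).toLinearMap

/-- The differential of `f : M → N` at `p`, as a linear map. -/
def dmap (f : M → N) (p : M) :
    TangentSpace 𝓘(ℝ, W) p →ₗ[ℝ] TangentSpace 𝓘(ℝ, V) (f p) :=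
  (mfderiv 𝓘(ℝ, W) 𝓘(ℝ, V) f p).toLinearMap

open Classical in
/-- Covariant derivative of a vector field `Y` along a map `f : M → N`: if `Ỹ` is a vector field
on `N`, differentiable at `f p`, that extends `Y` near `p` (that is, `Ỹ ∘ f = Y` near `p`),
then `∇_v Y := ∇_{df v} Ỹ` for `v ∈ T_p M`. For a connection this does not depend on `Ỹ`. -/
def covAlong [IsManifold 𝓘(ℝ, V) 1 N]
    (nab : DiffOp V N) (f : M → N) (Y : ∀ p : M, TangentSpace 𝓘(ℝ, V) (f p)) (p : M) :
    TangentSpace 𝓘(ℝ, W) p →ₗ[ℝ] TangentSpace 𝓘(ℝ, V) (f p) :=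
  if h : ∃ Z : VField V N, DiffAt Z (f p) ∧ ∀ᶠ q in nhds p, Z (f q) = Y q then
    nab h.choose (f p) ∘ₗ dmap f p
  else 0

/-- The pullback `f^* g`. -/
def pullbackMetric (g : Tensor02 V N) (f : M → N) : Tensor02 W M :=
  fun p => (g (f p)).comp (dmap f p) (dmap f p)

/-- The `g`-orthogonal complement of the image of `df`, for `f : M → N`. -/
def normalSpace (g : Tensor02 V N) (f : M → N) (p : M) :
    Submodule ℝ (TangentSpace 𝓘(ℝ, V) (f p)) where
  carrier := {w | ∀ v : TangentSpace 𝓘(ℝ, W) p, g (f p) w (dmap f p v) = 0}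
  zero_mem' := by simp
  add_mem' := by
    intro a b ha hb v
    have h1 := ha v
    have h2 := hb v
    simp [h1, h2]
  smul_mem' := by
    intro c a ha v
    have h1 := ha v
    simp [h1]

end Basics

/-! ## Mean curvature of submanifolds and of distributions -/

section MeanCurvature

variable {V : Type*} [NormedAddCommGroup V] [NormedSpace ℝ V]
  {N : Type*} [TopologicalSpace N] [ChartedSpace V N]
  {W : Type*} [NormedAddCommGroup W] [NormedSpace ℝ W]
  {M : Type*} [TopologicalSpace M] [ChartedSpace W M]

/-- Second fundamental form of an immersed submanifold `f : M → N` with respect to the operator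
`nab` and the transversal spaces `T p`, `T_{f p} N = df (T_p M) ⊕ T p`: the `T`-component of
`∇_u (df Y)`, where `Y` is a vector field with `Y p = v`. -/
def secondFundamentalForm [IsManifold 𝓘(ℝ, V) 1 N] [IsManifold 𝓘(ℝ, W) 1 M]
    (nab : DiffOp V N) (f : M → N) (T : ∀ p : M, Submodule ℝ (TangentSpace 𝓘(ℝ, V) (f p)))
    (p : M) (u v : TangentSpace 𝓘(ℝ, W) p) : TangentSpace 𝓘(ℝ, V) (f p) :=
  projAlong (T p) (LinearMap.range (dmap (W := W) f p))
    (covAlong nab f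
      (fun q : M => dmap (W := W) f q
        (FiberBundle.extend W (E := (TangentSpace 𝓘(ℝ, W) : M → Type _)) v q)) p u)

/-- Mean curvature vector of an immersed submanifold `f : M → N` with respect to `nab`, the
transversal spaces `T` and the metric induced from `g`. -/
def submanifoldMeanCurvature [IsManifold 𝓘(ℝ, V) 1 N] [FiniteDimensional ℝ W] [IsManifold 𝓘(ℝ, W) 1 M]
    (nab : DiffOp V N) (g : Tensor02 V N) (f : M → N)
    (T : ∀ p : M, Submodule ℝ (TangentSpace 𝓘(ℝ, V) (f p))) (p : M) :
    TangentSpace 𝓘(ℝ, V) (f p) :=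
  (Module.finrank ℝ W : ℝ)⁻¹ •
    metricTrace (fun u v => pullbackMetric (W := W) g f p u v) (secondFundamentalForm nab f T p)

/-- A submanifold is minimal if its mean curvature vector vanishes. -/
def IsMinimalSubmanifold [IsManifold 𝓘(ℝ, V) 1 N] [FiniteDimensional ℝ W] [IsManifold 𝓘(ℝ, W) 1 M]
    (nab : DiffOp V N) (g : Tensor02 V N) (f : M → N)
    (T : ∀ p : M, Submodule ℝ (TangentSpace 𝓘(ℝ, V) (f p))) : Prop :=
  ∀ p : M, submanifoldMeanCurvature (W := W) nab g f T p = 0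

/-- A (local) section of the distribution `D` near `p` whose value at `p` is the `D`-component
of `v`, `F` being a complement of `D`. -/
def sectionThrough [IsManifold 𝓘(ℝ, W) 1 M] (D F : TangentDistribution W M) (p : M)
    (v : TangentSpace 𝓘(ℝ, W) p) : VField W M :=
  fun q => projAlong (D q) (F q) 
    (FiberBundle.extend W (E := (TangentSpace 𝓘(ℝ, W) : M → Type _)) v q)

/-- The form `(X, Y) ↦ p_F (∇_{X₀} Y₀)`, where `TM = D ⊕ F` and `X₀, Y₀` are the `D`-components
of `X, Y` (unsymmetrized second fundamental form of `D`). -/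
def unsymSecondFF [IsManifold 𝓘(ℝ, W) 1 M] (nab : DiffOp W M) (D F : TangentDistribution W M) (p : M)
    (x y : TangentSpace 𝓘(ℝ, W) p) : TangentSpace 𝓘(ℝ, W) p :=
  projAlong (F p) (D p) (nab (sectionThrough D F p y) p (projAlong (D p) (F p) x))

/-- The symmetrized second fundamental form of `D`. -/
def symSecondFF [IsManifold 𝓘(ℝ, W) 1 M] (nab : DiffOp W M) (D F : TangentDistribution W M) (p : M)
    (x y : TangentSpace 𝓘(ℝ, W) p) : TangentSpace 𝓘(ℝ, W) p :=
  (2⁻¹ : ℝ) • (unsymSecondFF nab D F p x y + unsymSecondFF nab D F p y x)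

/-- The mean curvature vector of the distribution `D`, `TM = D ⊕ F`, with respect to `nab`; the
trace is taken over `D` with respect to `g`. -/
def distributionMeanCurvature [FiniteDimensional ℝ W] [IsManifold 𝓘(ℝ, W) 1 M]
    (nab : DiffOp W M) (g : Tensor02 W M) (D F : TangentDistribution W M) (p : M) :
    TangentSpace 𝓘(ℝ, W) p :=
  (Module.finrank ℝ (D p) : ℝ)⁻¹ •
    metricTrace (fun x y : D p => g p x y) (fun x y : D p => symSecondFF nab D F p x y)

/-- A distribution is minimal if its mean curvature vector vanishes. -/
def IsMinimalDistribution [FiniteDimensional ℝ W] [IsManifold 𝓘(ℝ, W) 1 M]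
    (nab : DiffOp W M) (g : Tensor02 W M) (D F : TangentDistribution W M) : Prop :=
  ∀ p, distributionMeanCurvature nab g D F p = 0

/-- The immersion `j : M → N` is an integral manifold of the distribution `D` on `N`: it is
injective and `dj (T_p M) = D (j p)` for all `p`. -/
structure IsIntegralManifold (D : TangentDistribution V N) (j : M → N) : Prop where
  immersion : Manifold.IsImmersion 𝓘(ℝ, W) 𝓘(ℝ, V) ∞ j
  injective : Function.Injective j
  tangent : ∀ p : M, LinearMap.range (dmap (W := W) j p) = D (j p)

end MeanCurvature

/-! ## Indefinite metric g.f.f-manifolds and indefinite S-manifolds -/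

section GFF

variable (V : Type*) [NormedAddCommGroup V] [NormedSpace ℝ V]
  (N : Type*) [TopologicalSpace N] [ChartedSpace V N] [IsManifold 𝓘(ℝ, V) ∞ N]

/-- An indefinite metric globally framed `f`-structure `(φ, ξ_α, η^α, g)`, `α = 1, …, r`. -/
structure IndefiniteGFF (r : ℕ) where
  φ : ∀ x : N, TangentSpace 𝓘(ℝ, V) x →L[ℝ] TangentSpace 𝓘(ℝ, V) x
  ξ : Fin r → VField V N
  η : Fin r → ∀ x : N, TangentSpace 𝓘(ℝ, V) x →L[ℝ] ℝ
  g : ∀ x : N, TangentSpace 𝓘(ℝ, V) x →L[ℝ] TangentSpace 𝓘(ℝ, V) x →L[ℝ] ℝ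
  /-- the causal characters of the `ξ_α` -/
  ε : Fin r → ℝ
  /-- the index of the metric -/
  ν : ℕ
  φ_smooth : ContMDiff 𝓘(ℝ, V) (𝓘(ℝ, V).prod 𝓘(ℝ, V →L[ℝ] V)) ∞
    (fun x => TotalSpace.mk' (V →L[ℝ] V)
      (E := fun y : N => TangentSpace 𝓘(ℝ, V) y →L[ℝ] TangentSpace 𝓘(ℝ, V) y) x (φ x))
  ξ_smooth : ∀ a, SmoothOn (ξ a) Set.univ
  η_smooth : ∀ a, ContMDiff 𝓘(ℝ, V) (𝓘(ℝ, V).prod 𝓘(ℝ, V →L[ℝ] ℝ)) ∞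
    (fun x => TotalSpace.mk' (V →L[ℝ] ℝ)
      (E := fun y : N => TangentSpace 𝓘(ℝ, V) y →L[ℝ] Bundle.Trivial N ℝ y) x (η a x))
  g_smooth : ContMDiff 𝓘(ℝ, V) (𝓘(ℝ, V).prod 𝓘(ℝ, V →L[ℝ] V →L[ℝ] ℝ)) ∞
    (fun x => TotalSpace.mk' (V →L[ℝ] V →L[ℝ] ℝ)
      (E := fun y : N => TangentSpace 𝓘(ℝ, V) y →L[ℝ] TangentSpace 𝓘(ℝ, V) y →L[ℝ] ℝ) x (g x))
  φ_ne_zero : ∀ x, φ x ≠ 0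
  /-- the `ξ_α` trivialize `ker φ` (which is why `φ` has constant rank) -/
  ker_φ : ∀ x, LinearMap.ker (φ x).toLinearMap = Submodule.span ℝ (Set.range fun a => ξ a x)
  φ_sq : ∀ x v, φ x (φ x v) = -v + ∑ a, η a x v • ξ a x
  η_ξ : ∀ x a b, η a x (ξ b x) = if a = b then 1 else 0
  g_symm : ∀ x v w, g x v w = g x w v
  g_nondegenerate : ∀ x v, (∀ w, g x v w = 0) → v = 0
  g_index : ∀ x, sigNeg (LinearMap.BilinMap.toQuadraticMap (g x).toBilinForm) = ν
  ν_pos : 0 < ν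
  ν_lt : ν < Module.finrank ℝ V
  ε_eq : ∀ a, ε a = 1 ∨ ε a = -1
  g_ξ : ∀ x a, g x (ξ a x) (ξ a x) = ε a
  compatible : ∀ x v w,
    g x (φ x v) (φ x w) = g x v w - ∑ a, ε a * η a x v * η a x w

variable {V N}

/-- The metric, as a field of bilinear forms. -/
def IndefiniteGFF.metric {r : ℕ} (G : IndefiniteGFF V N r) : Tensor02 V N :=
  fun x => (G.g x).toBilinForm

/-- The exterior derivative of a `1`-form,
`2 dη(X, Y) = X (η(Y)) - Y (η(X)) - η([X, Y])`. -/
def dOneForm (η : ∀ x : N, TangentSpace 𝓘(ℝ, V) x →L[ℝ] ℝ) (X Y : VField V N) (x : N) : ℝ :=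
  (mvfderiv 𝓘(ℝ, V) (fun y => η y (Y y)) x (X x)
    - mvfderiv 𝓘(ℝ, V) (fun y => η y (X y)) x (Y x)
    - η x (VectorField.mlieBracket 𝓘(ℝ, V) X Y x)) / 2

/-- The Nijenhuis torsion
`N_φ(X, Y) = φ²[X, Y] + [φX, φY] - φ[φX, Y] - φ[X, φY]`. -/
def nijenhuis (φ : ∀ x : N, TangentSpace 𝓘(ℝ, V) x →L[ℝ] TangentSpace 𝓘(ℝ, V) x)
    (X Y : VField V N) : VField V N :=
  fun x => φ x (φ x (VectorField.mlieBracket 𝓘(ℝ, V) X Y x))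
    + VectorField.mlieBracket 𝓘(ℝ, V) (fun y => φ y (X y)) (fun y => φ y (Y y)) x
    - φ x (VectorField.mlieBracket 𝓘(ℝ, V) (fun y => φ y (X y)) Y x)
    - φ x (VectorField.mlieBracket 𝓘(ℝ, V) X (fun y => φ y (Y y)) x)

/-- Indefinite `S`-manifolds: the structure is normal, and `dη^α = Φ` for all `α`, where
`Φ(X, Y) = g(X, φY)`. -/
structure IndefiniteGFF.IsSManifold {r : ℕ} (G : IndefiniteGFF V N r) : Prop where
  normal : ∀ (x : N) (X Y : VField V N), DiffAt X x → DiffAt Y x →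
    nijenhuis G.φ X Y x + ∑ a, (2 * dOneForm (G.η a) X Y x) • G.ξ a x = 0
  dη : ∀ (a : Fin r) (x : N) (X Y : VField V N), DiffAt X x → DiffAt Y x →
    dOneForm (G.η a) X Y x = G.g x (X x) (G.φ x (Y x))

end GFF

/-! ## Characteristic lightlike hypersurfaces -/

section Hypersurface

variable {V : Type*} [NormedAddCommGroup V] [NormedSpace ℝ V]
  {N : Type*} [TopologicalSpace N] [ChartedSpace V N] [IsManifold 𝓘(ℝ, V) ∞ N]
  {W : Type*} [NormedAddCommGroup W] [NormedSpace ℝ W]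
  {M : Type*} [TopologicalSpace M] [ChartedSpace W M] [IsManifold 𝓘(ℝ, W) ∞ M]

/-- The radical distribution of the hypersurface `i : M → N`, as a distribution on `M`. -/
def radical (g : Tensor02 V N) (i : M → N) : TangentDistribution W M := fun p =>
  (normalSpace (W := W) g i p).comap (dmap i p)

/-- `i : M → N` is a lightlike hypersurface: a hypersurface on which the induced metric is
degenerate at every point. -/
structure IsLightlikeHypersurface (g : Tensor02 V N) (i : M → N) : Prop where
  immersion : Manifold.IsImmersion 𝓘(ℝ, W) 𝓘(ℝ, V) ∞ i
  codim : Module.finrank ℝ W + 1 = Module.finrank ℝ V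
  degenerate : ∀ p, radical (W := W) g i p ≠ ⊥

/-- A screen distribution: a smooth complement of the radical distribution in `TM`. -/
structure IsScreen (g : Tensor02 V N) (i : M → N) (S : TangentDistribution W M) : Prop where
  smooth : IsSmoothDistribution S
  isCompl : ∀ p, IsCompl (radical (W := W) g i p) (S p)

/-- The lightlike transversal bundle `ltr(M)` of `M` with respect to the screen distribution
`S`: its fibre at `p` is spanned by the vectors `n` that satisfy, for some `e ∈ Rad(T_p M)`,
`g(n, e) = 1`, `g(n, n) = 0` and `g(n, w) = 0` for all `w ∈ S p`. -/
def ltr (g : Tensor02 V N) (i : M → N) (S : TangentDistribution W M) (p : M) :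
    Submodule ℝ (TangentSpace 𝓘(ℝ, V) (i p)) :=
  Submodule.span ℝ {n | g (i p) n n = 0 ∧ (∀ w ∈ S p, g (i p) n (dmap i p w) = 0) ∧
    ∃ e ∈ radical (W := W) g i p, g (i p) n (dmap i p e) = 1}

/-- The induced connection `∇` on `M`: `∇_X Y` is the component of `∇̄_X Y` tangent to `M` in
the decomposition `TN|_M = TM ⊕ ltr(M)`. -/
def inducedConnection (g : Tensor02 V N) (nab : DiffOp V N) (i : M → N) (S : TangentDistribution W M) :
    DiffOp W M :=
  fun Y p => tangentialPart (dmap i p) (ltr g i S p) ∘ₗ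
    covAlong nab i (fun q => dmap i q (Y q)) p

variable {r : ℕ} (G : IndefiniteGFF V N r) (i : M → N) (S : TangentDistribution W M)

/-- A lightlike hypersurface is characteristic if all `ξ_α` are tangent to it. -/
structure IsCharacteristic : Prop extends IsLightlikeHypersurface (W := W) G.metric i where
  ξ_tangent : ∀ a p, G.ξ a (i p) ∈ LinearMap.range (dmap (W := W) (V := V) i p)

/-- A screen distribution is characteristic if it contains `ker φ` and `φ(Rad(TM))`. -/
structure IsCharacteristicScreen : Prop extends IsScreen G.metric i S where
  ker_le : ∀ p, LinearMap.ker (G.φ (i p)).toLinearMap ≤ (S p).map (dmap i p)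
  φ_rad_le : ∀ p, ((radical (W := W) G.metric i p).map (dmap i p)).map (G.φ (i p)).toLinearMap
    ≤ (S p).map (dmap i p)

/-- `φ(Rad(TM)) ⊕ φ(ltr(M))`, as a subbundle of `TN|_M`. -/
def phiPart (p : M) : Submodule ℝ (TangentSpace 𝓘(ℝ, V) (i p)) :=
  ((radical (W := W) G.metric i p).map (dmap i p)).map (G.φ (i p)).toLinearMap
    ⊔ (ltr G.metric i S p).map (G.φ (i p)).toLinearMap

/-- The distribution `D₀` on `M`: the orthogonal complement of `φ(Rad(TM)) ⊕ φ(ltr(M))` in the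
screen distribution. -/
def D0 : TangentDistribution W M := fun p =>
  { carrier := {v | v ∈ S p ∧ ∀ w ∈ phiPart G i S p, G.metric (i p) (dmap i p v) w = 0}
    zero_mem' := by simp
    add_mem' := by
      rintro a b ⟨ha, ha'⟩ ⟨hb, hb'⟩
      refine ⟨(S p).add_mem ha hb, fun w hw => ?_⟩
      simp [ha' w hw, hb' w hw]
    smul_mem' := by
      rintro c a ⟨ha, ha'⟩
      refine ⟨(S p).smul_mem c ha, fun w hw => ?_⟩
      simp [ha' w hw] }

/-- The distribution `F = (φ(Rad(TM)) ⊕ φ(ltr(M))) ⊥ Rad(TM)` on `M`. -/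
def Fdist : TangentDistribution W M := fun p =>
  (phiPart G i S p).comap (dmap i p) ⊔ radical (W := W) G.metric i p

/-- The bundle `E = (φ(Rad(TM)) ⊕ φ(ltr(M))) ⊥ (Rad(TM) ⊕ ltr(M))` over `M`. -/
def Ebundle (p : M) : Submodule ℝ (TangentSpace 𝓘(ℝ, V) (i p)) :=
  phiPart G i S p ⊔ ((radical (W := W) G.metric i p).map (dmap i p) ⊔ ltr G.metric i S p)

/-- The second fundamental form `h̃` of `D₀` in `N` at `p`: for `x, y ∈ D₀(p)`, the `E`-component
of `∇̄_x Y` in `TN|_M = D₀ ⊥ E`, where `Y` is a section of `D₀` with `Y p = y`. -/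
def hTilde (nab : DiffOp V N) (p : M) (x y : D0 G i S p) :
    TangentSpace 𝓘(ℝ, V) (i p) :=
  projAlong (Ebundle G i S p) ((D0 G i S p).map (dmap i p))
    (covAlong nab i
      (fun q => dmap i q (sectionThrough (D0 G i S) (Fdist G i S) p (y : TangentSpace 𝓘(ℝ, W) p) q))
      p (x : TangentSpace 𝓘(ℝ, W) p))

end Hypersurface

end LightlikeGeometry

end

open LightlikeGeometry

open LightlikeGeometry

noncomputable section

namespace LightlikeGeometry

/-! ### Linear algebra: projections, traces, and the identity behind `∇φ` -/

section Algebra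

variable {X Y : Type*} [AddCommGroup X] [Module ℝ X] [AddCommGroup Y] [Module ℝ Y]

/-! Near a point of `M` choose smooth fields `e`, `n` spanning `Rad(TM)` and `ltr(M)` with `g(e, n)
= 1` (`exists_null_frame`). Then `e, n, φe, φn` span `E`, which consists of two orthogonal
hyperbolic planes, and `D₀` is the orthogonal complement of `E`. If `Y` is a section of `D₀`,
differentiating `g(Y, e) = g(Y, n) = g(Y, φe) = g(Y, φn) = 0` moves the derivative onto the frame.
The `E`-component of `∇̄_x Y` is therefore `h(x, Y)` for an explicit bilinear form `h =
nullSecondForm` (`nullComponent_nab`). This holds also if `Y` is tangent to `D₀` only along an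
integral manifold.

Three facts make the trace of `h` over `D₀` vanish. (a) `h(x, φy) = φ h(x, y)` for `x ∈ D₀`
(`nullSecondForm_φ`). On an `S`-manifold `g((∇̄_u φ)v, z) = -(∑ ε_α η^α(v)) g(u, z)` whenever all
`η^α(z)` vanish (`covPhiForm_eq`); with `z` among `e, n, φe, φn` and `u ∈ D₀` the right side is
zero. (b) `φ² = -1` on `E`, because the `η^α` vanish on `e` and `n` (`φ_φ_nullSecondForm`). (c) `h`
is symmetric on `D₀`, by integrability and absence of torsion (`nullSecondForm_symm`). Since `φ`
preserves `D₀`, these give `h(φx, φy) = -h(x, y)` and `h(φ²x, y) = -h(x, y)`. As `φ` is `g`-skew,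
the trace equals its own negative (`metricTrace_eq_zero_of_skew`). The second relation takes care of
the directions `ξ_α ∈ D₀`, where `φ` is not invertible: it forces `h(ξ_α, ·) = 0`.

All four assertions are instances of `metricTrace_nullSecondForm`: the second fundamental forms in
question are linear images of `h`, under the identity for `N` and under the projection to `F` for
`M`, with `D₀` parametrized by its inclusion or by the differential of an integral manifold. -/

theorem projAlong_add {A B : Submodule ℝ X} (h : IsCompl A B) {a b : X} (ha : a ∈ A) (hb : b ∈ B) :
    projAlong A B (a + b) = a := by
  rw [projAlong, dif_pos h, map_add, Submodule.projection_apply_of_mem_left h ha,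
    Submodule.projection_apply_of_mem_right h hb, add_zero]

theorem projAlong_mem {A B : Submodule ℝ X} (h : IsCompl A B) (x : X) : projAlong A B x ∈ A := by
  obtain ⟨a, ha, b, hb, rfl⟩ := Submodule.mem_sup.1 (h.sup_eq_top ▸ Submodule.mem_top (x := x))
  rwa [projAlong_add h ha hb]

theorem projAlong_of_mem_left {A B : Submodule ℝ X} (h : IsCompl A B) {a : X} (ha : a ∈ A) :
    projAlong A B a = a := by
  simpa using projAlong_add h ha B.zero_mem

theorem projAlong_of_mem_right {A B : Submodule ℝ X} (h : IsCompl A B) {b : X} (hb : b ∈ B) :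
    projAlong A B b = 0 := by
  simpa using projAlong_add h A.zero_mem hb

theorem tangentialPart_add {f : X →ₗ[ℝ] Y} {B : Submodule ℝ Y} (hf : Function.Injective f)
    (h : IsCompl (LinearMap.range f) B) (x : X) {b : Y} (hb : b ∈ B) :
    tangentialPart f B (f x + b) = x := by
  rw [tangentialPart, dif_pos ⟨hf, h⟩]
  have h1 : (LinearMap.range f).projectionOnto B h (f x) = LinearEquiv.ofInjective f hf x :=
    Submodule.projectionOnto_apply_left h (LinearEquiv.ofInjective f hf x)
  have h2 : (LinearMap.range f).projectionOnto B h b = 0 :=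
    Submodule.projectionOnto_apply_right h ⟨b, hb⟩
  simp [h1, h2]

/-- The sum `∑ Aⁱʲ b(eᵢ, eⱼ)`, after a change of both arguments by linear maps. -/
theorem sum_smul_map_map {ι : Type*} [Fintype ι] [DecidableEq ι] (e : Module.Basis ι ℝ X)
    (A : Matrix ι ι ℝ) (f g : X →ₗ[ℝ] X) (b : X →ₗ[ℝ] X →ₗ[ℝ] Y) :
    ∑ i, ∑ j, A i j • b (f (e i)) (g (e j)) =
      ∑ k, ∑ l, (LinearMap.toMatrix e e f * A * (LinearMap.toMatrix e e g).transpose) k l •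
        b (e k) (e l) := by
  have key : ∀ (f : X →ₗ[ℝ] X) i, f (e i) = ∑ k, LinearMap.toMatrix e e f k i • e k := by
    intro f i
    conv_lhs => rw [← e.sum_repr (f (e i))]
    simp [LinearMap.toMatrix_apply]
  have h1 : ∀ i j, A i j • b (f (e i)) (g (e j)) = ∑ k, ∑ l,
      (LinearMap.toMatrix e e f k i * A i j * LinearMap.toMatrix e e g l j) • b (e k) (e l) := by
    intro i j
    rw [key f i, key g j]
    simp only [map_sum, map_smul, LinearMap.sum_apply, LinearMap.smul_apply, Finset.smul_sum,
      smul_smul]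
    rw [Finset.sum_comm]
    refine Finset.sum_congr rfl fun k _ => Finset.sum_congr rfl fun l _ => ?_
    congr 1
    ring
  simp only [h1]
  calc _ = ∑ i, ∑ k, ∑ l, ∑ j, (LinearMap.toMatrix e e f k i * A i j *
        LinearMap.toMatrix e e g l j) • b (e k) (e l) := by
        refine Finset.sum_congr rfl fun i _ => ?_
        rw [Finset.sum_comm]
        refine Finset.sum_congr rfl fun k _ => ?_
        rw [Finset.sum_comm]
    _ = ∑ k, ∑ l, ∑ i, ∑ j, (LinearMap.toMatrix e e f k i * A i j *
        LinearMap.toMatrix e e g l j) • b (e k) (e l) := by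
        rw [Finset.sum_comm]
        refine Finset.sum_congr rfl fun k _ => ?_
        rw [Finset.sum_comm]
    _ = _ := by
        refine Finset.sum_congr rfl fun k _ => Finset.sum_congr rfl fun l _ => ?_
        simp only [← Finset.sum_smul]
        congr 1
        rw [Finset.sum_comm]
        simp only [Matrix.mul_apply, Matrix.transpose_apply, Finset.sum_mul]

/-- The trace of a bilinear map that is anti-invariant under a skew-symmetric endomorphism
vanishes. -/
theorem metricTrace_eq_zero_of_skew [FiniteDimensional ℝ X] (G : LinearMap.BilinForm ℝ X)
    (φ : X →ₗ[ℝ] X) (hφ : ∀ x y, G (φ x) y = -G x (φ y)) (b : X →ₗ[ℝ] X →ₗ[ℝ] Y)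
    (hb : ∀ x y, b (φ x) (φ y) = -b x y) (hb2 : ∀ x y, b (φ (φ x)) y = -b x y) :
    metricTrace (fun x y => G x y) (fun x y => b x y) = 0 := by
  classical
  unfold metricTrace
  set e := Module.finBasis ℝ X
  set A : Matrix _ _ ℝ := Matrix.of fun i j => G (e i) (e j) with hA
  set P := LinearMap.toMatrix e e φ with hP
  have hAG : A = LinearMap.BilinForm.toMatrix e G := by
    ext i j
    simp [hA]
  change ∑ i, ∑ j, A⁻¹ i j • b (e i) (e j) = 0
  -- For a singular Gram matrix the matrix inverse is zero by convention, and so is the trace; hence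
  -- nondegeneracy of `G` is not needed.
  by_cases hu : IsUnit A.det
  swap
  · simp [Matrix.nonsing_inv_apply_not_isUnit A hu]
  have hskew : P.transpose * A = -(A * P) := by
    have h1 := LinearMap.BilinForm.toMatrix_compLeft e G φ
    have h2 := LinearMap.BilinForm.toMatrix_compRight e G φ
    rw [hAG, hP, ← h1, ← h2, ← map_neg]
    congr 1
    ext x y
    simp [hφ]
  have hinv : A⁻¹ * P.transpose = -(P * A⁻¹) := by
    have h1 : A⁻¹ * (P.transpose * A) * A⁻¹ = -(A⁻¹ * (A * P) * A⁻¹) := by rw [hskew]; simp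
    rwa [← Matrix.mul_assoc, Matrix.mul_assoc (A⁻¹ * P.transpose), Matrix.mul_nonsing_inv _ hu,
      Matrix.mul_one, ← Matrix.mul_assoc, Matrix.nonsing_inv_mul _ hu, Matrix.one_mul] at h1
  -- Skewness gives `P A⁻¹ Pᵀ = -P² A⁻¹`. So `e1` and `hb` say that the trace is the sum with
  -- coefficients `P² A⁻¹`, while by `e2` and `hb2` that same sum is minus the trace.
  have e1 := sum_smul_map_map e A⁻¹ φ φ b
  have e2 := sum_smul_map_map e A⁻¹ (φ ∘ₗ φ) LinearMap.id b
  rw [← hP, Matrix.mul_assoc, hinv] at e1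
  rw [LinearMap.toMatrix_comp e e e, ← hP] at e2
  simp only [hb, smul_neg, Finset.sum_neg_distrib, Matrix.mul_neg, Matrix.neg_apply, neg_smul,
    neg_inj] at e1
  simp only [LinearMap.comp_apply, LinearMap.id_apply, hb2, smul_neg, Finset.sum_neg_distrib,
    LinearMap.toMatrix_id, Matrix.transpose_one, Matrix.mul_one, Matrix.mul_assoc] at e2
  rw [← e1] at e2
  have : IsAddTorsionFree Y := IsAddTorsionFree.of_isTorsionFree ℝ Y
  exact self_eq_neg.1 e2.symm

/-- The algebraic core of the formula for the covariant derivative of `φ` on an `S`-manifold: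
`T x y z` stands for `g((∇_x φ)y, z)` and `β a x y` for `g(∇_x ξ_a, y)`. -/
theorem covPhi_algebra {r : ℕ} (g : LinearMap.BilinForm ℝ X) (φ : X →ₗ[ℝ] X) (ξ : Fin r → X)
    (η : Fin r → X →ₗ[ℝ] ℝ) (ε : Fin r → ℝ) (T : X →ₗ[ℝ] X →ₗ[ℝ] X →ₗ[ℝ] ℝ)
    (β : Fin r → X →ₗ[ℝ] X →ₗ[ℝ] ℝ)
    (g_symm : ∀ x y, g x y = g y x) (hε : ∀ a, ε a * ε a = 1)
    (φ_sq : ∀ x, φ (φ x) = -x + ∑ a, η a x • ξ a) (φ_ξ : ∀ a, φ (ξ a) = 0)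
    (η_φ : ∀ a x, η a (φ x) = 0) (g_ξ : ∀ a x, g x (ξ a) = ε a * η a x)
    (skew : ∀ x y z, T x y z = -T x z y)
    (cyc : ∀ x y z, T x y z + T y z x + T z x y = 0)
    (normal : ∀ x y z, (∀ a, η a z = 0) →
      T (φ x) y z - T (φ y) x z + T x y (φ z) - T y x (φ z) = 0)
    (phi_sq : ∀ x y z, (∀ a, η a y = 0) → (∀ a, η a z = 0) → T x (φ y) z = T x y (φ z))
    (T_ξ : ∀ a x z, T x (ξ a) z = β a x (φ z))
    (dη : ∀ a x y, ε a * (β a x y - β a y x) = 2 * g x (φ y))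
    (β_ξ : ∀ a b x, β a x (ξ b) + β b x (ξ a) = 0)
    (x y z : X) (hz : ∀ a, η a z = 0) :
    T x y z = -(∑ a, ε a * η a y) * g x z := by
  have sq : ∀ x, (∀ a, η a x = 0) → φ (φ x) = -x := by
    intro x hx
    simp [φ_sq, hx]
  have hφ : ∀ x a, η a (φ x) = 0 := fun x a => η_φ a x
  -- `T` vanishes on the contact distribution
  have A0 : ∀ x y z, (∀ a, η a x = 0) → (∀ a, η a y = 0) → (∀ a, η a z = 0) →
      T (φ x) y z = -T x y (φ z) := by
    -- The form `T(φx, y, z) + T(x, y, φz)` is symmetric in `x, y` by normality and skew in `y, z`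
    -- because `φ` is skew and anticommutes with `∇φ`. A trilinear form with both properties is
    -- zero.
    have sy : ∀ x y z, (∀ a, η a x = 0) → (∀ a, η a y = 0) → (∀ a, η a z = 0) →
        T (φ x) y z + T x y (φ z) = T (φ y) x z + T y x (φ z) := by
      intro x y z _ _ hz
      linarith [normal x y z hz]
    have sk : ∀ x y z, (∀ a, η a x = 0) → (∀ a, η a y = 0) → (∀ a, η a z = 0) →
        T (φ x) y z + T x y (φ z) = -(T (φ x) z y + T x z (φ y)) := by
      intro x y z _ hy hz
      linarith [skew (φ x) y z, phi_sq x z y hz hy, skew x y (φ z)]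
    intro x y z hx hy hz
    linarith [sy x y z hx hy hz, sk x y z hx hy hz, sy y z x hy hz hx, sk y z x hy hz hx,
      sy z x y hz hx hy, sk z x y hz hx hy]
  have T0 : ∀ x y z, (∀ a, η a x = 0) → (∀ a, η a y = 0) → (∀ a, η a z = 0) → T y z x = 0 := by
    intro x y z hx hy hz
    -- Rewritten by `A0` and `phi_sq`, this cyclic sum is the one for `x, y, z` with the sign of the
    -- middle term changed; the difference of the two is `2 T y z x`.
    have h1 := cyc (φ x) y (φ z)
    have h2 := A0 x y (φ z) hx hy (hφ z)
    have h3 := phi_sq y z (φ x) hz (hφ x)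
    have h4 := A0 z (φ x) y hz (hφ x) hy
    have h5 := phi_sq z x (φ y) hx (hφ y)
    rw [sq z hz] at h2
    rw [sq x hx] at h3
    rw [sq y hy] at h5
    simp only [map_neg] at h2 h3 h5
    linarith [cyc x y z]
  -- the value on `ξ a`
  have B0 : ∀ a y z, (∀ b, η b y = 0) → (∀ b, η b z = 0) → T y (ξ a) z = -(ε a * g y z) := by
    -- Normality with `ξ a` in the first slot, combined with the cyclic identity. It yields `b2`,
    -- the Killing equation for `ξ a` on the contact distribution, so that `dη` determines `β a`
    -- there completely.
    have b1 : ∀ a y z, (∀ b, η b y = 0) → (∀ b, η b z = 0) →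
        T (φ y) (ξ a) z = -T (φ z) (ξ a) y := by
      intro a y z hy hz
      have h1 := normal (ξ a) y z hz
      rw [φ_ξ] at h1
      simp only [map_zero, LinearMap.zero_apply] at h1
      linarith [cyc (ξ a) y (φ z), skew y (φ z) (ξ a)]
    have b2 : ∀ a y z, (∀ b, η b y = 0) → (∀ b, η b z = 0) → β a y z = -β a z y := by
      intro a y z hy hz
      have h1 := b1 a (φ y) (φ z) (hφ y) (hφ z)
      rw [T_ξ, T_ξ, sq y hy, sq z hz] at h1
      simpa using h1
    intro a y z hy hz
    have h1 := dη a y (φ z)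
    rw [← neg_eq_iff_eq_neg.2 (b2 a y (φ z) hy (hφ z)), sq z hz, map_neg] at h1
    rw [T_ξ]
    have h2 : β a y (φ z) = ε a * (ε a * β a y (φ z)) := by rw [← mul_assoc, hε, one_mul]
    rw [h2]
    have h3 : ε a * β a y (φ z) = -g y z := by linarith
    rw [h3]
    ring
  have C0 : ∀ a y z, (∀ b, η b y = 0) → (∀ b, η b z = 0) → T (ξ a) y z = 0 := by
    intro a y z hy hz
    linarith [cyc (ξ a) y z, skew y z (ξ a), B0 a y z hy hz, B0 a z y hz hy,
      congrArg (ε a * ·) (g_symm y z)]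
  -- By normality `T (ξ a) (ξ b) z` is symmetric in `a, b`; by `f` and `β_ξ` it is skew.
  have D0 : ∀ a b z, (∀ c, η c z = 0) → T (ξ a) (ξ b) z = 0 := by
    intro a b z hz
    have f : ∀ a b, T (ξ a) (ξ b) z = β b (φ z) (ξ a) := by
      intro a b
      have h1 := dη b (ξ a) (φ z)
      rw [sq z hz, map_neg, g_symm, g_ξ, hz, mul_zero, neg_zero, mul_zero] at h1
      have h2 : ε b ≠ 0 := fun h => by simpa [h] using hε b
      rw [T_ξ]
      linarith [(mul_eq_zero.1 h1).resolve_left h2]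
    have h1 := normal (ξ a) (ξ b) (φ z) (hφ z)
    rw [φ_ξ, φ_ξ, sq z hz] at h1
    simp only [map_zero, LinearMap.zero_apply, map_neg] at h1
    linarith [f a b, f b a, β_ξ a b (φ z)]
  -- Splitting into a contact vector and a combination of the `ξ a` reduces the claim to the cases
  -- already settled.
  have dec : ∀ x, x = -φ (φ x) + ∑ a, η a x • ξ a := by
    intro x
    rw [φ_sq]
    abel
  have hH : ∀ x a, η a (-φ (φ x)) = 0 := fun x a => by rw [map_neg, η_φ, neg_zero]
  have e1 : ∀ x, T x y z = T x (-φ (φ y)) z + ∑ a, η a y * T x (ξ a) z := by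
    intro x
    conv_lhs => rw [dec y]
    simp only [map_add, map_sum, map_smul, LinearMap.add_apply, LinearMap.sum_apply,
      LinearMap.smul_apply, smul_eq_mul]
  have e2 : ∀ w, T x w z = T (-φ (φ x)) w z + ∑ a, η a x * T (ξ a) w z := by
    intro w
    conv_lhs => rw [dec x]
    simp only [map_add, map_sum, map_smul, LinearMap.add_apply, LinearMap.sum_apply,
      LinearMap.smul_apply, smul_eq_mul]
  have e3 : g x z = g (-φ (φ x)) z := by
    conv_lhs => rw [dec x]
    simp [g_symm _ z, g_ξ, hz]
  rw [e1, e2, T0 z _ _ hz (hH x) (hH y)]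
  simp only [e2 (ξ _), C0 _ _ z (hH y) hz, D0 _ _ z hz, B0 _ _ z (hH x) hz, mul_zero,
    Finset.sum_const_zero, add_zero, zero_add, e3]
  rw [neg_mul, Finset.sum_mul, ← Finset.sum_neg_distrib]
  exact Finset.sum_congr rfl fun a _ => by ring

end Algebra

/-! ### The Lie bracket as a commutator of derivations -/

section Commutator

open Filter Topology VectorField

variable {V : Type*} [NormedAddCommGroup V] [NormedSpace ℝ V]
  {N : Type*} [TopologicalSpace N] [ChartedSpace V N]
  {E : Type*} [NormedAddCommGroup E] [NormedSpace ℝ E]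

theorem mvfderiv_comp_vector {W : Type*} [NormedAddCommGroup W] [NormedSpace ℝ W]
    {M : Type*} [TopologicalSpace M] [ChartedSpace W M] {F : N → E} {f : M → N} {p : M}
    (hF : MDifferentiableAt 𝓘(ℝ, V) 𝓘(ℝ, E) F (f p))
    (hf : MDifferentiableAt 𝓘(ℝ, W) 𝓘(ℝ, V) f p) (u : TangentSpace 𝓘(ℝ, W) p) :
    mvfderiv 𝓘(ℝ, W) (F ∘ f) p u = mvfderiv 𝓘(ℝ, V) F (f p) (mfderiv 𝓘(ℝ, W) 𝓘(ℝ, V) f p u) :=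
  mfderiv_comp_apply p hF hf u

theorem mvfderiv_congr {F F' : N → E} {x : N} (h : F =ᶠ[𝓝 x] F') (v : TangentSpace 𝓘(ℝ, V) x) :
    mvfderiv 𝓘(ℝ, V) F x v = mvfderiv 𝓘(ℝ, V) F' x v :=
  DFunLike.congr_fun (h.mfderiv_eq (I := 𝓘(ℝ, V)) (I' := 𝓘(ℝ, E))) v

variable [IsManifold 𝓘(ℝ, V) ∞ N]

/-- The components of the vector field `Y` in the chart at `x`. -/
def chartField (x : N) (Y : VField V N) (z : V) : V :=
  mpullbackWithin 𝓘(ℝ, V) 𝓘(ℝ, V) (extChartAt 𝓘(ℝ, V) x).symm Y (Set.range 𝓘(ℝ, V)) z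

theorem differentiableAt_chartField [CompleteSpace V] {x : N} {Y : VField V N} (hY : DiffAt Y x) :
    DifferentiableAt ℝ (chartField x Y) (extChartAt 𝓘(ℝ, V) x x) := by
  have h := MDifferentiableWithinAt.differentiableWithinAt_mpullbackWithin_vectorField
    (I := 𝓘(ℝ, V)) (s := Set.univ) (V := Y) (x := x) (by
      rw [mdifferentiableWithinAt_univ]; exact hY)
  have hu : (extChartAt 𝓘(ℝ, V) x).symm ⁻¹' Set.univ ∩ Set.range 𝓘(ℝ, V) = Set.univ := by
    rw [ModelWithCorners.range_eq_univ, Set.preimage_univ, Set.univ_inter]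
  rw [hu] at h
  exact differentiableWithinAt_univ.1 h

theorem chartField_extChartAt {x y : N} (hy : y ∈ (extChartAt 𝓘(ℝ, V) x).source)
    (Y : VField V N) :
    chartField x Y (extChartAt 𝓘(ℝ, V) x y) =
      mfderiv 𝓘(ℝ, V) 𝓘(ℝ, V) (extChartAt 𝓘(ℝ, V) x) y (Y y) := by
  have hz : (extChartAt 𝓘(ℝ, V) x).symm (extChartAt 𝓘(ℝ, V) x y) = y :=
    (extChartAt 𝓘(ℝ, V) x).left_inv hy
  have hy' := (extChartAt 𝓘(ℝ, V) x).map_source hy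
  unfold chartField
  rw [mpullbackWithin_apply, ContinuousLinearMap.inverse_eq
    (mfderivWithin_extChartAt_symm_comp_mfderiv_extChartAt hy')
    (mfderiv_extChartAt_comp_mfderivWithin_extChartAt_symm hy'), hz]

theorem mlieBracket_eq_lieBracket_chartField (X Y : VField V N) (x : N) :
    mlieBracket 𝓘(ℝ, V) X Y x =
      lieBracket ℝ (chartField x X) (chartField x Y) (extChartAt 𝓘(ℝ, V) x x) := by
  have h : ∀ w : V, (mfderiv 𝓘(ℝ, V) 𝓘(ℝ, V) (extChartAt 𝓘(ℝ, V) x) x).inverse w = w := by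
    intro w
    rw [mfderiv_extChartAt_self]
    exact DFunLike.congr_fun (ContinuousLinearMap.inverse_id (R := ℝ) (M := V)) w
  rw [mlieBracket, mlieBracketWithin_apply]
  refine (h _).trans ?_
  rw [Set.preimage_univ, Set.univ_inter, ← lieBracketWithin_univ,
    ModelWithCorners.range_eq_univ]
  unfold chartField
  rw [ModelWithCorners.range_eq_univ]

/-- The chart is centred at `x` while `y` varies over its domain, so the identity may be
differentiated once more at `x`. -/
theorem mvfderiv_eq_fderiv_chart {F : N → E} {x y : N} (hy : y ∈ (extChartAt 𝓘(ℝ, V) x).source)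
    (hF : MDifferentiableAt 𝓘(ℝ, V) 𝓘(ℝ, E) F y) (Y : VField V N) :
    mvfderiv 𝓘(ℝ, V) F y (Y y) =
      fderiv ℝ (F ∘ (extChartAt 𝓘(ℝ, V) x).symm) (extChartAt 𝓘(ℝ, V) x y)
        (chartField x Y (extChartAt 𝓘(ℝ, V) x y)) := by
  rw [chartField_extChartAt hy]
  have hz : (extChartAt 𝓘(ℝ, V) x).symm (extChartAt 𝓘(ℝ, V) x y) = y :=
    (extChartAt 𝓘(ℝ, V) x).left_inv hy
  have hy' := (extChartAt 𝓘(ℝ, V) x).map_source hy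
  have hs : MDifferentiableAt 𝓘(ℝ, V) 𝓘(ℝ, V) (extChartAt 𝓘(ℝ, V) x).symm
      (extChartAt 𝓘(ℝ, V) x y) := by
    have := mdifferentiableWithinAt_extChartAt_symm hy'
    rwa [ModelWithCorners.range_eq_univ, mdifferentiableWithinAt_univ] at this
  have hF' : MDifferentiableAt 𝓘(ℝ, V) 𝓘(ℝ, E) (F ∘ (extChartAt 𝓘(ℝ, V) x).symm)
      (extChartAt 𝓘(ℝ, V) x y) := by
    apply MDifferentiableAt.comp _ _ hs
    rwa [hz]
  have hφ : MDifferentiableAt 𝓘(ℝ, V) 𝓘(ℝ, V) (extChartAt 𝓘(ℝ, V) x) y :=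
    mdifferentiableAt_extChartAt (by rwa [extChartAt_source] at hy)
  have e : F =ᶠ[𝓝 y] (F ∘ (extChartAt 𝓘(ℝ, V) x).symm) ∘ (extChartAt 𝓘(ℝ, V) x) := by
    filter_upwards [extChartAt_source_mem_nhds' (I := 𝓘(ℝ, V)) hy] with q hq
    simp only [Function.comp_apply, (extChartAt 𝓘(ℝ, V) x).left_inv hq]
  have h1 : mfderiv 𝓘(ℝ, V) 𝓘(ℝ, E) F y =
      mfderiv 𝓘(ℝ, V) 𝓘(ℝ, E) ((F ∘ (extChartAt 𝓘(ℝ, V) x).symm) ∘ (extChartAt 𝓘(ℝ, V) x)) y :=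
    e.mfderiv_eq
  have h2 := mfderiv_comp_apply (I := 𝓘(ℝ, V)) (I' := 𝓘(ℝ, V)) (I'' := 𝓘(ℝ, E)) y hF' hφ (Y y)
  rw [mfderiv_eq_fderiv] at h2
  exact (DFunLike.congr_fun h1 (Y y)).trans h2

theorem mdifferentiableAt_mvfderiv_apply [CompleteSpace V] {F : N → E} {Y : VField V N} {x : N}
    (hF : ContMDiffAt 𝓘(ℝ, V) 𝓘(ℝ, E) 2 F x) (hY : DiffAt Y x) :
    MDifferentiableAt 𝓘(ℝ, V) 𝓘(ℝ, E) (fun y => mvfderiv 𝓘(ℝ, V) F y (Y y)) x := by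
  have hFc : ContDiffAt ℝ 2 (F ∘ (extChartAt 𝓘(ℝ, V) x).symm) (extChartAt 𝓘(ℝ, V) x x) := by
    rw [← contMDiffAt_iff_contDiffAt]
    refine ContMDiffAt.comp (I' := 𝓘(ℝ, V)) _ (by rwa [extChartAt_to_inv]) ?_
    have h := contMDiffWithinAt_extChartAt_symm_target (I := 𝓘(ℝ, V)) (n := 2) x
      (mem_extChartAt_target (I := 𝓘(ℝ, V)) x)
    exact h.contMDiffAt (extChartAt_target_mem_nhds x)
  have hD : DifferentiableAt ℝ (fderiv ℝ (F ∘ (extChartAt 𝓘(ℝ, V) x).symm))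
      (extChartAt 𝓘(ℝ, V) x x) :=
    (hFc.fderiv_right (m := 1) (by norm_num)).differentiableAt (by simp)
  have h1 := (hD.clm_apply (differentiableAt_chartField hY)).mdifferentiableAt.comp x
    (mdifferentiableAt_extChartAt (I := 𝓘(ℝ, V)) (mem_chart_source V x))
  refine h1.congr_of_eventuallyEq ?_
  filter_upwards [contMDiffAt_iff_contMDiffAt_nhds (by simp) |>.1 hF,
    extChartAt_source_mem_nhds (I := 𝓘(ℝ, V)) x] with y hy hy'
  exact mvfderiv_eq_fderiv_chart hy' (hy.mdifferentiableAt (by simp)) Y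

/-- The bracket acts on vector-valued functions as the commutator. -/
theorem mvfderiv_mlieBracket [CompleteSpace V] {F : N → E} {X Y : VField V N} {x : N}
    (hF : ContMDiffAt 𝓘(ℝ, V) 𝓘(ℝ, E) 2 F x) (hX : DiffAt X x) (hY : DiffAt Y x) :
    mvfderiv 𝓘(ℝ, V) F x (mlieBracket 𝓘(ℝ, V) X Y x) =
      mvfderiv 𝓘(ℝ, V) (fun y => mvfderiv 𝓘(ℝ, V) F y (Y y)) x (X x) -
        mvfderiv 𝓘(ℝ, V) (fun y => mvfderiv 𝓘(ℝ, V) F y (X y)) x (Y x) := by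
  set c := extChartAt 𝓘(ℝ, V) x with hc
  set F' : V → E := F ∘ c.symm with hF'
  have hxs : x ∈ c.source := mem_extChartAt_source x
  have hz : c.symm (c x) = x := c.left_inv hxs
  have hFc : ContDiffAt ℝ 2 F' (c x) := by
    rw [← contMDiffAt_iff_contDiffAt]
    refine ContMDiffAt.comp (I' := 𝓘(ℝ, V)) (c x) (by rwa [hz]) ?_
    have h := contMDiffWithinAt_extChartAt_symm_target (I := 𝓘(ℝ, V)) (n := 2) x
      (mem_extChartAt_target (I := 𝓘(ℝ, V)) x)
    exact h.contMDiffAt (extChartAt_target_mem_nhds x)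
  have hsymm := hFc.isSymmSndFDerivAt (by simp)
  have hD : DifferentiableAt ℝ (fderiv ℝ F') (c x) :=
    (hFc.fderiv_right (m := 1) (by norm_num)).differentiableAt (by simp)
  have hev : ∀ᶠ y in 𝓝 x, MDifferentiableAt 𝓘(ℝ, V) 𝓘(ℝ, E) F y := by
    filter_upwards [contMDiffAt_iff_contMDiffAt_nhds (by simp) |>.1 hF] with y hy
    exact hy.mdifferentiableAt (by simp)
  have hφ : MDifferentiableAt 𝓘(ℝ, V) 𝓘(ℝ, V) c x :=
    mdifferentiableAt_extChartAt (mem_chart_source V x)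
  -- In the chart, `Z'(Z F) = D²F(Z', Z) + DF(DZ · Z')`. In the commutator the second derivatives
  -- cancel by symmetry, and what remains is the derivative of `F` along the bracket.
  have key : ∀ Z : VField V N, DiffAt Z x → ∀ Z' : VField V N,
      mvfderiv 𝓘(ℝ, V) (fun y => mvfderiv 𝓘(ℝ, V) F y (Z y)) x (Z' x) =
        fderiv ℝ (fderiv ℝ F') (c x) (chartField x Z' (c x)) (chartField x Z (c x)) +
          fderiv ℝ F' (c x) (fderiv ℝ (chartField x Z) (c x) (chartField x Z' (c x))) := by
    intro Z hZ Z'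
    have hZc := differentiableAt_chartField hZ
    have e : (fun y => mvfderiv 𝓘(ℝ, V) F y (Z y)) =ᶠ[𝓝 x]
        (fun z => fderiv ℝ F' z (chartField x Z z)) ∘ c := by
      filter_upwards [hev, extChartAt_source_mem_nhds (I := 𝓘(ℝ, V)) x] with y hy hy'
      exact mvfderiv_eq_fderiv_chart hy' hy Z
    have hK : DifferentiableAt ℝ (fun z => fderiv ℝ F' z (chartField x Z z)) (c x) :=
      hD.clm_apply hZc
    rw [mvfderiv_congr e, mvfderiv_comp_vector hK.mdifferentiableAt hφ]
    rw [← chartField_extChartAt hxs]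
    have h2 : mvfderiv 𝓘(ℝ, V) (fun z => fderiv ℝ F' z (chartField x Z z)) (c x) =
        fderiv ℝ (fun z => fderiv ℝ F' z (chartField x Z z)) (c x) := by
      unfold mvfderiv
      rw [mfderiv_eq_fderiv]
      rfl
    rw [h2, fderiv_clm_apply hD hZc]
    exact add_comm _ _
  rw [key Y hY X, key X hX Y, mvfderiv_eq_fderiv_chart (x := x) hxs hev.self_of_nhds,
    chartField_extChartAt hxs]
  have hb : mfderiv 𝓘(ℝ, V) 𝓘(ℝ, V) c x (mlieBracket 𝓘(ℝ, V) X Y x) =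
      lieBracket ℝ (chartField x X) (chartField x Y) (c x) := by
    rw [hc, mfderiv_extChartAt_self]
    exact mlieBracket_eq_lieBracket_chartField X Y x
  rw [hb, lieBracket, map_sub, hsymm.eq]
  abel

end Commutator

/-! ### Locally smooth vector fields and commuting coordinate fields -/

section SmoothFields

open Filter Topology VectorField

variable {V : Type*} [NormedAddCommGroup V] [NormedSpace ℝ V]
  {N : Type*} [TopologicalSpace N] [ChartedSpace V N] [IsManifold 𝓘(ℝ, V) ∞ N]

/-- The vector field `Y` is smooth on a neighbourhood of `x`. -/
def SmoothNear (Y : VField V N) (x : N) : Prop :=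
  ∀ᶠ y in 𝓝 x, ContMDiffAt 𝓘(ℝ, V) 𝓘(ℝ, V).tangent ∞
    (fun z => (⟨z, Y z⟩ : TangentBundle 𝓘(ℝ, V) N)) y

theorem SmoothNear.contMDiffAt {Y : VField V N} {x : N} (h : SmoothNear Y x) :
    ContMDiffAt 𝓘(ℝ, V) 𝓘(ℝ, V).tangent ∞ (fun z => (⟨z, Y z⟩ : TangentBundle 𝓘(ℝ, V) N)) x :=
  h.self_of_nhds

theorem SmoothNear.diffAt {Y : VField V N} {x : N} (h : SmoothNear Y x) : DiffAt Y x :=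
  h.contMDiffAt.mdifferentiableAt (by simp)

theorem SmoothNear.eventually {Y : VField V N} {x : N} (h : SmoothNear Y x) :
    ∀ᶠ y in 𝓝 x, SmoothNear Y y :=
  h.eventually_nhds

theorem SmoothOn.smoothNear {Y : VField V N} {s : Set N} (h : SmoothOn Y s) (hs : IsOpen s)
    {x : N} (hx : x ∈ s) : SmoothNear Y x := by
  filter_upwards [hs.mem_nhds hx] with y hy using (h y hy).contMDiffAt (hs.mem_nhds hy)

theorem SmoothNear.exists_smoothOn {Y : VField V N} {x : N} (h : SmoothNear Y x) :
    ∃ s : Set N, IsOpen s ∧ x ∈ s ∧ SmoothOn Y s := by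
  obtain ⟨s, hs, ho, hx⟩ := eventually_nhds_iff.1 h
  exact ⟨s, ho, hx, fun y hy => (hs y hy).contMDiffWithinAt⟩

theorem SmoothNear.add {Y Y' : VField V N} {x : N} (h : SmoothNear Y x) (h' : SmoothNear Y' x) :
    SmoothNear (fun y => Y y + Y' y) x := by
  filter_upwards [h, h'] with y hy hy' using hy.add_section hy'

theorem SmoothNear.sub {Y Y' : VField V N} {x : N} (h : SmoothNear Y x) (h' : SmoothNear Y' x) :
    SmoothNear (fun y => Y y - Y' y) x := by
  filter_upwards [h, h'] with y hy hy' using hy.sub_section hy'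

theorem SmoothNear.smul {F : N → ℝ} {Y : VField V N} {x : N}
    (hF : ∀ᶠ y in 𝓝 x, ContMDiffAt 𝓘(ℝ, V) 𝓘(ℝ, ℝ) ∞ F y) (h : SmoothNear Y x) :
    SmoothNear (fun y => F y • Y y) x := by
  filter_upwards [h, hF] with y hy hy' using hy'.smul_section hy

theorem SmoothNear.sum {ι : Type*} {s : Finset ι} {Y : ι → VField V N} {x : N}
    (h : ∀ i ∈ s, SmoothNear (Y i) x) : SmoothNear (fun y => ∑ i ∈ s, Y i y) x := by
  filter_upwards [(Filter.eventually_all_finset s).2 h] with y hy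
    using ContMDiffAt.sum_section fun i hi => hy i hi

theorem smoothNear_extend {x : N} (v : TangentSpace 𝓘(ℝ, V) x) :
    SmoothNear (FiberBundle.extend V (E := (TangentSpace 𝓘(ℝ, V) : N → Type _)) v) x := by
  set t := trivializationAt V (TangentSpace 𝓘(ℝ, V) : N → Type _) x with ht
  filter_upwards [t.open_baseSet.mem_nhds (FiberBundle.mem_baseSet_trivializationAt' x)] with y hy
  refine (t.contMDiffAt_section_iff hy).2 ?_
  refine (contMDiffAt_const (c := (t ⟨x, v⟩).2)).congr_of_eventuallyEq ?_
  filter_upwards [t.open_baseSet.mem_nhds hy] with z hz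
  simp only [FiberBundle.extend]
  rw [t.apply_mk_symm hz]

/-- The fields `FiberBundle.extend V v` are coordinate vector fields. -/
theorem mfderiv_extChartAt_extend {x y : N} (hy : y ∈ (chartAt V x).source)
    (v : TangentSpace 𝓘(ℝ, V) x) :
    mfderiv 𝓘(ℝ, V) 𝓘(ℝ, V) (extChartAt 𝓘(ℝ, V) x) y
      (FiberBundle.extend V (E := (TangentSpace 𝓘(ℝ, V) : N → Type _)) v y) = v := by
  have h0 := TangentBundle.continuousLinearMapAt_trivializationAt (I := 𝓘(ℝ, V)) hy
  refine (DFunLike.congr_fun h0 _).symm.trans ?_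
  set t := trivializationAt V (TangentSpace 𝓘(ℝ, V) : N → Type _) x with ht
  have hb : y ∈ t.baseSet := by simpa [ht] using hy
  have hx : x ∈ t.baseSet := FiberBundle.mem_baseSet_trivializationAt' x
  have h2 : t.continuousLinearMapAt ℝ y (FiberBundle.extend V v y) = (t ⟨x, v⟩).2 := by
    rw [Trivialization.continuousLinearMapAt_apply, t.coe_linearMapAt_of_mem hb]
    simp only [FiberBundle.extend]
    rw [t.apply_mk_symm hb]
  refine h2.trans ?_
  have h3 := mfderiv_extChartAt_self (I := 𝓘(ℝ, V)) (x := x)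
  rw [← TangentBundle.continuousLinearMapAt_trivializationAt (mem_chart_source V x)] at h3
  have h4 := DFunLike.congr_fun h3 v
  have h5 : t.continuousLinearMapAt ℝ x v = (t ⟨x, v⟩).2 := by
    rw [Trivialization.continuousLinearMapAt_apply, t.coe_linearMapAt_of_mem hx]
  exact h5.symm.trans h4

/-- The chart has constant derivative along each coordinate field. By the commutator formula its
differential annihilates the bracket, and that differential is invertible. -/
theorem mlieBracket_extend [CompleteSpace V] {x : N} (v w : TangentSpace 𝓘(ℝ, V) x) :
    ∀ᶠ y in 𝓝 x, mlieBracket 𝓘(ℝ, V)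
      (FiberBundle.extend V (E := (TangentSpace 𝓘(ℝ, V) : N → Type _)) v)
      (FiberBundle.extend V (E := (TangentSpace 𝓘(ℝ, V) : N → Type _)) w) y = 0 := by
  filter_upwards [(chartAt V x).open_source.mem_nhds (mem_chart_source V x),
    (smoothNear_extend v).eventually, (smoothNear_extend w).eventually] with y hy hv hw
  have hF : ContMDiffAt 𝓘(ℝ, V) 𝓘(ℝ, V) 2 (extChartAt 𝓘(ℝ, V) x) y := contMDiffAt_extChartAt' hy
  have h := mvfderiv_mlieBracket hF hv.diffAt hw.diffAt
  have hc : ∀ u : TangentSpace 𝓘(ℝ, V) x, ∀ z : TangentSpace 𝓘(ℝ, V) y,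
      mvfderiv 𝓘(ℝ, V) (fun q => mvfderiv 𝓘(ℝ, V) (extChartAt 𝓘(ℝ, V) x) q
        (FiberBundle.extend V (E := (TangentSpace 𝓘(ℝ, V) : N → Type _)) u q)) y z = 0 := by
    intro u z
    have e : (fun q => mvfderiv 𝓘(ℝ, V) (extChartAt 𝓘(ℝ, V) x) q
        (FiberBundle.extend V (E := (TangentSpace 𝓘(ℝ, V) : N → Type _)) u q)) =ᶠ[𝓝 y]
        fun _ => (u : V) := by
      filter_upwards [(chartAt V x).open_source.mem_nhds hy] with q hq
      exact mfderiv_extChartAt_extend hq u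
    have h0 : ∀ a : V, mvfderiv 𝓘(ℝ, V) (fun _ : N => a) y z = 0 := fun a => by
      rw [mvfderiv_const]
      rfl
    exact (mvfderiv_congr e z).trans (h0 u)
  rw [hc, hc, sub_zero] at h
  have hinv := isInvertible_mfderiv_extChartAt (I := 𝓘(ℝ, V)) (x := x) (y := y)
    (by rwa [extChartAt_source])
  exact hinv.injective (h.trans (map_zero _).symm)

end SmoothFields

/-! ### Immersions: local retractions, extension of fields, related fields -/

section Immersions

open Filter Topology VectorField

variable {V : Type*} [NormedAddCommGroup V] [NormedSpace ℝ V]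
  {N : Type*} [TopologicalSpace N] [ChartedSpace V N]
  {W : Type*} [NormedAddCommGroup W] [NormedSpace ℝ W]
  {M : Type*} [TopologicalSpace M] [ChartedSpace W M]

theorem dmap_comp {U : Type*} [NormedAddCommGroup U] [NormedSpace ℝ U]
    {L : Type*} [TopologicalSpace L] [ChartedSpace U L] {f : M → N} {j : L → M} {l : L}
    (hf : MDifferentiableAt 𝓘(ℝ, W) 𝓘(ℝ, V) f (j l))
    (hj : MDifferentiableAt 𝓘(ℝ, U) 𝓘(ℝ, W) j l) (u : TangentSpace 𝓘(ℝ, U) l) :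
    dmap (W := U) (V := V) (f ∘ j) l u = dmap (W := W) f (j l) (dmap (W := U) j l u) :=
  mfderiv_comp_apply l hf hj u

theorem eventually_dmap_retraction {f : M → N} {p : M} {ρ : N → M} {s : Set N}
    (hf : ContMDiff 𝓘(ℝ, W) 𝓘(ℝ, V) ∞ f) (hs : IsOpen s) (hp : f p ∈ s)
    (hρ : ContMDiffOn 𝓘(ℝ, V) 𝓘(ℝ, W) ∞ ρ s) (h : ∀ᶠ q in 𝓝 p, ρ (f q) = q) :
    ∀ᶠ q in 𝓝 p, ∀ u : TangentSpace 𝓘(ℝ, W) q,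
      (mfderiv 𝓘(ℝ, V) 𝓘(ℝ, W) ρ (f q) (dmap (V := V) f q u) : W) = u := by
  filter_upwards [h.eventually_nhds, hf.continuous.continuousAt.eventually_mem (hs.mem_nhds hp)]
    with q hq hqs u
  have h1 := mfderiv_comp_apply (I := 𝓘(ℝ, W)) (I' := 𝓘(ℝ, V)) (I'' := 𝓘(ℝ, W)) q
    ((hρ.contMDiffAt (hs.mem_nhds hqs)).mdifferentiableAt (by simp))
    (hf.mdifferentiableAt (by simp)) u
  have e : (ρ ∘ f) =ᶠ[𝓝 q] id := hq
  rw [e.mfderiv_eq, mfderiv_id] at h1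
  exact h1.symm

/-- An immersion has a smooth local retraction. -/
theorem exists_local_retraction {f : M → N} {p : M}
    (hf : Manifold.IsImmersionAt 𝓘(ℝ, W) 𝓘(ℝ, V) ∞ f p) :
    ∃ (ρ : N → M) (s : Set N), IsOpen s ∧ f p ∈ s ∧ ContMDiffOn 𝓘(ℝ, V) 𝓘(ℝ, W) ∞ ρ s ∧
      ∀ᶠ q in 𝓝 p, ρ (f q) = q := by
  set d := hf.domChart
  set c := hf.codChart
  -- In adapted charts `f` is `x ↦ (x, 0)`; the retraction is the first coordinate `k`, carried back
  -- to `M`.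
  have hk : ∀ q ∈ d.source, hf.equiv.symm (c (f q)) = (d q, 0) := by
    intro q hq
    have hq' : d q ∈ (d.extend 𝓘(ℝ, W)).target := by simpa using d.map_source hq
    have h := hf.writtenInCharts hq'
    rw [ContinuousLinearEquiv.symm_apply_eq]
    simpa [d, c, d.left_inv hq] using h
  let k : N → W := fun y => (hf.equiv.symm (c y)).1
  have hks : ContMDiffOn 𝓘(ℝ, V) 𝓘(ℝ, W) ∞ k c.source := by
    have h1 : ContMDiff 𝓘(ℝ, V) 𝓘(ℝ, W) ∞ (fun z => (hf.equiv.symm z).1) :=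
      (contDiff_fst.comp hf.equiv.symm.contDiff).contMDiff
    exact h1.comp_contMDiffOn (contMDiffOn_of_mem_maximalAtlas hf.codChart_mem_maximalAtlas)
  refine ⟨d.symm ∘ k, c.source ∩ k ⁻¹' d.target,
    hks.continuousOn.isOpen_inter_preimage c.open_source d.open_target, ?_, ?_, ?_⟩
  · refine ⟨hf.mem_codChart_source, ?_⟩
    simp only [Set.mem_preimage, k, hk p hf.mem_domChart_source]
    exact d.map_source hf.mem_domChart_source
  · exact (contMDiffOn_symm_of_mem_maximalAtlas hf.domChart_mem_maximalAtlas).comp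
      (hks.mono Set.inter_subset_left) Set.inter_subset_right
  · filter_upwards [d.open_source.mem_nhds hf.mem_domChart_source] with q hq
    simp only [Function.comp_apply, k, hk q hq]
    exact d.left_inv hq

theorem dmap_injective {f : M → N} (hf : Manifold.IsImmersion 𝓘(ℝ, W) 𝓘(ℝ, V) ∞ f) (p : M) :
    Function.Injective (dmap (W := W) (V := V) f p) := by
  obtain ⟨ρ, s, hs, hp, hρ, h⟩ := exists_local_retraction (hf.isImmersionAt p)
  have := (eventually_dmap_retraction hf.contMDiff hs hp hρ h).self_of_nhds
  intro u v huv
  have h1 := this u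
  rw [huv, this v] at h1
  exact h1.symm

variable [IsManifold 𝓘(ℝ, V) ∞ N] [IsManifold 𝓘(ℝ, W) ∞ M]

/-- Vector fields on an immersed submanifold locally extend to the ambient manifold. -/
theorem exists_extension {f : M → N} (hf : Manifold.IsImmersion 𝓘(ℝ, W) 𝓘(ℝ, V) ∞ f) (p : M)
    (Y : VField W M) :
    ∃ Z : VField V N, (SmoothNear Y p → SmoothNear Z (f p)) ∧ (DiffAt Y p → DiffAt Z (f p)) ∧
      ∀ᶠ q in 𝓝 p, Z (f q) = dmap f q (Y q) := by
  obtain ⟨ρ, s, hs, hp, hρ, h⟩ := exists_local_retraction (hf.isImmersionAt p)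
  set t := trivializationAt V (TangentSpace 𝓘(ℝ, V) : N → Type _) (f p) with ht
  have hpt : f p ∈ t.baseSet := FiberBundle.mem_baseSet_trivializationAt' _
  have hρp : ρ (f p) = p := h.self_of_nhds
  have hTf : ContMDiff 𝓘(ℝ, W).tangent 𝓘(ℝ, V).tangent ∞ (tangentMap 𝓘(ℝ, W) 𝓘(ℝ, V) f) :=
    hf.contMDiff.contMDiff_tangentMap (by simp)
  have hρa : ∀ y ∈ s, ContMDiffAt 𝓘(ℝ, V) 𝓘(ℝ, W) ∞ ρ y :=
    fun y hy => hρ.contMDiffAt (hs.mem_nhds hy)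
  have hfρ : ContinuousOn (f ∘ ρ) s := hf.contMDiff.continuous.comp_continuousOn hρ.continuousOn
  have hO : IsOpen (s ∩ (f ∘ ρ) ⁻¹' t.baseSet) := hfρ.isOpen_inter_preimage hs t.open_baseSet
  have hOp : f p ∈ s ∩ (f ∘ ρ) ⁻¹' t.baseSet := ⟨hp, by simpa [hρp] using hpt⟩
  -- The vector `df(Y(ρ y))` lies over `f(ρ y)`, not over `y`. The trivialization at `f p` carries
  -- it to the fibre over `y`, and does nothing when `y = f q` with `ρ (f q) = q`.
  let σ : N → TangentBundle 𝓘(ℝ, V) N := fun y => tangentMap 𝓘(ℝ, W) 𝓘(ℝ, V) f ⟨ρ y, Y (ρ y)⟩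
  have hσt : ∀ y ∈ s ∩ (f ∘ ρ) ⁻¹' t.baseSet, σ y ∈ t.source := by
    intro y hy
    rw [t.mem_source]
    exact hy.2
  let Z : VField V N := fun y => t.symm y (t (σ y)).2
  have hZt : ∀ y ∈ t.baseSet, (t ⟨y, Z y⟩).2 = (t (σ y)).2 := by
    intro y hy
    rw [t.apply_mk_symm hy]
  refine ⟨Z, fun hY => ?_, fun hY => ?_, ?_⟩
  · have hY' : ∀ᶠ y in 𝓝 (f p), ContMDiffAt 𝓘(ℝ, W) 𝓘(ℝ, W).tangent ∞
        (fun z => (⟨z, Y z⟩ : TangentBundle 𝓘(ℝ, W) M)) (ρ y) := by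
      refine (hρa _ hp).continuousAt.eventually ?_
      rw [hρp]
      exact hY
    filter_upwards [hY', hO.mem_nhds hOp, t.open_baseSet.mem_nhds hpt] with y hy hys hyt
    refine (t.contMDiffAt_section_iff hyt).2 ?_
    have h1 : ContMDiffAt 𝓘(ℝ, V) 𝓘(ℝ, V).tangent ∞ σ y :=
      (hTf.contMDiffAt).comp y (hy.comp y (hρa y hys.1))
    have h2 := (t.contMDiffAt_iff (IB := 𝓘(ℝ, V)) (hσt y hys)).1 h1
    refine h2.2.congr_of_eventuallyEq ?_
    filter_upwards [t.open_baseSet.mem_nhds hyt] with z hz using hZt z hz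
  · have hY' : MDifferentiableAt 𝓘(ℝ, W) 𝓘(ℝ, W).tangent
        (fun z => (⟨z, Y z⟩ : TangentBundle 𝓘(ℝ, W) M)) (ρ (f p)) := by
      rw [hρp]
      exact hY
    refine (t.mdifferentiableAt_section_iff 𝓘(ℝ, V) Z hpt).2 ?_
    have h1 : MDifferentiableAt 𝓘(ℝ, V) 𝓘(ℝ, V).tangent σ (f p) :=
      (hTf.mdifferentiable (by simp) _).comp _
        (MDifferentiableAt.comp (f p) hY' ((hρa _ hp).mdifferentiableAt (by simp)))
    have h2 := (t.mdifferentiableAt_totalSpace_iff 𝓘(ℝ, V) σ (hσt _ hOp)).1 h1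
    refine h2.2.congr_of_eventuallyEq ?_
    filter_upwards [t.open_baseSet.mem_nhds hpt] with z hz using hZt z hz
  · filter_upwards [h, hf.contMDiff.continuous.continuousAt.eventually_mem
      (t.open_baseSet.mem_nhds hpt)] with q hq hqt
    have h1 : σ (f q) = ⟨f q, dmap f q (Y q)⟩ :=
      congrArg (fun z => tangentMap 𝓘(ℝ, W) 𝓘(ℝ, V) f ⟨z, Y z⟩) hq
    simp only [Z, h1]
    exact t.symm_proj_apply ⟨f q, dmap f q (Y q)⟩ hqt

/-- A vector field on an immersed submanifold that is the restriction of a smooth field is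
smooth. -/
theorem smoothNear_of_related {f : M → N} (hf : Manifold.IsImmersion 𝓘(ℝ, W) 𝓘(ℝ, V) ∞ f) {p : M}
    {X : VField W M} {Z : VField V N} (hZ : SmoothNear Z (f p))
    (hXZ : ∀ᶠ q in 𝓝 p, Z (f q) = dmap f q (X q)) : SmoothNear X p := by
  obtain ⟨ρ, s, hs, hp, hρ, h⟩ := exists_local_retraction (hf.isImmersionAt p)
  -- The field is recovered as `X = dρ ∘ Z ∘ f`, a composite of smooth maps.
  have hT := hρ.contMDiffOn_tangentMapWithin (m := ∞) (by simp) hs.uniqueMDiffOn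
  have hd := eventually_dmap_retraction hf.contMDiff hs hp hρ h
  have hc := hf.contMDiff.continuous.continuousAt (x := p)
  filter_upwards [hc.eventually_mem (hs.mem_nhds hp), hc.eventually hZ, h.eventually_nhds,
    hXZ.eventually_nhds, hd.eventually_nhds] with q hqs hZq hq hXq hdq
  have hT' : ContMDiffAt 𝓘(ℝ, V).tangent 𝓘(ℝ, W).tangent ∞
      (tangentMapWithin 𝓘(ℝ, V) 𝓘(ℝ, W) ρ s) (⟨f q, Z (f q)⟩ : TangentBundle 𝓘(ℝ, V) N) :=
    hT.contMDiffAt ((hs.preimage (FiberBundle.continuous_proj V _)).mem_nhds hqs)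
  have h1 := hT'.comp q (hZq.comp q hf.contMDiff.contMDiffAt)
  refine h1.congr_of_eventuallyEq ?_
  filter_upwards [hq, hXq, hdq, hf.contMDiff.continuous.continuousAt.eventually_mem
    (hs.mem_nhds hqs)] with y h1 h2 h3 h4
  have h5 := h3 (X y)
  simp only [Function.comp_apply, tangentMapWithin, h2]
  rw [mfderivWithin_of_isOpen hs h4]
  refine Bundle.TotalSpace.ext h1.symm ?_
  exact heq_of_eq h5.symm

/-- With `c` the chart of `N` at `f p`, the commutator formula for `c` on `N` and for `c ∘ f` on `M`
has the same right-hand side. The differential of `c` is injective. -/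
theorem mlieBracket_of_related [CompleteSpace V] [CompleteSpace W] {f : M → N} {p : M}
    (hf : ContMDiff 𝓘(ℝ, W) 𝓘(ℝ, V) ∞ f) {X Y : VField W M} {X' Y' : VField V N}
    (hX : DiffAt X p) (hY : DiffAt Y p) (hX' : DiffAt X' (f p)) (hY' : DiffAt Y' (f p))
    (hXX' : ∀ᶠ q in 𝓝 p, X' (f q) = dmap f q (X q))
    (hYY' : ∀ᶠ q in 𝓝 p, Y' (f q) = dmap f q (Y q)) :
    mlieBracket 𝓘(ℝ, V) X' Y' (f p) = dmap f p (mlieBracket 𝓘(ℝ, W) X Y p) := by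
  set c := extChartAt 𝓘(ℝ, V) (f p) with hc
  have hs := mem_chart_source V (f p)
  have hcs : ContMDiffAt 𝓘(ℝ, V) 𝓘(ℝ, V) 2 c (f p) := contMDiffAt_extChartAt
  have hcf : ContMDiffAt 𝓘(ℝ, W) 𝓘(ℝ, V) 2 (c ∘ f) p :=
    hcs.comp p (hf.contMDiffAt.of_le (WithTop.coe_le_coe.2 (le_top : (2 : ℕ∞) ≤ ⊤)))
  have hfd : ∀ q, MDifferentiableAt 𝓘(ℝ, W) 𝓘(ℝ, V) f q := fun q => hf.mdifferentiableAt (by simp)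
  have key : ∀ (Z : VField W M) (Z' : VField V N), DiffAt Z' (f p) →
      (∀ᶠ q in 𝓝 p, Z' (f q) = dmap f q (Z q)) → ∀ u : TangentSpace 𝓘(ℝ, W) p,
      mvfderiv 𝓘(ℝ, V) (fun y => mvfderiv 𝓘(ℝ, V) c y (Z' y)) (f p) (dmap f p u) =
        mvfderiv 𝓘(ℝ, W) (fun q => mvfderiv 𝓘(ℝ, W) (c ∘ f) q (Z q)) p u := by
    intro Z Z' hZ' hZZ' u
    have hG : MDifferentiableAt 𝓘(ℝ, V) 𝓘(ℝ, V) (fun y => mvfderiv 𝓘(ℝ, V) c y (Z' y)) (f p) := by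
      have h1 : MDifferentiableAt 𝓘(ℝ, V) 𝓘(ℝ, V) (chartField (f p) Z' ∘ c) (f p) :=
        (differentiableAt_chartField hZ').mdifferentiableAt.comp _ (mdifferentiableAt_extChartAt hs)
      refine h1.congr_of_eventuallyEq ?_
      filter_upwards [extChartAt_source_mem_nhds (I := 𝓘(ℝ, V)) (f p)] with y hy
      exact (chartField_extChartAt hy Z').symm
    have h2 := mvfderiv_comp_vector hG (hfd p) u
    refine h2.symm.trans (mvfderiv_congr ?_ u)
    filter_upwards [hZZ', hf.continuous.continuousAt.eventually_mem
      ((chartAt V (f p)).open_source.mem_nhds hs)] with q hq hqs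
    simp only [Function.comp_apply, hq]
    exact (mvfderiv_comp_vector (mdifferentiableAt_extChartAt hqs) (hfd q) (Z q)).symm
  have h1 := mvfderiv_mlieBracket hcs hX' hY'
  rw [hXX'.self_of_nhds, hYY'.self_of_nhds, key Y Y' hY' hYY', key X X' hX' hXX',
    ← mvfderiv_mlieBracket hcf hX hY,
    mvfderiv_comp_vector (hcs.mdifferentiableAt (by simp)) (hfd p)] at h1
  have hinv := isInvertible_mfderiv_extChartAt (I := 𝓘(ℝ, V)) (x := f p) (y := f p)
    (by rwa [extChartAt_source])
  exact hinv.injective h1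

end Immersions

/-! ### Pointwise identities and smoothness for g.f.f-structures -/

section GFFLemmas

open Filter Topology VectorField

variable {V : Type*} [NormedAddCommGroup V] [NormedSpace ℝ V]
  {N : Type*} [TopologicalSpace N] [ChartedSpace V N] [IsManifold 𝓘(ℝ, V) ∞ N]
  {r : ℕ} (G : IndefiniteGFF V N r)

namespace IndefiniteGFF

theorem metric_apply (x : N) (v w : TangentSpace 𝓘(ℝ, V) x) : G.metric x v w = G.g x v w := rfl

theorem ε_mul_self (a : Fin r) : G.ε a * G.ε a = 1 := by
  rcases G.ε_eq a with h | h <;> simp [h]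

theorem φ_ξ (x : N) (a : Fin r) : G.φ x (G.ξ a x) = 0 := by
  have h : G.ξ a x ∈ LinearMap.ker (G.φ x).toLinearMap := by
    rw [G.ker_φ]
    exact Submodule.subset_span ⟨a, rfl⟩
  exact h

/-- Evaluating `φ³ v` as `φ²(φ v)` and as `φ(φ² v)` gives `∑ η(φ v) ξ = 0`; the `ξ` are dual to the
`η`. -/
theorem η_φ (x : N) (a : Fin r) (v : TangentSpace 𝓘(ℝ, V) x) : G.η a x (G.φ x v) = 0 := by
  have h1 := G.φ_sq x (G.φ x v)
  rw [G.φ_sq x v] at h1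
  simp only [map_add, map_neg, map_sum, map_smul, G.φ_ξ, smul_zero, Finset.sum_const_zero,
    add_zero] at h1
  have h2 := congrArg (G.η a x) (left_eq_add.1 h1)
  simpa [G.η_ξ] using h2

theorem g_ξ_right (x : N) (a : Fin r) (v : TangentSpace 𝓘(ℝ, V) x) :
    G.g x v (G.ξ a x) = G.ε a * G.η a x v := by
  have h := G.compatible x v (G.ξ a x)
  simp only [G.φ_ξ, map_zero, G.η_ξ, mul_ite, mul_one, mul_zero, Finset.sum_ite_eq',
    Finset.mem_univ, if_true] at h
  linarith

/-- Compatibility for `v` and `φ w`; the correction terms drop since `η ∘ φ = 0` and `g(·, ξ)` is a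
multiple of `η`. -/
theorem g_φ_left (x : N) (v w : TangentSpace 𝓘(ℝ, V) x) :
    G.g x (G.φ x v) w = -G.g x v (G.φ x w) := by
  have h := G.compatible x v (G.φ x w)
  rw [G.φ_sq] at h
  simp only [map_add, map_neg, map_sum, map_smul, G.g_ξ_right, G.η_φ, mul_zero, smul_eq_mul,
    Finset.sum_const_zero, add_zero, sub_zero] at h
  linarith

theorem g_φ_φ (x : N) (v : TangentSpace 𝓘(ℝ, V) x) {w : TangentSpace 𝓘(ℝ, V) x}
    (hw : ∀ a, G.η a x w = 0) : G.g x (G.φ x v) (G.φ x w) = G.g x v w := by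
  simp [G.compatible, hw]

theorem φ_φ (x : N) {v : TangentSpace 𝓘(ℝ, V) x} (hv : ∀ a, G.η a x v = 0) :
    G.φ x (G.φ x v) = -v := by
  simp [G.φ_sq, hv]

theorem φ_φ_φ (x : N) (v : TangentSpace 𝓘(ℝ, V) x) : G.φ x (G.φ x (G.φ x v)) = -G.φ x v :=
  G.φ_φ x fun a => G.η_φ x a v

theorem eq_of_g_eq {x : N} {v w : TangentSpace 𝓘(ℝ, V) x} (h : ∀ z, G.g x v z = G.g x w z) :
    v = w := by
  rw [← sub_eq_zero]
  exact G.g_nondegenerate x _ fun z => by simp [h]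

variable {G}

theorem smoothNear_φ {Y : VField V N} {x : N} (hY : SmoothNear Y x) :
    SmoothNear (fun y => G.φ y (Y y)) x := by
  filter_upwards [hY] with y hy
  exact ContMDiffAt.clm_bundle_apply (F₁ := V) (F₂ := V) (b := fun y : N => y)
    G.φ_smooth.contMDiffAt hy

theorem diffAt_φ {Y : VField V N} {x : N} (hY : DiffAt Y x) :
    DiffAt (fun y => G.φ y (Y y)) x :=
  MDifferentiableAt.clm_bundle_apply (F₁ := V) (F₂ := V) (b := fun y : N => y)
    (G.φ_smooth.mdifferentiable (by simp) x) hY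

theorem contMDiffAt_g {Y Z : VField V N} {x : N} (hY : SmoothNear Y x) (hZ : SmoothNear Z x) :
    ∀ᶠ y in 𝓝 x, ContMDiffAt 𝓘(ℝ, V) 𝓘(ℝ, ℝ) ∞ (fun y => G.g y (Y y) (Z y)) y := by
  filter_upwards [hY, hZ] with y hy hz
  have : ContMDiffAt 𝓘(ℝ, V) (𝓘(ℝ, V).prod 𝓘(ℝ, ℝ)) ∞
      (fun y => TotalSpace.mk' ℝ (E := Bundle.Trivial N ℝ) y (G.g y (Y y) (Z y))) y := by
    apply ContMDiffAt.clm_bundle_apply₂ (F₁ := V) (F₂ := V) (b := fun y : N => y)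
    · exact G.g_smooth.contMDiffAt
    · exact hy
    · exact hz
  simp only [contMDiffAt_totalSpace] at this
  exact this.2

theorem mdifferentiableAt_g {Y Z : VField V N} {x : N} (hY : DiffAt Y x) (hZ : DiffAt Z x) :
    MDifferentiableAt 𝓘(ℝ, V) 𝓘(ℝ, ℝ) (fun y => G.g y (Y y) (Z y)) x := by
  have : MDifferentiableAt 𝓘(ℝ, V) (𝓘(ℝ, V).prod 𝓘(ℝ, ℝ))
      (fun y => TotalSpace.mk' ℝ (E := Bundle.Trivial N ℝ) y (G.g y (Y y) (Z y))) x := by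
    apply MDifferentiableAt.clm_bundle_apply₂ (F₁ := V) (F₂ := V) (b := fun y : N => y)
    · exact G.g_smooth.mdifferentiable (by simp) x
    · exact hY
    · exact hZ
  simp only [mdifferentiableAt_totalSpace] at this
  exact this.2

theorem contMDiffAt_η (a : Fin r) {Y : VField V N} {x : N} (hY : SmoothNear Y x) :
    ∀ᶠ y in 𝓝 x, ContMDiffAt 𝓘(ℝ, V) 𝓘(ℝ, ℝ) ∞ (fun y => G.η a y (Y y)) y := by
  filter_upwards [hY] with y hy
  have : ContMDiffAt 𝓘(ℝ, V) (𝓘(ℝ, V).prod 𝓘(ℝ, ℝ)) ∞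
      (fun y => TotalSpace.mk' ℝ (E := Bundle.Trivial N ℝ) y (G.η a y (Y y))) y := by
    apply ContMDiffAt.clm_bundle_apply (F₁ := V) (b := fun y : N => y)
    · exact (G.η_smooth a).contMDiffAt
    · exact hy
  simp only [contMDiffAt_totalSpace] at this
  exact this.2

theorem diffAt_ξ (a : Fin r) (x : N) : DiffAt (G.ξ a) x :=
  ((G.ξ_smooth a).smoothNear isOpen_univ (Set.mem_univ x)).diffAt

end IndefiniteGFF

end GFFLemmas

/-! ### The covariant derivative of `φ` as a tensor -/

section CovariantDerivative

open Filter Topology VectorField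

variable {V : Type*} [NormedAddCommGroup V] [NormedSpace ℝ V]
  {N : Type*} [TopologicalSpace N] [ChartedSpace V N] [IsManifold 𝓘(ℝ, V) ∞ N]
  {r : ℕ} {G : IndefiniteGFF V N r}
  {nab : CovariantDerivative 𝓘(ℝ, V) V (TangentSpace 𝓘(ℝ, V) : N → Type _)}

theorem IsLeviCivita.mvfderiv_g (hnab : IsLeviCivita G.metric nab) {x : N}
    (v : TangentSpace 𝓘(ℝ, V) x) {Y Z : VField V N} (hY : DiffAt Y x) (hZ : DiffAt Z x) :
    mvfderiv 𝓘(ℝ, V) (fun y => G.g y (Y y) (Z y)) x v =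
      G.g x (nab Y x v) (Z x) + G.g x (Y x) (nab Z x v) :=
  hnab.metric x v Y Z hY hZ

/-- Metric compatibility along a map. -/
theorem IsLeviCivita.mvfderiv_g_comp (hnab : IsLeviCivita G.metric nab)
    {W : Type*} [NormedAddCommGroup W] [NormedSpace ℝ W]
    {M : Type*} [TopologicalSpace M] [ChartedSpace W M] {f : M → N} {p : M}
    (hf : MDifferentiableAt 𝓘(ℝ, W) 𝓘(ℝ, V) f p) {Y Z : VField V N} (hY : DiffAt Y (f p))
    (hZ : DiffAt Z (f p)) (u : TangentSpace 𝓘(ℝ, W) p) :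
    mvfderiv 𝓘(ℝ, W) (fun q => G.g (f q) (Y (f q)) (Z (f q))) p u =
      G.g (f p) (nab Y (f p) (dmap f p u)) (Z (f p)) +
        G.g (f p) (Y (f p)) (nab Z (f p) (dmap f p u)) :=
  (mvfderiv_comp_vector (IndefiniteGFF.mdifferentiableAt_g hY hZ) hf u).trans
    (hnab.mvfderiv_g _ hY hZ)

/-- `∇_{df u} Z` only depends on `Z` along `f`. -/
theorem IsLeviCivita.nab_eq_of_eq_along (hnab : IsLeviCivita G.metric nab)
    {W : Type*} [NormedAddCommGroup W] [NormedSpace ℝ W]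
    {M : Type*} [TopologicalSpace M] [ChartedSpace W M] {f : M → N} {p : M}
    (hf : MDifferentiableAt 𝓘(ℝ, W) 𝓘(ℝ, V) f p) {Y Z : VField V N} (hY : DiffAt Y (f p))
    (hZ : DiffAt Z (f p)) (h : ∀ᶠ q in 𝓝 p, Y (f q) = Z (f q)) (u : TangentSpace 𝓘(ℝ, W) p) :
    nab Y (f p) (dmap f p u) = nab Z (f p) (dmap f p u) := by
  -- Metric compatibility against a test field through `w` expresses `g(∇Y, w)` by the derivative of
  -- a function on `M`, which sees `Y` only along `f`.
  refine G.eq_of_g_eq fun w => ?_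
  have hK := (smoothNear_extend w).diffAt
  have h1 := hnab.mvfderiv_g_comp hf hY hK u
  have h2 := hnab.mvfderiv_g_comp hf hZ hK u
  have e : (fun q => G.g (f q) (Y (f q)) (FiberBundle.extend V w (f q))) =ᶠ[𝓝 p]
      fun q => G.g (f q) (Z (f q)) (FiberBundle.extend V w (f q)) := by
    filter_upwards [h] with q hq
    rw [hq]
  rw [mvfderiv_congr e, h2, h.self_of_nhds] at h1
  simp only [FiberBundle.extend_apply_self] at h1
  linarith

variable (G nab) in
/-- The covariant derivative `(∇φ)Y`. -/
def covPhi (Y : VField V N) (x : N) (u : TangentSpace 𝓘(ℝ, V) x) : TangentSpace 𝓘(ℝ, V) x :=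
  nab (fun y => G.φ y (Y y)) x u - G.φ x (nab Y x u)

/-- The derivative of the identity `g(φY, Z) = -g(Y, φZ)`. -/
theorem g_covPhi_skew (hnab : IsLeviCivita G.metric nab) {x : N} {Y Z : VField V N}
    (hY : DiffAt Y x) (hZ : DiffAt Z x) (u : TangentSpace 𝓘(ℝ, V) x) :
    G.g x (covPhi G nab Y x u) (Z x) = -G.g x (covPhi G nab Z x u) (Y x) := by
  have h1 := hnab.mvfderiv_g u (IndefiniteGFF.diffAt_φ (G := G) hY) hZ
  have h2 := hnab.mvfderiv_g u hY (IndefiniteGFF.diffAt_φ (G := G) hZ)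
  have e : (fun y => G.g y (G.φ y (Y y)) (Z y)) = -(fun y => G.g y (Y y) (G.φ y (Z y))) := by
    ext y
    simp [G.g_φ_left]
  rw [e, mvfderiv_neg] at h1
  simp only [neg_apply] at h1
  rw [h2] at h1
  simp only [covPhi, map_sub, sub_apply, G.g_φ_left]
  rw [G.g_symm x (nab (fun y => G.φ y (Z y)) x u), G.g_symm x (nab Z x u)]
  rw [G.g_φ_left] at h1
  linarith [G.g_φ_left x (Y x) (nab Z x u)]

/-- Tensoriality is free: skewness moves `Y` into the slot where it is not differentiated. -/
theorem g_covPhi_eq (hnab : IsLeviCivita G.metric nab) {x : N} {Y Y' : VField V N}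
    (hY : DiffAt Y x) (hY' : DiffAt Y' x) (h : Y x = Y' x) (u : TangentSpace 𝓘(ℝ, V) x) :
    covPhi G nab Y x u = covPhi G nab Y' x u := by
  refine G.eq_of_g_eq fun w => ?_
  have hK := (smoothNear_extend w).diffAt
  have h1 := g_covPhi_skew hnab hY hK u
  have h2 := g_covPhi_skew hnab hY' hK u
  rw [FiberBundle.extend_apply_self] at h1 h2
  rw [h1, h2, h]

/-- The trilinear form `(u, y, z) ↦ g((∇_u φ)y, z)`. -/
def covPhiForm (hnab : IsLeviCivita G.metric nab) (x : N) :
    TangentSpace 𝓘(ℝ, V) x →ₗ[ℝ] TangentSpace 𝓘(ℝ, V) x →ₗ[ℝ] TangentSpace 𝓘(ℝ, V) x →ₗ[ℝ] ℝ :=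
  LinearMap.mk₂ ℝ
    (fun u y => (G.g x (covPhi G nab (FiberBundle.extend V y) x u)).toLinearMap)
    (by intro u u' y; ext z; simp [covPhi, sub_add_sub_comm])
    (by intro c u y; ext z; simp [covPhi, mul_sub])
    (by
      intro u y y'
      ext z
      have hd := fun y : TangentSpace 𝓘(ℝ, V) x => (smoothNear_extend y).diffAt
      have h := fun y => g_covPhi_skew hnab (hd y) (hd z) u
      simp only [FiberBundle.extend_apply_self] at h
      simp only [ContinuousLinearMap.coe_coe, LinearMap.add_apply, h, map_add]
      ring)
    (by
      intro c u y
      ext z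
      have hd := fun y : TangentSpace 𝓘(ℝ, V) x => (smoothNear_extend y).diffAt
      have h := fun y => g_covPhi_skew hnab (hd y) (hd z) u
      simp only [FiberBundle.extend_apply_self] at h
      simp only [ContinuousLinearMap.coe_coe, LinearMap.smul_apply, h, map_smul]
      simp)

theorem covPhiForm_apply (hnab : IsLeviCivita G.metric nab) {x : N} {Y : VField V N}
    (hY : DiffAt Y x) (u z : TangentSpace 𝓘(ℝ, V) x) :
    covPhiForm hnab x u (Y x) z = G.g x (covPhi G nab Y x u) z := by
  rw [g_covPhi_eq hnab hY (smoothNear_extend (Y x)).diffAt (by simp)]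
  rfl

theorem covPhiForm_skew (hnab : IsLeviCivita G.metric nab) {x : N}
    (u y z : TangentSpace 𝓘(ℝ, V) x) : covPhiForm hnab x u y z = -covPhiForm hnab x u z y := by
  have h := g_covPhi_skew hnab (smoothNear_extend y).diffAt (smoothNear_extend z).diffAt u
  rw [FiberBundle.extend_apply_self, FiberBundle.extend_apply_self] at h
  exact h

end CovariantDerivative

/-! ### The formula for `∇φ` on an indefinite S-manifold -/

section SManifold

open Filter Topology VectorField

variable {V : Type*} [NormedAddCommGroup V] [NormedSpace ℝ V]
  {N : Type*} [TopologicalSpace N] [ChartedSpace V N] [IsManifold 𝓘(ℝ, V) ∞ N]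
  {r : ℕ} {G : IndefiniteGFF V N r}
  {nab : CovariantDerivative 𝓘(ℝ, V) V (TangentSpace 𝓘(ℝ, V) : N → Type _)}

theorem mvfderiv_η (hnab : IsLeviCivita G.metric nab) (a : Fin r) {x : N} {Y : VField V N}
    (hY : DiffAt Y x) (u : TangentSpace 𝓘(ℝ, V) x) :
    mvfderiv 𝓘(ℝ, V) (fun y => G.η a y (Y y)) x u =
      G.η a x (nab Y x u) + G.ε a * G.g x (Y x) (nab (G.ξ a) x u) := by
  have h := hnab.mvfderiv_g u hY (IndefiniteGFF.diffAt_ξ (G := G) a x)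
  have e : (fun y => G.η a y (Y y)) = (fun y => G.ε a • G.g y (Y y) (G.ξ a y)) := by
    ext y
    rw [G.g_ξ_right, smul_eq_mul, ← mul_assoc, G.ε_mul_self, one_mul]
  have h2 := mvfderiv_smul (I := 𝓘(ℝ, V)) (a := fun _ : N => G.ε a) mdifferentiableAt_const
    (IndefiniteGFF.mdifferentiableAt_g (G := G) hY (IndefiniteGFF.diffAt_ξ (G := G) a x))
  have h3 := DFunLike.congr_fun h2 u
  rw [e]
  refine (h3.trans ?_)
  rw [mvfderiv_const]
  simp only [add_apply, smul_apply, smul_eq_mul,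
    ContinuousLinearMap.smulRight_apply, zero_apply, zero_mul, add_zero]
  rw [h, G.g_ξ_right]
  linear_combination (G.η a x (nab Y x u)) * G.ε_mul_self a

/-- The condition `dη = Φ`, with the bracket replaced by covariant derivatives and `η` by `ε g(·,
ξ)`: the derivatives of the extensions cancel. -/
theorem g_nab_ξ_sub (hG : G.IsSManifold) (hnab : IsLeviCivita G.metric nab) (a : Fin r) {x : N}
    (u v : TangentSpace 𝓘(ℝ, V) x) :
    G.ε a * (G.g x (nab (G.ξ a) x u) v - G.g x (nab (G.ξ a) x v) u) = 2 * G.g x u (G.φ x v) := by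
  have hd := fun y : TangentSpace 𝓘(ℝ, V) x => (smoothNear_extend y).diffAt
  have h := hG.dη a x _ _ (hd u) (hd v)
  have ht := hnab.torsion_free x _ _ (hd u) (hd v)
  unfold dOneForm at h
  rw [← ht, mvfderiv_η hnab a (hd v), mvfderiv_η hnab a (hd u)] at h
  simp only [FiberBundle.extend_apply_self, map_sub] at h
  rw [G.g_symm x _ v, G.g_symm x _ u]
  linarith

theorem g_nab_ξ_ξ (hnab : IsLeviCivita G.metric nab) (a b : Fin r) {x : N}
    (u : TangentSpace 𝓘(ℝ, V) x) :
    G.g x (nab (G.ξ a) x u) (G.ξ b x) + G.g x (nab (G.ξ b) x u) (G.ξ a x) = 0 := by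
  have h := hnab.mvfderiv_g u (IndefiniteGFF.diffAt_ξ (G := G) a x) (IndefiniteGFF.diffAt_ξ (G := G) b x)
  have e : (fun y => G.g y (G.ξ a y) (G.ξ b y)) =
      fun _ => G.ε b * if b = a then 1 else 0 := by
    ext y
    rw [G.g_ξ_right, G.η_ξ]
  rw [e, mvfderiv_const, zero_apply] at h
  rw [G.g_symm x _ (G.ξ a x)]
  exact h.symm

theorem covPhiForm_ξ (hnab : IsLeviCivita G.metric nab) (a : Fin r) {x : N}
    (u z : TangentSpace 𝓘(ℝ, V) x) :
    covPhiForm hnab x u (G.ξ a x) z = G.g x (nab (G.ξ a) x u) (G.φ x z) := by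
  rw [covPhiForm_apply hnab (IndefiniteGFF.diffAt_ξ (G := G) a x)]
  have e : (fun y => G.φ y (G.ξ a y)) = (0 : VField V N) := by
    ext1 y
    exact G.φ_ξ y a
  simp [covPhi, e, G.g_φ_left]

/-- Written with a torsion-free connection, the Nijenhuis torsion contains only derivatives of `φ`.
Pairing with `z` removes the `ξ`-valued part of the normality condition. -/
theorem covPhiForm_normal (hG : G.IsSManifold) (hnab : IsLeviCivita G.metric nab) {x : N}
    (u v z : TangentSpace 𝓘(ℝ, V) x) (hz : ∀ a, G.η a x z = 0) :
    covPhiForm hnab x (G.φ x u) v z - covPhiForm hnab x (G.φ x v) u z +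
      covPhiForm hnab x u v (G.φ x z) - covPhiForm hnab x v u (G.φ x z) = 0 := by
  have hd := fun y : TangentSpace 𝓘(ℝ, V) x => (smoothNear_extend y).diffAt
  have hφ := fun y => IndefiniteGFF.diffAt_φ (G := G) (hd y)
  have h := hG.normal x _ _ (hd u) (hd v)
  unfold nijenhuis at h
  rw [← hnab.torsion_free x _ _ (hd u) (hd v), ← hnab.torsion_free x _ _ (hφ u) (hφ v),
    ← hnab.torsion_free x _ _ (hφ u) (hd v), ← hnab.torsion_free x _ _ (hd u) (hφ v)] at h
  have h1 := congrArg (fun w => G.g x w z) h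
  have hξ : ∀ a, G.g x (G.ξ a x) z = 0 := fun a => by rw [G.g_symm, G.g_ξ_right, hz, mul_zero]
  simp only [FiberBundle.extend_apply_self, map_add, map_sub, add_apply, sub_apply, map_sum,
    map_smul, sum_apply, smul_apply, hξ, smul_zero, Finset.sum_const_zero,
    map_zero, zero_apply, G.g_φ_left, neg_neg] at h1
  have e := fun (w y z : TangentSpace 𝓘(ℝ, V) x) =>
    covPhiForm_apply hnab (hd y) w z
  simp only [FiberBundle.extend_apply_self] at e
  simp only [e, covPhi, map_sub, sub_apply, G.g_φ_left]
  linarith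

theorem covPhiForm_φ (hnab : IsLeviCivita G.metric nab) {x : N}
    (u y z : TangentSpace 𝓘(ℝ, V) x) (hy : ∀ a, G.η a x y = 0) (hz : ∀ a, G.η a x z = 0) :
    covPhiForm hnab x u (G.φ x y) z = covPhiForm hnab x u y (G.φ x z) := by
  -- This extension of `y` is a contact field everywhere, not only at `x`, so that `φ²Y = -Y` can be
  -- differentiated.
  set Y : VField V N := fun q => G.φ q (G.φ q (FiberBundle.extend V (-y) q)) with hY
  have hYd : DiffAt Y x :=
    IndefiniteGFF.diffAt_φ (IndefiniteGFF.diffAt_φ (smoothNear_extend (-y)).diffAt)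
  have hYx : Y x = y := by
    simp only [hY, FiberBundle.extend_apply_self, map_neg, G.φ_φ x hy, neg_neg]
  have e : (fun q => G.φ q (G.φ q (Y q))) = ((-1 : ℝ) • Y : VField V N) := by
    ext1 q
    simp [hY, G.φ_φ_φ]
  have hneg := nab.isCovariantDerivativeOn (s := Set.univ) |>.smul_const (-1 : ℝ) hYd
  have h1 := covPhiForm_apply hnab (IndefiniteGFF.diffAt_φ (G := G) hYd) u z
  have h2 := covPhiForm_apply hnab hYd u (G.φ x z)
  rw [hYx] at h1 h2
  rw [h1, h2]
  simp only [covPhi, e, map_sub, sub_apply]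
  rw [hneg]
  simp only [G.g_φ_left]
  have h3 := G.g_φ_φ x (nab Y x u) hz
  rw [G.g_φ_left] at h3
  simp only [neg_smul, one_smul, neg_apply, map_neg]
  linarith

/-- The cyclic sum expresses `dΦ`, and `Φ` is exact, being `dη` for any one of the forms. This is
where at least one `ξ` is required. -/
theorem covPhiForm_cyclic [CompleteSpace V] (hr : 0 < r) (hG : G.IsSManifold)
    (hnab : IsLeviCivita G.metric nab) {x : N} (u v w : TangentSpace 𝓘(ℝ, V) x) :
    covPhiForm hnab x u v w + covPhiForm hnab x v w u + covPhiForm hnab x w u v = 0 := by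
  let a : Fin r := ⟨0, hr⟩
  let E : TangentSpace 𝓘(ℝ, V) x → VField V N := fun v => FiberBundle.extend V v
  have hE : ∀ v, E v x = v := fun v => FiberBundle.extend_apply_self V v
  have hs := fun v : TangentSpace 𝓘(ℝ, V) x => smoothNear_extend v
  have hd : ∀ v, DiffAt (E v) x := fun y => (hs y).diffAt
  have hη : ∀ v, ContMDiffAt 𝓘(ℝ, V) 𝓘(ℝ, ℝ) 2 (fun y => G.η a y (E v y)) x := fun v =>
    (IndefiniteGFF.contMDiffAt_η a (hs v)).self_of_nhds.of_le
      (WithTop.coe_le_coe.2 (le_top : (2 : ℕ∞) ≤ ⊤))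
  have hb : ∀ v w, mlieBracket 𝓘(ℝ, V) (E v) (E w) x = 0 :=
    fun v w => (mlieBracket_extend v w).self_of_nhds
  -- Coordinate fields commute near `x`, not just at `x`; the bracket term of `dη` is therefore
  -- absent on a neighbourhood and the formula for `Φ` can be differentiated.
  have key : ∀ u v w, mvfderiv 𝓘(ℝ, V) (fun y => G.g y (E u y) (G.φ y (E v y))) x w =
      (mvfderiv 𝓘(ℝ, V) (fun y => mvfderiv 𝓘(ℝ, V) (fun z => G.η a z (E v z)) y (E u y)) x w -
      mvfderiv 𝓘(ℝ, V) (fun y => mvfderiv 𝓘(ℝ, V) (fun z => G.η a z (E u z)) y (E v y)) x w) / 2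
      := by
    intro u v w
    have e : (fun y => G.g y (E u y) (G.φ y (E v y))) =ᶠ[𝓝 x] fun y => (2⁻¹ : ℝ) •
        ((fun y => mvfderiv 𝓘(ℝ, V) (fun z => G.η a z (E v z)) y (E u y)) -
        (fun y => mvfderiv 𝓘(ℝ, V) (fun z => G.η a z (E u z)) y (E v y))) y := by
      filter_upwards [mlieBracket_extend u v, (hs u).eventually, (hs v).eventually]
        with y hy hu hv
      rw [← hG.dη a y _ _ hu.diffAt hv.diffAt]
      unfold dOneForm
      rw [hy, map_zero, sub_zero]
      simp only [Pi.sub_apply, smul_eq_mul]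
      ring
    have m1 := mdifferentiableAt_mvfderiv_apply (hη v) (hd u)
    have m2 := mdifferentiableAt_mvfderiv_apply (hη u) (hd v)
    refine (mvfderiv_congr e w).trans ?_
    have h2 := mvfderiv_smul (I := 𝓘(ℝ, V)) (a := fun _ : N => (2⁻¹ : ℝ)) mdifferentiableAt_const
      (m1.sub m2)
    refine (DFunLike.congr_fun h2 w).trans ?_
    rw [mvfderiv_const, mvfderiv_sub m1 m2]
    simp only [add_apply, smul_apply, sub_apply, smul_eq_mul,
      ContinuousLinearMap.smulRight_apply, zero_apply, zero_mul, add_zero]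
    ring
  have comm : ∀ u v w,
      mvfderiv 𝓘(ℝ, V) (fun y => mvfderiv 𝓘(ℝ, V) (fun z => G.η a z (E w z)) y (E v y)) x u =
      mvfderiv 𝓘(ℝ, V) (fun y => mvfderiv 𝓘(ℝ, V) (fun z => G.η a z (E w z)) y (E u y)) x v := by
    intro u v w
    have h := mvfderiv_mlieBracket (hη w) (hd u) (hd v)
    rw [hb, map_zero, hE, hE] at h
    linarith
  have dΦ : ∀ u v w, mvfderiv 𝓘(ℝ, V) (fun y => G.g y (E u y) (G.φ y (E v y))) x w +
      mvfderiv 𝓘(ℝ, V) (fun y => G.g y (E v y) (G.φ y (E w y))) x u +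
      mvfderiv 𝓘(ℝ, V) (fun y => G.g y (E w y) (G.φ y (E u y))) x v = 0 := by
    intro u v w
    rw [key, key, key]
    linarith [comm u v w, comm v w u, comm w u v]
  -- Summed cyclically, the terms containing derivatives of the coordinate fields cancel by `tor`,
  -- leaving only `∇φ`.
  have exp : ∀ u v w, mvfderiv 𝓘(ℝ, V) (fun y => G.g y (E u y) (G.φ y (E v y))) x w =
      G.g x (nab (E u) x w) (G.φ x v) + covPhiForm hnab x w v u
        - G.g x (nab (E v) x w) (G.φ x u) := by
    intro u v w
    have h := hnab.mvfderiv_g w (hd u) (IndefiniteGFF.diffAt_φ (G := G) (hd v))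
    have h2 := covPhiForm_apply hnab (hd v) w u
    rw [hE] at h2
    rw [h, h2, hE, hE]
    simp only [covPhi, map_sub, sub_apply, G.g_φ_left]
    rw [G.g_symm x (nab (fun y => G.φ y (E v y)) x w) u]
    ring
  have tor : ∀ u v, nab (E v) x u = nab (E u) x v := by
    intro u v
    have h := hnab.torsion_free x _ _ (hd u) (hd v)
    rw [hb, hE, hE, sub_eq_zero] at h
    exact h
  have h := dΦ u w v
  rw [exp, exp, exp, tor u v, tor u w, tor v w] at h
  linarith

theorem covPhiForm_eq [CompleteSpace V] (hr : 0 < r) (hG : G.IsSManifold)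
    (hnab : IsLeviCivita G.metric nab) {x : N} (u v z : TangentSpace 𝓘(ℝ, V) x)
    (hz : ∀ a, G.η a x z = 0) :
    covPhiForm hnab x u v z = -(∑ a, G.ε a * G.η a x v) * G.g x u z := by
  refine covPhi_algebra (G.g x).toBilinForm (G.φ x).toLinearMap (fun a => G.ξ a x)
    (fun a => (G.η a x).toLinearMap) G.ε (covPhiForm hnab x)
    (fun a => LinearMap.mk₂ ℝ (fun u v => G.g x (nab (G.ξ a) x u) v) (by simp) (by simp) (by simp)
      (by simp))
    (G.g_symm x) G.ε_mul_self (G.φ_sq x) (G.φ_ξ x) (fun a v => G.η_φ x a v)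
    (fun a v => G.g_ξ_right x a v) (covPhiForm_skew hnab) (covPhiForm_cyclic hr hG hnab)
    (covPhiForm_normal hG hnab) (covPhiForm_φ hnab)
    (fun a x z => covPhiForm_ξ hnab a x z) (fun a x y => g_nab_ξ_sub hG hnab a x y)
    (fun a b x => g_nab_ξ_ξ hnab a b x) u v z hz

end SManifold

/-! ### Null pairs and the orthogonal splitting `D₀ ⊥ E` at a point -/

section NullPairs

variable {V : Type*} [NormedAddCommGroup V] [NormedSpace ℝ V]
  {N : Type*} [TopologicalSpace N] [ChartedSpace V N] [IsManifold 𝓘(ℝ, V) ∞ N]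
  {W : Type*} [NormedAddCommGroup W] [NormedSpace ℝ W]
  {M : Type*} [TopologicalSpace M] [ChartedSpace W M]
  {r : ℕ}

/-- `e` spans the radical of the hypersurface `i` at `p`, and `n` is the corresponding lightlike
transversal vector: `g(n, e) = 1`, `g(n, n) = 0` and `n ⟂ S`. -/
structure IsNullPair (G : IndefiniteGFF V N r) (i : M → N) (S : TangentDistribution W M) (p : M)
    (e n : TangentSpace 𝓘(ℝ, V) (i p)) : Prop where
  e_mem : e ∈ (radical (W := W) G.metric i p).map (dmap i p)
  n_S : ∀ w ∈ S p, G.g (i p) n (dmap i p w) = 0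
  n_n : G.g (i p) n n = 0
  n_e : G.g (i p) n e = 1

/-- The component of `v` in the span of `e, n, φ e, φ n`. -/
def nullComponent (G : IndefiniteGFF V N r) {x : N} (e n v : TangentSpace 𝓘(ℝ, V) x) :
    TangentSpace 𝓘(ℝ, V) x :=
  G.g x v n • e + G.g x v e • n + G.g x v (G.φ x n) • G.φ x e + G.g x v (G.φ x e) • G.φ x n

theorem map_Fdist_le [IsManifold 𝓘(ℝ, W) ∞ M] (G : IndefiniteGFF V N r) (i : M → N)
    (S : TangentDistribution W M) (p : M) : (Fdist G i S p).map (dmap i p) ≤ Ebundle G i S p := by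
  rw [Fdist, Submodule.map_sup]
  refine sup_le ((Submodule.map_comap_le _ _).trans le_sup_left) ?_
  exact le_sup_left.trans le_sup_right

namespace IsNullPair

variable {G : IndefiniteGFF V N r} {i : M → N} {S : TangentDistribution W M} {p : M}
  {e n : TangentSpace 𝓘(ℝ, V) (i p)}

theorem g_e (h : IsNullPair G i S p e n) (u : TangentSpace 𝓘(ℝ, W) p) :
    G.g (i p) e (dmap i p u) = 0 := by
  obtain ⟨e', he', rfl⟩ := h.e_mem
  exact he' u

theorem e_range (h : IsNullPair G i S p e n) : ∃ e' : TangentSpace 𝓘(ℝ, W) p, dmap i p e' = e := by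
  obtain ⟨e', -, rfl⟩ := h.e_mem
  exact ⟨e', rfl⟩

theorem e_e (h : IsNullPair G i S p e n) : G.g (i p) e e = 0 := by
  obtain ⟨e', he'⟩ := h.e_range
  have := h.g_e e'
  rwa [he'] at this

theorem e_n (h : IsNullPair G i S p e n) : G.g (i p) e n = 1 := by
  rw [G.g_symm, h.n_e]

theorem isCompl_span [FiniteDimensional ℝ V] [FiniteDimensional ℝ W]
    (hi : IsLightlikeHypersurface (W := W) G.metric i) (h : IsNullPair G i S p e n) :
    IsCompl (LinearMap.range (dmap (W := W) i p)) (Submodule.span ℝ {n}) := by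
  have hd : Disjoint (LinearMap.range (dmap (W := W) i p)) (Submodule.span ℝ {n}) := by
    rw [Submodule.disjoint_def]
    rintro _ ⟨u, rfl⟩ hu
    obtain ⟨c, hc⟩ := Submodule.mem_span_singleton.1 hu
    have h1 := h.g_e u
    rw [← hc, map_smul, h.e_n, smul_eq_mul, mul_one] at h1
    rw [← hc, h1, zero_smul]
  refine ⟨hd, codisjoint_iff.2 (Submodule.eq_top_of_finrank_eq ?_)⟩
  have h1 := Submodule.finrank_sup_add_finrank_inf_eq (LinearMap.range (dmap (W := W) i p))
    (Submodule.span ℝ {n})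
  rw [hd.eq_bot, finrank_bot] at h1
  have hn : n ≠ 0 := by
    rintro rfl
    have := h.n_e
    simp at this
  have h2 : Module.finrank ℝ (LinearMap.range (dmap (W := W) (V := V) i p)) = Module.finrank ℝ W :=
    LinearMap.finrank_range_of_inj (dmap_injective hi.immersion p)
  have h3 : Module.finrank ℝ (Submodule.span ℝ {n}) = 1 := finrank_span_singleton hn
  have h4 : Module.finrank ℝ (TangentSpace 𝓘(ℝ, V) (i p)) = Module.finrank ℝ V := rfl
  have := hi.codim
  omega

variable [FiniteDimensional ℝ V] [FiniteDimensional ℝ W]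

theorem exists_eq_add (hi : IsLightlikeHypersurface (W := W) G.metric i)
    (h : IsNullPair G i S p e n) (v : TangentSpace 𝓘(ℝ, V) (i p)) :
    ∃ u : TangentSpace 𝓘(ℝ, W) p, v = dmap i p u + G.g (i p) v e • n := by
  obtain ⟨_, ⟨u, rfl⟩, b, hb, hv⟩ := Submodule.mem_sup.1
    ((h.isCompl_span hi).sup_eq_top ▸ Submodule.mem_top (x := v))
  obtain ⟨c, rfl⟩ := Submodule.mem_span_singleton.1 hb
  refine ⟨u, ?_⟩
  have : G.g (i p) v e = c := by
    rw [G.g_symm, ← hv, map_add, h.g_e, map_smul, h.e_n]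
    simp
  rw [this, hv]

theorem mem_range (hi : IsLightlikeHypersurface (W := W) G.metric i)
    (h : IsNullPair G i S p e n) {v : TangentSpace 𝓘(ℝ, V) (i p)} (hv : G.g (i p) v e = 0) :
    ∃ u : TangentSpace 𝓘(ℝ, W) p, dmap i p u = v := by
  obtain ⟨u, hu⟩ := h.exists_eq_add hi v
  exact ⟨u, by rw [hu, hv]; simp⟩

/-- The normal space of the hypersurface is the line through `e`: both sides have the same product
with every `du + t n`, and these vectors exhaust the ambient space. -/
theorem eq_smul_e (hi : IsLightlikeHypersurface (W := W) G.metric i)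
    (h : IsNullPair G i S p e n) {v : TangentSpace 𝓘(ℝ, V) (i p)}
    (hv : ∀ u : TangentSpace 𝓘(ℝ, W) p, G.g (i p) v (dmap i p u) = 0) :
    v = G.g (i p) v n • e := by
  refine G.eq_of_g_eq fun z => ?_
  obtain ⟨u, hu⟩ := h.exists_eq_add hi z
  rw [hu]
  simp [hv, h.g_e, h.e_n, mul_comm]

theorem map_radical (hi : IsLightlikeHypersurface (W := W) G.metric i)
    (h : IsNullPair G i S p e n) :
    (radical (W := W) G.metric i p).map (dmap i p) = Submodule.span ℝ {e} := by
  apply le_antisymm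
  · rintro _ ⟨v, hv, rfl⟩
    rw [h.eq_smul_e hi hv]
    exact Submodule.smul_mem _ _ (Submodule.mem_span_singleton_self e)
  · rw [Submodule.span_singleton_le_iff_mem]
    exact h.e_mem

variable [IsManifold 𝓘(ℝ, W) ∞ M]

theorem map_S (hi : IsLightlikeHypersurface (W := W) G.metric i) (hS : IsScreen G.metric i S)
    (h : IsNullPair G i S p e n) {v : TangentSpace 𝓘(ℝ, V) (i p)} :
    v ∈ (S p).map (dmap i p) ↔ G.g (i p) v e = 0 ∧ G.g (i p) v n = 0 := by
  constructor
  · rintro ⟨w, hw, rfl⟩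
    rw [G.g_symm _ _ e, G.g_symm _ _ n]
    exact ⟨h.g_e w, h.n_S w hw⟩
  · rintro ⟨h1, h2⟩
    obtain ⟨u, rfl⟩ := h.mem_range hi h1
    obtain ⟨a, ha, s, hs, rfl⟩ := Submodule.mem_sup.1
      ((hS.isCompl p).sup_eq_top ▸ Submodule.mem_top (x := u))
    have h3 := h.eq_smul_e hi ha
    have h4 := h.n_S s hs
    rw [G.g_symm] at h4
    rw [map_add, map_add, add_apply, h4, add_zero] at h2
    rw [h2, zero_smul] at h3
    exact ⟨s, hs, by rw [map_add, h3, zero_add]⟩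

/-- Uniqueness of the transversal direction. For a generator `m` with `t = g(m, e)`, the vector `m -
t n` is tangent and orthogonal to `Rad` and to the screen, hence equals `c e`. Then `g(m, m) = 2tc =
0` with `t ≠ 0` forces `c = 0`. -/
theorem ltr_eq (hi : IsLightlikeHypersurface (W := W) G.metric i) (hS : IsScreen G.metric i S)
    (h : IsNullPair G i S p e n) : ltr G.metric i S p = Submodule.span ℝ {n} := by
  apply le_antisymm
  · refine Submodule.span_le.2 ?_
    rintro m ⟨hm, hmS, e', he', hme⟩
    simp only [G.metric_apply] at hm hmS hme
    obtain ⟨u, hu⟩ := h.exists_eq_add hi m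
    set t := G.g (i p) m e with ht
    have h1 : dmap i p u = G.g (i p) (dmap i p u) n • e := by
      refine h.eq_smul_e hi fun w => ?_
      obtain ⟨a, ha, s, hs, rfl⟩ := Submodule.mem_sup.1
        ((hS.isCompl p).sup_eq_top ▸ Submodule.mem_top (x := w))
      have h2 : dmap i p u = m - t • n := by rw [hu]; simp
      have h3 : G.g (i p) (dmap i p u) (dmap i p a) = 0 := by
        rw [G.g_symm]; exact ha u
      rw [map_add, map_add, h3, h2]
      simp [hmS s hs, h.n_S s hs]
    set c := G.g (i p) (dmap i p u) n
    rw [h1] at hu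
    have h4 : dmap i p e' = G.g (i p) (dmap i p e') n • e := h.eq_smul_e hi he'
    have ht0 : t ≠ 0 := by
      intro h0
      rw [h4, map_smul, ← ht, h0] at hme
      simp at hme
    have hc : c = 0 := by
      rw [hu] at hm
      simp [h.e_e, h.e_n, h.n_e, h.n_n] at hm
      have : 2 * t * c = 0 := by linarith
      simpa [ht0] using this
    rw [hu, hc, zero_smul, zero_add]
    exact Submodule.smul_mem _ _ (Submodule.mem_span_singleton_self n)
  · rw [Submodule.span_singleton_le_iff_mem]
    obtain ⟨e', he', h1⟩ := h.e_mem
    exact Submodule.subset_span ⟨h.n_n, h.n_S, e', he', by rw [h1]; exact h.n_e⟩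

section Characteristic

variable (hi : IsCharacteristic (W := W) G i) (hS : IsCharacteristicScreen G i S)
  (h : IsNullPair G i S p e n)

include hi hS h

theorem g_ξ (a : Fin r) : G.g (i p) (G.ξ a (i p)) e = 0 ∧ G.g (i p) (G.ξ a (i p)) n = 0 :=
  (h.map_S hi.toIsLightlikeHypersurface hS.toIsScreen).1 (hS.ker_le p (G.φ_ξ (i p) a))

theorem η_e (a : Fin r) : G.η a (i p) e = 0 := by
  have h1 := (h.g_ξ hi hS a).1
  have h2 := G.ε_mul_self a
  rw [G.g_symm, G.g_ξ_right] at h1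
  linear_combination G.ε a * h1 - G.η a (i p) e * h2

theorem η_n (a : Fin r) : G.η a (i p) n = 0 := by
  have h1 := (h.g_ξ hi hS a).2
  have h2 := G.ε_mul_self a
  rw [G.g_symm, G.g_ξ_right] at h1
  linear_combination G.ε a * h1 - G.η a (i p) n * h2

theorem g_φe : G.g (i p) (G.φ (i p) e) e = 0 ∧ G.g (i p) (G.φ (i p) e) n = 0 :=
  (h.map_S hi.toIsLightlikeHypersurface hS.toIsScreen).1 (hS.φ_rad_le p ⟨e, h.e_mem, rfl⟩)

theorem g_φn : G.g (i p) (G.φ (i p) n) e = 0 ∧ G.g (i p) (G.φ (i p) n) n = 0 := by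
  constructor
  · rw [G.g_φ_left, G.g_symm, (h.g_φe hi hS).2, neg_zero]
  · have h1 := G.g_φ_left (i p) n n
    rw [G.g_symm _ n] at h1
    linarith

theorem g_φe_φe : G.g (i p) (G.φ (i p) e) (G.φ (i p) e) = 0 := by
  rw [G.g_φ_φ _ _ (h.η_e hi hS), h.e_e]

theorem g_φn_φn : G.g (i p) (G.φ (i p) n) (G.φ (i p) n) = 0 := by
  rw [G.g_φ_φ _ _ (h.η_n hi hS), h.n_n]

theorem g_φe_φn : G.g (i p) (G.φ (i p) e) (G.φ (i p) n) = 1 := by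
  rw [G.g_φ_φ _ _ (h.η_n hi hS), h.e_n]

theorem φ_φ_e : G.φ (i p) (G.φ (i p) e) = -e := G.φ_φ _ (h.η_e hi hS)

theorem φ_φ_n : G.φ (i p) (G.φ (i p) n) = -n := G.φ_φ _ (h.η_n hi hS)

theorem phiPart_eq : phiPart G i S p = Submodule.span ℝ {G.φ (i p) e, G.φ (i p) n} := by
  rw [phiPart, h.map_radical hi.toIsLightlikeHypersurface,
    h.ltr_eq hi.toIsLightlikeHypersurface hS.toIsScreen, Submodule.map_span, Submodule.map_span,
    Set.image_singleton, Set.image_singleton, Submodule.span_insert]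
  rfl

theorem Ebundle_eq : Ebundle G i S p =
    Submodule.span ℝ {G.φ (i p) e, G.φ (i p) n} ⊔ Submodule.span ℝ {e, n} := by
  rw [Ebundle, h.phiPart_eq hi hS, h.map_radical hi.toIsLightlikeHypersurface,
    h.ltr_eq hi.toIsLightlikeHypersurface hS.toIsScreen, Submodule.span_insert e]

theorem map_D0 {v : TangentSpace 𝓘(ℝ, V) (i p)} :
    v ∈ (D0 G i S p).map (dmap i p) ↔ (G.g (i p) v e = 0 ∧ G.g (i p) v n = 0) ∧
      G.g (i p) v (G.φ (i p) e) = 0 ∧ G.g (i p) v (G.φ (i p) n) = 0 := by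
  rw [← h.map_S hi.toIsLightlikeHypersurface hS.toIsScreen]
  constructor
  · rintro ⟨w, ⟨hw, hw'⟩, rfl⟩
    rw [h.phiPart_eq hi hS] at hw'
    exact ⟨⟨w, hw, rfl⟩, hw' _ (Submodule.subset_span (by simp)),
      hw' _ (Submodule.subset_span (by simp))⟩
  · rintro ⟨⟨w, hw, rfl⟩, h1, h2⟩
    refine ⟨w, ⟨hw, fun z hz => ?_⟩, rfl⟩
    rw [h.phiPart_eq hi hS] at hz
    obtain ⟨a, b, rfl⟩ := Submodule.mem_span_pair.1 hz
    rw [G.metric_apply]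
    simp [h1, h2]

theorem nullComponent_mem (v : TangentSpace 𝓘(ℝ, V) (i p)) :
    nullComponent G e n v ∈ Ebundle G i S p := by
  rw [h.Ebundle_eq hi hS, nullComponent, add_assoc, add_comm]
  refine Submodule.add_mem_sup ?_ ?_
  · exact Submodule.mem_span_pair.2 ⟨_, _, rfl⟩
  · exact Submodule.mem_span_pair.2 ⟨_, _, rfl⟩

/-- The pairs `e, n` and `φe, φn` are hyperbolic and mutually orthogonal. Hence `nullComponent` has
the same products with these four vectors as `v`. -/
theorem sub_nullComponent_mem (v : TangentSpace 𝓘(ℝ, V) (i p)) :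
    v - nullComponent G e n v ∈ (D0 G i S p).map (dmap i p) := by
  have h1 := h.g_φe hi hS
  have h2 := h.g_φn hi hS
  have h3 := G.g_symm (i p) e (G.φ (i p) e)
  have h4 := G.g_symm (i p) n (G.φ (i p) e)
  have h5 := G.g_symm (i p) e (G.φ (i p) n)
  have h6 := G.g_symm (i p) n (G.φ (i p) n)
  have h7 := G.g_symm (i p) (G.φ (i p) n) (G.φ (i p) e)
  rw [h.map_D0 hi hS]
  simp [nullComponent, h1, h2, h3, h4, h5, h6, h7, h.e_e, h.e_n, h.n_e, h.n_n, h.g_φe_φe hi hS,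
    h.g_φn_φn hi hS, h.g_φe_φn hi hS]

theorem g_D0_Ebundle {v w : TangentSpace 𝓘(ℝ, V) (i p)} (hv : v ∈ (D0 G i S p).map (dmap i p))
    (hw : w ∈ Ebundle G i S p) : G.g (i p) v w = 0 := by
  obtain ⟨⟨h1, h2⟩, h3, h4⟩ := (h.map_D0 hi hS).1 hv
  rw [h.Ebundle_eq hi hS] at hw
  obtain ⟨x, hx, y, hy, rfl⟩ := Submodule.mem_sup.1 hw
  obtain ⟨a, b, rfl⟩ := Submodule.mem_span_pair.1 hx
  obtain ⟨c, d, rfl⟩ := Submodule.mem_span_pair.1 hy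
  simp [h1, h2, h3, h4]

theorem isCompl_D0_Ebundle : IsCompl ((D0 G i S p).map (dmap i p)) (Ebundle G i S p) := by
  constructor
  · rw [Submodule.disjoint_def]
    intro v hv hv'
    refine G.g_nondegenerate _ v fun w => ?_
    rw [← sub_add_cancel w (nullComponent G e n w), map_add,
      h.g_D0_Ebundle hi hS hv (h.nullComponent_mem hi hS w), G.g_symm,
      h.g_D0_Ebundle hi hS (h.sub_nullComponent_mem hi hS w) hv', add_zero]
  · refine codisjoint_iff.2 (eq_top_iff.2 fun v _ => ?_)
    rw [← sub_add_cancel v (nullComponent G e n v)]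
    exact Submodule.add_mem_sup (h.sub_nullComponent_mem hi hS v) (h.nullComponent_mem hi hS v)

theorem projAlong_eq (v : TangentSpace 𝓘(ℝ, V) (i p)) :
    projAlong (Ebundle G i S p) ((D0 G i S p).map (dmap i p)) v = nullComponent G e n v := by
  conv_lhs => rw [← add_sub_cancel (nullComponent G e n v) v]
  exact projAlong_add (h.isCompl_D0_Ebundle hi hS).symm (h.nullComponent_mem hi hS v)
    (h.sub_nullComponent_mem hi hS v)

theorem nondegenerateOn_D0 : NondegenerateOn
    (fun v w => pullbackMetric (W := W) G.metric i p v w) (D0 G i S p) := by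
  intro a ha hab
  apply dmap_injective hi.immersion p
  rw [map_zero]
  refine G.g_nondegenerate _ _ fun w => ?_
  obtain ⟨b, hb, hw⟩ := h.sub_nullComponent_mem hi hS w
  rw [← sub_add_cancel w (nullComponent G e n w), map_add,
    h.g_D0_Ebundle hi hS ⟨a, ha, rfl⟩ (h.nullComponent_mem hi hS w), ← hw, add_zero]
  exact hab b hb

/-- A tangent vector whose image lies in the bundle `E` belongs to `F`. -/
theorem mem_Fdist {u : TangentSpace 𝓘(ℝ, W) p} (hu : dmap i p u ∈ Ebundle G i S p) :
    u ∈ Fdist G i S p := by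
  rw [h.Ebundle_eq hi hS] at hu
  obtain ⟨x, hx, y, hy, hxy⟩ := Submodule.mem_sup.1 hu
  obtain ⟨c, d, rfl⟩ := Submodule.mem_span_pair.1 hy
  -- The coefficient of `n` is read off by pairing with `e`, which is orthogonal to every tangent
  -- vector.
  have hd : d = 0 := by
    have h1 := h.g_e u
    obtain ⟨a, b, rfl⟩ := Submodule.mem_span_pair.1 hx
    rw [← hxy] at h1
    simpa [G.g_symm (i p) e (G.φ (i p) e), G.g_symm (i p) e (G.φ (i p) n), h.g_φe hi hS,
      h.g_φn hi hS, h.e_e, h.e_n] using h1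
  obtain ⟨e', he', h2⟩ := h.e_mem
  rw [← sub_add_cancel u (c • e')]
  refine Submodule.add_mem_sup ?_ (Submodule.smul_mem _ _ he')
  rw [Submodule.mem_comap, h.phiPart_eq hi hS, map_sub, map_smul, h2, ← hxy, hd]
  simpa using hx

theorem isCompl_D0_Fdist : IsCompl (D0 G i S p) (Fdist G i S p) := by
  constructor
  · rw [Submodule.disjoint_def]
    intro v hv hv'
    apply dmap_injective hi.immersion p
    rw [map_zero]
    exact Submodule.disjoint_def.1 (h.isCompl_D0_Ebundle hi hS).disjoint _ ⟨v, hv, rfl⟩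
      (map_Fdist_le G i S p ⟨v, hv', rfl⟩)
  · refine codisjoint_iff.2 (eq_top_iff.2 fun u _ => ?_)
    obtain ⟨d, hd, hdu⟩ := h.sub_nullComponent_mem hi hS (dmap i p u)
    rw [← add_sub_cancel d u]
    refine Submodule.add_mem_sup hd (h.mem_Fdist hi hS ?_)
    rw [map_sub, hdu, sub_sub_cancel]
    exact h.nullComponent_mem hi hS _

/-- Up to sign `φ` permutes `e, n, φe, φn`, and it is skew, so it preserves their orthogonal
complement. -/
theorem φ_mem_map_D0 {v : TangentSpace 𝓘(ℝ, V) (i p)} (hv : v ∈ (D0 G i S p).map (dmap i p)) :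
    G.φ (i p) v ∈ (D0 G i S p).map (dmap i p) := by
  obtain ⟨⟨h1, h2⟩, h3, h4⟩ := (h.map_D0 hi hS).1 hv
  refine (h.map_D0 hi hS).2 ⟨⟨?_, ?_⟩, ?_, ?_⟩
  · rw [G.g_φ_left, h3, neg_zero]
  · rw [G.g_φ_left, h4, neg_zero]
  · rw [G.g_φ_φ _ _ (h.η_e hi hS), h1]
  · rw [G.g_φ_φ _ _ (h.η_n hi hS), h2]

/-- The `D₀`-part of `w` is orthogonal to `D₀` and to `E`, hence zero. This identifies `E` with the
normal bundle of an integral manifold. -/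
theorem mem_Ebundle_of_g_eq_zero {w : TangentSpace 𝓘(ℝ, V) (i p)}
    (hw : ∀ v ∈ (D0 G i S p).map (dmap i p), G.g (i p) w v = 0) : w ∈ Ebundle G i S p := by
  have h1 := h.sub_nullComponent_mem hi hS w
  have h2 : w - nullComponent G e n w = 0 := by
    refine G.g_nondegenerate _ _ fun z => ?_
    have h3 := h.sub_nullComponent_mem hi hS z
    rw [← sub_add_cancel z (nullComponent G e n z), map_add,
      h.g_D0_Ebundle hi hS h1 (h.nullComponent_mem hi hS z), add_zero, G.g_symm, map_sub,
      G.g_symm _ _ w, hw _ h3, h.g_D0_Ebundle hi hS h3 (h.nullComponent_mem hi hS w), sub_zero]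
  rw [sub_eq_zero.1 h2]
  exact h.nullComponent_mem hi hS w

end Characteristic

end IsNullPair

end NullPairs

/-! ### Smooth local null frames -/

section SmoothFrames

open Filter Topology

variable {V : Type*} [NormedAddCommGroup V] [NormedSpace ℝ V]
  {N : Type*} [TopologicalSpace N] [ChartedSpace V N]

theorem contMDiffAt_det {ι : Type*} [Fintype ι] [DecidableEq ι] {A : N → Matrix ι ι ℝ} {x : N}
    (hA : ∀ i j, ContMDiffAt 𝓘(ℝ, V) 𝓘(ℝ, ℝ) ∞ (fun y => A y i j) x) :
    ContMDiffAt 𝓘(ℝ, V) 𝓘(ℝ, ℝ) ∞ (fun y => (A y).det) x := by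
  simp only [Matrix.det_apply']
  refine ContMDiffAt.sum fun σ _ => ?_
  exact contMDiffAt_const.mul (contMDiffAt_finsetProd fun k _ => hA (σ k) k)

theorem contMDiffAt_adjugate {ι : Type*} [Fintype ι] [DecidableEq ι] {A : N → Matrix ι ι ℝ} {x : N}
    (hA : ∀ i j, ContMDiffAt 𝓘(ℝ, V) 𝓘(ℝ, ℝ) ∞ (fun y => A y i j) x) (i j : ι) :
    ContMDiffAt 𝓘(ℝ, V) 𝓘(ℝ, ℝ) ∞ (fun y => (A y).adjugate i j) x := by
  simp only [Matrix.adjugate_apply]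
  refine contMDiffAt_det fun k l => ?_
  by_cases hk : k = j
  · subst hk
    simpa using contMDiffAt_const
  · simpa [Matrix.updateRow_apply, hk] using hA k l

variable [IsManifold 𝓘(ℝ, V) ∞ N] {r : ℕ} (G : IndefiniteGFF V N r)

/-- The Gram matrix of the vector fields `s`. -/
def gram {ι : Type*} (s : ι → VField V N) (y : N) : Matrix ι ι ℝ :=
  Matrix.of fun k l => G.g y (s k y) (s l y)

variable {G}

theorem contMDiffAt_gram {ι : Type*} [Finite ι] {s : ι → VField V N} {x : N}
    (hs : ∀ k, SmoothNear (s k) x) :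
    ∀ᶠ y in 𝓝 x, ∀ k l, ContMDiffAt 𝓘(ℝ, V) 𝓘(ℝ, ℝ) ∞ (fun z => gram G s z k l) y :=
  eventually_all.2 fun k => eventually_all.2 fun l =>
    IndefiniteGFF.contMDiffAt_g (G := G) (hs k) (hs l)

/-- A multiple of the vector field `Y` can be made orthogonal to the vector fields `s`. -/
theorem exists_orthogonal {ι : Type*} [Fintype ι] [DecidableEq ι] {s : ι → VField V N} {x : N}
    (hs : ∀ k, SmoothNear (s k) x) {Y : VField V N} (hY : SmoothNear Y x) :
    ∃ Z : VField V N, SmoothNear Z x ∧ ∀ y, (∀ k, G.g y (Z y) (s k y) = 0) ∧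
      ∃ c : ι → ℝ, Z y = (gram G s y).det • Y y - ∑ k, c k • s k y := by
  have hA := contMDiffAt_gram (G := G) hs
  -- Orthogonal projection multiplied by the Gram determinant: the adjugate replaces the inverse, so
  -- the field is smooth and orthogonal to `s` even where the Gram matrix degenerates.
  refine ⟨fun y => (gram G s y).det • Y y -
    ∑ k, (∑ l, G.g y (Y y) (s l y) * (gram G s y).adjugate l k) • s k y, ?_, fun y => ⟨?_, _, rfl⟩⟩
  · refine (hY.smul ?_).sub (SmoothNear.sum fun k _ => (hs k).smul ?_)
    · filter_upwards [hA] with y hy using contMDiffAt_det hy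
    · filter_upwards [hA, eventually_all.2 fun l => IndefiniteGFF.contMDiffAt_g (G := G) hY (hs l)]
        with y hy hy'
      exact ContMDiffAt.sum fun l _ => (hy' l).mul (contMDiffAt_adjugate hy l k)
  · intro k
    have h1 : ∀ l, ∑ j, (gram G s y).adjugate l j * G.g y (s j y) (s k y) =
        (gram G s y).det * (if l = k then 1 else 0) := by
      intro l
      have h2 := congrFun (congrFun (Matrix.adjugate_mul (gram G s y)) l) k
      rw [Matrix.mul_apply] at h2
      rw [← Matrix.one_apply]
      exact h2
    simp only [map_sub, map_smul, map_sum, sub_apply, smul_apply, sum_apply, smul_eq_mul,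
      Finset.sum_mul, mul_assoc]
    rw [Finset.sum_comm]
    simp only [← Finset.mul_sum, h1]
    simp [mul_comm]

variable {W : Type*} [NormedAddCommGroup W] [NormedSpace ℝ W]
  {M : Type*} [TopologicalSpace M] [ChartedSpace W M] [IsManifold 𝓘(ℝ, W) ∞ M]
  {i : M → N} {S : TangentDistribution W M}

/-- A kernel vector of the Gram matrix gives a vector of `S p` orthogonal to `S p`, hence to all of
`T_p M`; it lies in `Rad ∩ S = 0`. -/
theorem gram_det_ne_zero {ι : Type*} [Fintype ι] [DecidableEq ι] {s : ι → VField V N} {p : M}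
    (hS : IsScreen G.metric i S) {s' : ι → TangentSpace 𝓘(ℝ, W) p}
    (hs : ∀ k, s k (i p) = dmap i p (s' k)) (hli : LinearIndependent ℝ s')
    (hsp : Submodule.span ℝ (Set.range s') = S p) : (gram G s (i p)).det ≠ 0 := by
  intro h0
  obtain ⟨c, hc, hc0⟩ := Matrix.exists_mulVec_eq_zero_iff.2 h0
  apply hc
  have hmem : ∑ l, c l • s' l ∈ S p := by
    rw [← hsp]
    exact Submodule.sum_mem _ fun l _ => Submodule.smul_mem _ _ (Submodule.subset_span ⟨l, rfl⟩)
  have h1 : ∀ k, G.g (i p) (dmap i p (∑ l, c l • s' l)) (dmap i p (s' k)) = 0 := by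
    intro k
    have h2 := congrFun hc0 k
    rw [G.g_symm]
    simp only [map_sum, map_smul, ← hs, smul_eq_mul]
    refine (Finset.sum_congr rfl fun l _ => ?_).trans h2
    exact mul_comm _ _
  have h3 : ∀ w ∈ S p, G.g (i p) (dmap i p (∑ l, c l • s' l)) (dmap i p w) = 0 := by
    intro w hw
    rw [← hsp] at hw
    induction hw using Submodule.span_induction with
    | mem x hx => obtain ⟨k, rfl⟩ := hx; exact h1 k
    | zero => simp
    | add x y _ _ hx hy => rw [map_add, map_add, hx, hy, add_zero]
    | smul a x _ hx => rw [map_smul, map_smul, hx, smul_zero]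
  have h4 : ∑ l, c l • s' l ∈ radical (W := W) G.metric i p := by
    intro w
    obtain ⟨a, ha, b, hb, rfl⟩ := Submodule.mem_sup.1
      ((hS.isCompl p).sup_eq_top ▸ Submodule.mem_top (x := w))
    have h5 : G.g (i p) (dmap i p (∑ l, c l • s' l)) (dmap i p a) = 0 := by
      rw [G.g_symm]
      exact ha _
    rw [G.metric_apply, map_add, map_add, h5, h3 b hb, add_zero]
  have h6 := Submodule.disjoint_def.1 (hS.isCompl p).disjoint _ h4 hmem
  exact funext (Fintype.linearIndependent_iff.1 hli c h6)

theorem exists_null_frame (hi : IsLightlikeHypersurface (W := W) G.metric i)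
    (hS : IsScreen G.metric i S) (p : M) :
    ∃ e n : VField V N, SmoothNear e (i p) ∧ SmoothNear n (i p) ∧
      ∀ᶠ q in 𝓝 p, IsNullPair G i S q (e (i q)) (n (i q)) := by
  classical
  obtain ⟨U, hU, hpU, m, s', hs', hspan⟩ := hS.smooth p
  have hc : ContinuousAt i p := hi.immersion.contMDiff.continuous.continuousAt
  have hext := fun k => exists_extension hi.immersion p (s' k)
  choose s hs1 hs2 hs3 using hext
  have hs : ∀ k, SmoothNear (s k) (i p) := fun k => hs1 k ((hs' k).smoothNear hU hpU)
  have hsr : ∀ᶠ q in 𝓝 p, ∀ k, s k (i q) = dmap i q (s' k q) := eventually_all.2 hs3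
  obtain ⟨e₀, he₀, hne₀⟩ := Submodule.exists_mem_ne_zero_of_ne_bot (hi.degenerate p)
  obtain ⟨E₀, hE1, -, hE3⟩ := exists_extension hi.immersion p
    (FiberBundle.extend W (E := (TangentSpace 𝓘(ℝ, W) : M → Type _)) e₀)
  -- Along `M` this field is tangent to `M` and orthogonal to the screen, hence radical. It is
  -- nonzero at `p` because `e₀` is not in `S p` and the Gram determinant is not zero.
  obtain ⟨e, he, heq⟩ := exists_orthogonal (G := G) hs (hE1 (smoothNear_extend e₀))
  have hmemS : ∀ᶠ q in 𝓝 p, ∀ w ∈ S q, ∀ z : TangentSpace 𝓘(ℝ, V) (i q),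
      (∀ k, G.g (i q) z (s k (i q)) = 0) → G.g (i q) z (dmap i q w) = 0 := by
    filter_upwards [hsr, hU.mem_nhds hpU] with q hq hqU w hw z hz
    rw [← (hspan q hqU).2] at hw
    induction hw using Submodule.span_induction with
    | mem x hx => obtain ⟨k, rfl⟩ := hx; rw [← hq]; exact hz k
    | zero => simp
    | add x y _ _ hx hy => rw [map_add, map_add, hx, hy, add_zero]
    | smul a x _ hx => rw [map_smul, map_smul, hx, smul_zero]
  have hrad : ∀ᶠ q in 𝓝 p, e (i q) ∈ (radical (W := W) G.metric i q).map (dmap i q) := by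
    filter_upwards [hsr, hE3, hmemS] with q hq hEq hSq
    obtain ⟨horth, c, hce⟩ := heq (i q)
    have h1 : e (i q) = dmap i q ((gram G s (i q)).det • FiberBundle.extend W
        (E := (TangentSpace 𝓘(ℝ, W) : M → Type _)) e₀ q - ∑ k, c k • s' k q) := by
      rw [hce, hEq]
      simp [hq]
    rw [h1]
    refine ⟨_, fun w => ?_, rfl⟩
    rw [← h1]
    obtain ⟨a, ha, b, hb, rfl⟩ := Submodule.mem_sup.1
      ((hS.isCompl q).sup_eq_top ▸ Submodule.mem_top (x := w))
    have h2 : G.g (i q) (e (i q)) (dmap i q a) = 0 := by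
      rw [G.g_symm, h1]
      exact ha _
    rw [G.metric_apply, map_add, map_add, h2, hSq b hb _ horth, add_zero]
  have hdet : (gram G s (i p)).det ≠ 0 :=
    gram_det_ne_zero hS hsr.self_of_nhds (hspan p hpU).1
      (hspan p hpU).2
  have hE0 : E₀ (i p) = dmap i p e₀ := by
    rw [hE3.self_of_nhds, FiberBundle.extend_apply_self]
  have hep : e (i p) ≠ 0 := by
    intro h0
    obtain ⟨-, c, hce⟩ := heq (i p)
    rw [h0, hE0] at hce
    have h1 : (gram G s (i p)).det • e₀ = ∑ k, c k • s' k p := by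
      apply dmap_injective hi.immersion p
      rw [map_smul, map_sum]
      simp only [map_smul, ← hsr.self_of_nhds]
      exact (sub_eq_zero.1 hce.symm)
    have h2 : (gram G s (i p)).det • e₀ ∈ S p := by
      rw [h1, ← (hspan p hpU).2]
      exact Submodule.sum_mem _ fun l _ => Submodule.smul_mem _ _ (Submodule.subset_span ⟨l, rfl⟩)
    have h3 := Submodule.disjoint_def.1 (hS.isCompl p).disjoint _
      (Submodule.smul_mem _ (gram G s (i p)).det he₀) h2
    exact hne₀ ((smul_eq_zero.1 h3).resolve_left hdet)
  obtain ⟨n₀, hn₀⟩ : ∃ n₀, G.g (i p) n₀ (e (i p)) ≠ 0 := by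
    by_contra! h
    exact hep (G.g_nondegenerate _ _ fun w => by rw [G.g_symm]; exact h w)
  obtain ⟨n₁, hn₁, hneq⟩ := exists_orthogonal (G := G) hs (smoothNear_extend n₀)
  set F : N → ℝ := fun y => G.g y (n₁ y) (e y) with hF
  have hFs := IndefiniteGFF.contMDiffAt_g (G := G) hn₁ he
  have hFp : F (i p) ≠ 0 := by
    obtain ⟨-, c, hc'⟩ := hneq (i p)
    have h1 := (heq (i p)).1
    rw [hF]
    simp only [hc', FiberBundle.extend_apply_self, map_sub, map_smul, map_sum, sub_apply, smul_apply,
      sum_apply, smul_eq_mul]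
    simp only [G.g_symm _ (s _ _), h1, mul_zero, Finset.sum_const_zero, sub_zero]
    exact mul_ne_zero hdet hn₀
  have hFn : ∀ᶠ y in 𝓝 (i p), F y ≠ 0 := hFs.self_of_nhds.continuousAt.eventually_ne hFp
  have hFi : ∀ᶠ y in 𝓝 (i p), ContMDiffAt 𝓘(ℝ, V) 𝓘(ℝ, ℝ) ∞ (fun z => (F z)⁻¹) y := by
    filter_upwards [hFs, hFn] with y hy hy' using hy.inv₀ hy'
  -- Dividing by `F = g(n₁, e)` normalizes the product with `e`; the multiple of `e` is chosen to
  -- make the vector null. Orthogonality to the screen survives because `e` is radical.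
  refine ⟨e, fun y => (F y)⁻¹ • (n₁ y - (2⁻¹ * G.g y (n₁ y) (n₁ y) * (F y)⁻¹) • e y), he, ?_, ?_⟩
  · refine SmoothNear.smul hFi (hn₁.sub (SmoothNear.smul ?_ he))
    filter_upwards [hFi, IndefiniteGFF.contMDiffAt_g (G := G) hn₁ hn₁] with y hy hy'
      using (contMDiffAt_const.mul hy').mul hy
  · filter_upwards [hrad, hc.eventually hFn, hmemS] with q hq hFq hSq
    have hee : ∀ u : TangentSpace 𝓘(ℝ, W) q, G.g (i q) (e (i q)) (dmap i q u) = 0 := by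
      obtain ⟨e', he', h1⟩ := hq
      intro u
      rw [← h1]
      exact he' u
    have hee' : G.g (i q) (e (i q)) (e (i q)) = 0 := by
      obtain ⟨e', he', h1⟩ := hq
      conv_lhs => enter [2]; rw [← h1]
      exact hee e'
    refine ⟨hq, fun w hw => ?_, ?_, ?_⟩
    · simp [hee, hSq w hw _ (hneq (i q)).1]
    · have h1 : G.g (i q) (e (i q)) (n₁ (i q)) = F (i q) := G.g_symm _ _ _
      have h2 : G.g (i q) (n₁ (i q)) (e (i q)) = F (i q) := rfl
      simp only [map_smul, map_sub, smul_apply, sub_apply, smul_eq_mul, hee', h1, h2]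
      field_simp
      ring
    · have h2 : G.g (i q) (n₁ (i q)) (e (i q)) = F (i q) := rfl
      simp only [map_smul, map_sub, smul_apply, sub_apply, smul_eq_mul, hee', h2]
      field_simp
      ring

end SmoothFrames

/-! ### The second fundamental form of `D₀`: symmetry, `φ`-linearity, trace -/

section SecondForm

open Filter Topology

variable {V : Type*} [NormedAddCommGroup V] [NormedSpace ℝ V]
  {N : Type*} [TopologicalSpace N] [ChartedSpace V N] [IsManifold 𝓘(ℝ, V) ∞ N] {r : ℕ}

/-- For a frame `e, n, φ e, φ n` as in `IsNullPair`: the bilinear form which computes the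
`E`-component of the covariant derivative of sections of `D₀`. -/
def nullSecondForm (G : IndefiniteGFF V N r)
    (nab : CovariantDerivative 𝓘(ℝ, V) V (TangentSpace 𝓘(ℝ, V) : N → Type _))
    (e n : VField V N) (x : N) :
    TangentSpace 𝓘(ℝ, V) x →ₗ[ℝ] TangentSpace 𝓘(ℝ, V) x →ₗ[ℝ] TangentSpace 𝓘(ℝ, V) x :=
  LinearMap.mk₂ ℝ
    (fun u y => -(G.g x y (nab n x u) • e x + G.g x y (nab e x u) • n x
      + G.g x y (nab (fun z => G.φ z (n z)) x u) • G.φ x (e x)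
      + G.g x y (nab (fun z => G.φ z (e z)) x u) • G.φ x (n x)))
    (by intro u u' y; simp only [map_add]; module)
    (by intro c u y; simp only [map_smul, smul_eq_mul]; module)
    (by intro u y y'; simp only [map_add, add_apply]; module)
    (by intro c u y; simp only [map_smul, smul_apply, smul_eq_mul]; module)

theorem nullSecondForm_apply (G : IndefiniteGFF V N r)
    (nab : CovariantDerivative 𝓘(ℝ, V) V (TangentSpace 𝓘(ℝ, V) : N → Type _))
    (e n : VField V N) (x : N) (u y : TangentSpace 𝓘(ℝ, V) x) :
    nullSecondForm G nab e n x u y = -(G.g x y (nab n x u) • e x + G.g x y (nab e x u) • n x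
      + G.g x y (nab (fun z => G.φ z (n z)) x u) • G.φ x (e x)
      + G.g x y (nab (fun z => G.φ z (e z)) x u) • G.φ x (n x)) := rfl

variable {G : IndefiniteGFF V N r}
  {nab : CovariantDerivative 𝓘(ℝ, V) V (TangentSpace 𝓘(ℝ, V) : N → Type _)}

theorem g_nab_eq_neg (hnab : IsLeviCivita G.metric nab)
    {L U : Type*} [NormedAddCommGroup U] [NormedSpace ℝ U] [TopologicalSpace L] [ChartedSpace U L]
    {f : L → N} {l : L} (hf : MDifferentiableAt 𝓘(ℝ, U) 𝓘(ℝ, V) f l) {Y Z : VField V N}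
    (hY : DiffAt Y (f l)) (hZ : DiffAt Z (f l)) (h : ∀ᶠ q in 𝓝 l, G.g (f q) (Y (f q)) (Z (f q)) = 0)
    (u : TangentSpace 𝓘(ℝ, U) l) :
    G.g (f l) (nab Y (f l) (dmap f l u)) (Z (f l)) =
      -G.g (f l) (Y (f l)) (nab Z (f l) (dmap f l u)) := by
  have h1 := hnab.mvfderiv_g_comp hf hY hZ u
  have e : (fun q => G.g (f q) (Y (f q)) (Z (f q))) =ᶠ[𝓝 l] fun _ => (0 : ℝ) := h
  rw [mvfderiv_congr e, mvfderiv_const, zero_apply] at h1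
  linarith

variable {W : Type*} [NormedAddCommGroup W] [NormedSpace ℝ W]
  {M : Type*} [TopologicalSpace M] [ChartedSpace W M] [IsManifold 𝓘(ℝ, W) ∞ M]
  [FiniteDimensional ℝ V] [FiniteDimensional ℝ W]
  {i : M → N} {S : TangentDistribution W M}

/-- Each product of `Z` with a frame vector vanishes along `i ∘ j`, so its derivative along `L` does
too. The map `j` is the identity for sections of `D₀` on `M` and the immersion for integral
manifolds. Differentiability of `Z` at one point suffices, which is all that is known of the
extension chosen in `covAlong`. -/
theorem nullComponent_nab (hnab : IsLeviCivita G.metric nab) (hi : IsCharacteristic (W := W) G i)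
    (hS : IsCharacteristicScreen G i S)
    {L U : Type*} [NormedAddCommGroup U] [NormedSpace ℝ U] [TopologicalSpace L] [ChartedSpace U L]
    {j : L → M} {l : L} (hj : MDifferentiableAt 𝓘(ℝ, U) 𝓘(ℝ, W) j l) {e n : VField V N}
    (he : DiffAt e (i (j l))) (hn : DiffAt n (i (j l)))
    (hen : ∀ᶠ q in 𝓝 (j l), IsNullPair G i S q (e (i q)) (n (i q)))
    {Z : VField V N} (hZ : DiffAt Z (i (j l)))
    (hZD : ∀ᶠ q in 𝓝 l, Z (i (j q)) ∈ (D0 G i S (j q)).map (dmap i (j q)))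
    (u : TangentSpace 𝓘(ℝ, U) l) :
    nullComponent G (e (i (j l))) (n (i (j l)))
      (nab Z (i (j l)) (dmap (W := W) i (j l) (dmap j l u))) =
      nullSecondForm G nab e n (i (j l)) (dmap (W := W) i (j l) (dmap j l u)) (Z (i (j l))) := by
  have hid : MDifferentiableAt 𝓘(ℝ, W) 𝓘(ℝ, V) i (j l) :=
    hi.immersion.contMDiff.contMDiffAt.mdifferentiableAt (by simp)
  have hf : MDifferentiableAt 𝓘(ℝ, U) 𝓘(ℝ, V) (i ∘ j) l := hid.comp l hj
  have hd := dmap_comp hid hj u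
  have hg := ((hj.continuousAt.eventually hen).and hZD).mono fun q hq =>
    (hq.1.map_D0 hi hS).1 hq.2
  have key : ∀ {Y : VField V N}, DiffAt Y (i (j l)) →
      (∀ᶠ q in 𝓝 l, G.g (i (j q)) (Z (i (j q))) (Y (i (j q))) = 0) →
      G.g (i (j l)) (nab Z (i (j l)) (dmap (W := W) i (j l) (dmap j l u))) (Y (i (j l))) =
        -G.g (i (j l)) (Z (i (j l))) (nab Y (i (j l)) (dmap (W := W) i (j l) (dmap j l u))) := by
    intro Y hY hZY
    have := g_nab_eq_neg hnab hf hZ hY hZY u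
    rw [hd] at this
    exact this
  have h1 := key he (hg.mono fun q hq => hq.1.1)
  have h2 := key hn (hg.mono fun q hq => hq.1.2)
  have h3 := key (IndefiniteGFF.diffAt_φ (G := G) he) (hg.mono fun q hq => hq.2.1)
  have h4 := key (IndefiniteGFF.diffAt_φ (G := G) hn) (hg.mono fun q hq => hq.2.2)
  rw [nullComponent, nullSecondForm_apply, h1, h2, h3, h4]
  module

theorem IsNullPair.dmap_projAlong (hi : IsCharacteristic (W := W) G i)
    (hS : IsCharacteristicScreen G i S) {p : M} {e n : TangentSpace 𝓘(ℝ, V) (i p)}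
    (h : IsNullPair G i S p e n) (v : TangentSpace 𝓘(ℝ, W) p) :
    dmap i p (projAlong (D0 G i S p) (Fdist G i S p) v) =
      dmap i p v - nullComponent G e n (dmap i p v) := by
  obtain ⟨d, hd, hdv⟩ := h.sub_nullComponent_mem hi hS (dmap i p v)
  have hF : v - d ∈ Fdist G i S p := by
    refine h.mem_Fdist hi hS ?_
    rw [map_sub, hdv, sub_sub_cancel]
    exact h.nullComponent_mem hi hS _
  rw [← hdv, ← projAlong_add (h.isCompl_D0_Fdist hi hS) hd hF, add_sub_cancel]

theorem IsNullPair.nullComponent_eq_zero (hi : IsCharacteristic (W := W) G i)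
    (hS : IsCharacteristicScreen G i S) {p : M} {e n : TangentSpace 𝓘(ℝ, V) (i p)}
    (h : IsNullPair G i S p e n) {v : TangentSpace 𝓘(ℝ, V) (i p)}
    (hv : v ∈ (D0 G i S p).map (dmap i p)) : nullComponent G e n v = 0 := by
  obtain ⟨⟨h1, h2⟩, h3, h4⟩ := (h.map_D0 hi hS).1 hv
  simp [nullComponent, h1, h2, h3, h4]

omit [FiniteDimensional ℝ V] [FiniteDimensional ℝ W] in
theorem nullComponent_sub {x : N} (e n v w : TangentSpace 𝓘(ℝ, V) x) :
    nullComponent G e n (v - w) = nullComponent G e n v - nullComponent G e n w := by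
  simp only [nullComponent, map_sub, sub_apply]
  module

theorem exists_extension_sectionThrough (hi : IsCharacteristic (W := W) G i)
    (hS : IsCharacteristicScreen G i S) (p : M) (v : TangentSpace 𝓘(ℝ, W) p) :
    ∃ Z : VField V N, SmoothNear Z (i p) ∧
      ∀ᶠ q in 𝓝 p, Z (i q) = dmap i q (sectionThrough (D0 G i S) (Fdist G i S) p v q) := by
  obtain ⟨e, n, he, hn, hen⟩ := exists_null_frame hi.toIsLightlikeHypersurface hS.toIsScreen p
  obtain ⟨Y, hY, -, hYv⟩ := exists_extension hi.immersion p
    (FiberBundle.extend W (E := (TangentSpace 𝓘(ℝ, W) : M → Type _)) v)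
  have hYs := hY (smoothNear_extend v)
  have hφe := IndefiniteGFF.smoothNear_φ (G := G) he
  have hφn := IndefiniteGFF.smoothNear_φ (G := G) hn
  have hg := fun {A : VField V N} (hA : SmoothNear A (i p)) =>
    IndefiniteGFF.contMDiffAt_g (G := G) hYs hA
  refine ⟨fun z => Y z - nullComponent G (e z) (n z) (Y z), ?_, ?_⟩
  · exact hYs.sub ((((SmoothNear.smul (hg hn) he).add (SmoothNear.smul (hg he) hn)).add
      (SmoothNear.smul (hg hφn) hφe)).add (SmoothNear.smul (hg hφe) hφn))
  · filter_upwards [hYv, hen] with q hq hq'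
    rw [sectionThrough, hq'.dmap_projAlong hi hS, hq]

omit [FiniteDimensional ℝ V] [FiniteDimensional ℝ W] in
theorem exists_isNullPair (hi : IsLightlikeHypersurface (W := W) G.metric i)
    (hS : IsScreen G.metric i S) (p : M) :
    ∃ e n : TangentSpace 𝓘(ℝ, V) (i p), IsNullPair G i S p e n := by
  obtain ⟨e, n, -, -, h⟩ := exists_null_frame hi hS p
  exact ⟨_, _, h.self_of_nhds⟩

theorem sectionThrough_mem (hi : IsCharacteristic (W := W) G i)
    (hS : IsCharacteristicScreen G i S) (p : M) (v : TangentSpace 𝓘(ℝ, W) p) (q : M) :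
    sectionThrough (D0 G i S) (Fdist G i S) p v q ∈ D0 G i S q := by
  obtain ⟨e, n, h⟩ := exists_isNullPair hi.toIsLightlikeHypersurface hS.toIsScreen q
  exact projAlong_mem (h.isCompl_D0_Fdist hi hS) _

theorem sectionThrough_self (hi : IsCharacteristic (W := W) G i)
    (hS : IsCharacteristicScreen G i S) {p : M} {v : TangentSpace 𝓘(ℝ, W) p}
    (hv : v ∈ D0 G i S p) : sectionThrough (D0 G i S) (Fdist G i S) p v p = v := by
  obtain ⟨e, n, h⟩ := exists_isNullPair hi.toIsLightlikeHypersurface hS.toIsScreen p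
  rw [sectionThrough, FiberBundle.extend_apply_self]
  exact projAlong_of_mem_left (h.isCompl_D0_Fdist hi hS) hv

/-- The `E`-component of `∇_x Y`, for a section `Y` of `D₀` on the hypersurface. -/
theorem nullComponent_nab_sectionThrough (hnab : IsLeviCivita G.metric nab)
    (hi : IsCharacteristic (W := W) G i) (hS : IsCharacteristicScreen G i S) {p : M}
    {e n : VField V N} (he : DiffAt e (i p)) (hn : DiffAt n (i p))
    (hen : ∀ᶠ q in 𝓝 p, IsNullPair G i S q (e (i q)) (n (i q)))
    {y : TangentSpace 𝓘(ℝ, W) p} (hy : y ∈ D0 G i S p) {Z : VField V N} (hZ : DiffAt Z (i p))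
    (hZy : ∀ᶠ q in 𝓝 p, Z (i q) = dmap i q (sectionThrough (D0 G i S) (Fdist G i S) p y q))
    (u : TangentSpace 𝓘(ℝ, W) p) :
    nullComponent G (e (i p)) (n (i p)) (nab Z (i p) (dmap i p u)) =
      nullSecondForm G nab e n (i p) (dmap i p u) (dmap i p y) := by
  have h1 : dmap (W := W) (V := W) (id : M → M) p u = u :=
    DFunLike.congr_fun (mfderiv_id (I := 𝓘(ℝ, W)) (x := p)) u
  have h2 : Z (i p) = dmap i p y := by
    rw [hZy.self_of_nhds, sectionThrough_self hi hS hy]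
  have h3 := nullComponent_nab hnab hi hS (j := id) (l := p) mdifferentiableAt_id he hn hen hZ
    (hZy.mono fun q hq => ⟨_, sectionThrough_mem hi hS p y q, hq.symm⟩) u
  rw [h1] at h3
  rw [← h2]
  exact h3

/-- For sections `X`, `Y` of `D₀` the difference is the `E`-component of `∇̄_X Y - ∇̄_Y X = [X, Y]`,
and the bracket lies in `D₀` by integrability. -/
theorem nullSecondForm_symm (hnab : IsLeviCivita G.metric nab)
    (hi : IsCharacteristic (W := W) G i) (hS : IsCharacteristicScreen G i S)
    (hD0 : IsIntegrable (D0 G i S)) {p : M}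
    {e n : VField V N} (he : DiffAt e (i p)) (hn : DiffAt n (i p))
    (hen : ∀ᶠ q in 𝓝 p, IsNullPair G i S q (e (i q)) (n (i q)))
    {x y : TangentSpace 𝓘(ℝ, V) (i p)} (hx : x ∈ (D0 G i S p).map (dmap i p))
    (hy : y ∈ (D0 G i S p).map (dmap i p)) :
    nullSecondForm G nab e n (i p) x y = nullSecondForm G nab e n (i p) y x := by
  obtain ⟨x, hx, rfl⟩ := hx
  obtain ⟨y, hy, rfl⟩ := hy
  obtain ⟨X', hX', hXx⟩ := exists_extension_sectionThrough hi hS p x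
  obtain ⟨Y', hY', hYy⟩ := exists_extension_sectionThrough hi hS p y
  have hXs := smoothNear_of_related hi.immersion hX' hXx
  have hYs := smoothNear_of_related hi.immersion hY' hYy
  obtain ⟨s, hs, hps, hXs'⟩ := hXs.exists_smoothOn
  obtain ⟨t, ht, hpt, hYt⟩ := hYs.exists_smoothOn
  have := FiniteDimensional.complete ℝ V
  have := FiniteDimensional.complete ℝ W
  have h1 := hD0 (s ∩ t) (hs.inter ht) _ _ (hXs'.mono Set.inter_subset_left)
    (hYt.mono Set.inter_subset_right)
    (fun q _ => ⟨sectionThrough_mem hi hS p x q, sectionThrough_mem hi hS p y q⟩) p ⟨hps, hpt⟩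
  have h2 := mlieBracket_of_related hi.immersion.contMDiff hXs.diffAt hYs.diffAt hX'.diffAt
    hY'.diffAt hXx hYy
  have h3 := hnab.torsion_free (i p) X' Y' hX'.diffAt hY'.diffAt
  have h4 : X' (i p) = dmap i p x := by rw [hXx.self_of_nhds, sectionThrough_self hi hS hx]
  have h5 : Y' (i p) = dmap i p y := by rw [hYy.self_of_nhds, sectionThrough_self hi hS hy]
  have h6 := hen.self_of_nhds.nullComponent_eq_zero hi hS ⟨_, h1, h2.symm⟩
  rw [← h3, nullComponent_sub, h4, h5,
    nullComponent_nab_sectionThrough hnab hi hS he hn hen hy hY'.diffAt hYy,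
    nullComponent_nab_sectionThrough hnab hi hS he hn hen hx hX'.diffAt hXx] at h6
  exact sub_eq_zero.1 h6

/-- The formula for `∇φ` with `w` in the last slot has the factor `g(u, w) = 0`. Thus `(∇_u φ)w` is
orthogonal to every `y`. -/
theorem g_nab_φ (hr : 0 < r) (hG : G.IsSManifold) (hnab : IsLeviCivita G.metric nab) {x : N}
    {w : VField V N} (hw : DiffAt w x) (hηw : ∀ a, G.η a x (w x) = 0)
    {u y : TangentSpace 𝓘(ℝ, V) x} (hu : G.g x u (w x) = 0) :
    G.g x (G.φ x y) (nab w x u) = -G.g x y (nab (fun z => G.φ z (w z)) x u) := by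
  have := FiniteDimensional.complete ℝ V
  have h1 := covPhiForm_eq hr hG hnab u y (w x) hηw
  rw [hu, mul_zero, covPhiForm_skew, covPhiForm_apply hnab hw, neg_eq_zero, covPhi, map_sub,
    sub_apply, G.g_φ_left, G.g_symm _ _ y, G.g_symm _ _ (G.φ x y)] at h1
  linarith

/-- By `g_nab_φ`, replacing `y` by `φy` interchanges the coefficients belonging to `e, φe` and to
`n, φn`, with the signs of `φe ↦ -e` and `φn ↦ -n`. -/
theorem nullSecondForm_φ (hr : 0 < r) (hG : G.IsSManifold) (hnab : IsLeviCivita G.metric nab)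
    (hi : IsCharacteristic (W := W) G i) (hS : IsCharacteristicScreen G i S) {p : M}
    {e n : VField V N} (he : DiffAt e (i p)) (hn : DiffAt n (i p))
    (hen : ∀ᶠ q in 𝓝 p, IsNullPair G i S q (e (i q)) (n (i q)))
    {x : TangentSpace 𝓘(ℝ, V) (i p)} (hx : x ∈ (D0 G i S p).map (dmap i p))
    (y : TangentSpace 𝓘(ℝ, V) (i p)) :
    nullSecondForm G nab e n (i p) x (G.φ (i p) y) =
      G.φ (i p) (nullSecondForm G nab e n (i p) x y) := by
  have hp := hen.self_of_nhds
  obtain ⟨⟨h1, h2⟩, h3, h4⟩ := (hp.map_D0 hi hS).1 hx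
  have hφe := IndefiniteGFF.diffAt_φ (G := G) he
  have hφn := IndefiniteGFF.diffAt_φ (G := G) hn
  have hid : MDifferentiableAt 𝓘(ℝ, W) 𝓘(ℝ, V) i p :=
    hi.immersion.contMDiff.contMDiffAt.mdifferentiableAt (by simp)
  obtain ⟨x, -, rfl⟩ := hx
  have hneg : ∀ {A : VField V N}, DiffAt A (i p) →
      (∀ᶠ q in 𝓝 p, G.φ (i q) (G.φ (i q) (A (i q))) = -A (i q)) →
      nab (fun z => G.φ z (G.φ z (A z))) (i p) (dmap i p x) = -nab A (i p) (dmap i p x) := by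
    intro A hA h
    have hA' := IndefiniteGFF.diffAt_φ (G := G) (IndefiniteGFF.diffAt_φ (G := G) hA)
    have h5 : DiffAt ((-1 : ℝ) • A) (i p) := hA.smul_const_section
    have h6 := nab.isCovariantDerivativeOnUniv.smul_const (-1 : ℝ) hA
    -- The relation `φ²A = -A` is known only along `M`, and the derivative is taken in a direction
    -- tangent to `M`.
    refine (hnab.nab_eq_of_eq_along hid hA' h5 (h.mono fun q hq => ?_) x).trans
      ((DFunLike.congr_fun h6 (dmap i p x)).trans ?_)
    · exact hq.trans (neg_one_smul ℝ _).symm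
    · exact neg_one_smul ℝ _
  have h5 := hneg he (hen.mono fun q hq => hq.φ_φ_e hi hS)
  have h6 := hneg hn (hen.mono fun q hq => hq.φ_φ_n hi hS)
  rw [nullSecondForm_apply, nullSecondForm_apply,
    g_nab_φ hr hG hnab he (hp.η_e hi hS) h1, g_nab_φ hr hG hnab hn (hp.η_n hi hS) h2,
    g_nab_φ hr hG hnab hφe (G.η_φ (i p) · _) h3, g_nab_φ hr hG hnab hφn (G.η_φ (i p) · _) h4,
    h5, h6]
  simp only [map_neg, map_add, map_smul, hp.φ_φ_e hi hS, hp.φ_φ_n hi hS]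
  module

theorem φ_φ_nullSecondForm (hi : IsCharacteristic (W := W) G i)
    (hS : IsCharacteristicScreen G i S) {p : M} {e n : VField V N}
    (hp : IsNullPair G i S p (e (i p)) (n (i p))) (x y : TangentSpace 𝓘(ℝ, V) (i p)) :
    G.φ (i p) (G.φ (i p) (nullSecondForm G nab e n (i p) x y)) =
      -nullSecondForm G nab e n (i p) x y := by
  rw [nullSecondForm_apply]
  simp only [map_neg, map_add, map_smul, hp.φ_φ_e hi hS, hp.φ_φ_n hi hS]
  module

/-- The trace over `D₀` of any linear image of the second fundamental form vanishes. -/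
theorem metricTrace_nullSecondForm (hr : 0 < r) (hG : G.IsSManifold)
    (hnab : IsLeviCivita G.metric nab) (hi : IsCharacteristic (W := W) G i)
    (hS : IsCharacteristicScreen G i S) (hD0 : IsIntegrable (D0 G i S)) {p : M}
    {e n : VField V N} (he : DiffAt e (i p)) (hn : DiffAt n (i p))
    (hen : ∀ᶠ q in 𝓝 p, IsNullPair G i S q (e (i q)) (n (i q)))
    {X Y : Type*} [AddCommGroup X] [Module ℝ X] [FiniteDimensional ℝ X] [AddCommGroup Y]
    [Module ℝ Y] (A : X →ₗ[ℝ] TangentSpace 𝓘(ℝ, V) (i p)) (hA : Function.Injective A)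
    (hAr : LinearMap.range A = (D0 G i S p).map (dmap i p))
    (Q : TangentSpace 𝓘(ℝ, V) (i p) →ₗ[ℝ] Y) :
    metricTrace (fun x y => G.metric (i p) (A x) (A y))
      (fun x y => Q (nullSecondForm G nab e n (i p) (A x) (A y))) = 0 := by
  -- A left inverse of `A` transports `φ` to an endomorphism of `X`; this is faithful because `φ`
  -- preserves the range `D₀` of `A`.
  obtain ⟨B, hB⟩ := LinearMap.exists_leftInverse_of_injective A (LinearMap.ker_eq_bot.2 hA)
  have hp := hen.self_of_nhds
  have hmem : ∀ x, A x ∈ (D0 G i S p).map (dmap i p) := fun x => hAr ▸ LinearMap.mem_range_self A x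
  have hφ : ∀ x, A ((B ∘ₗ (G.φ (i p)).toLinearMap ∘ₗ A) x) = G.φ (i p) (A x) := by
    intro x
    have h1 := hp.φ_mem_map_D0 hi hS (hmem x)
    rw [← hAr] at h1
    obtain ⟨z, hz⟩ := h1
    have h2 := LinearMap.congr_fun hB z
    simp only [LinearMap.comp_apply, LinearMap.id_apply] at h2
    simp only [LinearMap.comp_apply, ContinuousLinearMap.coe_coe, ← hz, h2]
  have hφII := fun x y => nullSecondForm_φ hr hG hnab hi hS he hn hen (hmem x) (A y)
  have hsymm := fun {x y} =>
    nullSecondForm_symm (nab := nab) (x := x) (y := y) hnab hi hS hD0 he hn hen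
  have hφm := fun x => hp.φ_mem_map_D0 hi hS (hmem x)
  refine metricTrace_eq_zero_of_skew ((G.metric (i p)).comp A A)
    (B ∘ₗ (G.φ (i p)).toLinearMap ∘ₗ A) ?_
    (((nullSecondForm G nab e n (i p)).compl₁₂ A A).compr₂ Q) ?_ ?_
  · intro x y
    simp only [LinearMap.BilinForm.comp_apply, hφ]
    exact G.g_φ_left _ _ _
  · intro x y
    simp only [LinearMap.compr₂_apply, LinearMap.compl₁₂_apply, hφ]
    -- Only the second argument is `φ`-linear, so symmetry is used to bring `φx` there: `h(φx, φy) =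
    -- φ h(y, φx) = φ² h(y, x) = -h(x, y)`.
    rw [nullSecondForm_φ hr hG hnab hi hS he hn hen (hφm x), hsymm (hφm x) (hmem y), hφII,
      φ_φ_nullSecondForm hi hS hp, map_neg, hsymm (hmem y) (hmem x)]
  · intro x y
    simp only [LinearMap.compr₂_apply, LinearMap.compl₁₂_apply, hφ]
    rw [hsymm (hp.φ_mem_map_D0 hi hS (hφm x)) (hmem y),
      nullSecondForm_φ hr hG hnab hi hS he hn hen (hmem y), hφII,
      φ_φ_nullSecondForm hi hS hp, map_neg, hsymm (hmem y) (hmem x)]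

end SecondForm

/-! ### Tangent spaces of integral manifolds -/

section IntegralManifold

variable {V : Type*} [NormedAddCommGroup V] [NormedSpace ℝ V]
  {N : Type*} [TopologicalSpace N] [ChartedSpace V N] [IsManifold 𝓘(ℝ, V) ∞ N]
  {W : Type*} [NormedAddCommGroup W] [NormedSpace ℝ W]
  {M : Type*} [TopologicalSpace M] [ChartedSpace W M]
  {U : Type*} [NormedAddCommGroup U] [NormedSpace ℝ U]
  {L : Type*} [TopologicalSpace L] [ChartedSpace U L]
  {r : ℕ} {G : IndefiniteGFF V N r} {i : M → N} {S : TangentDistribution W M}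

theorem IsIntegralManifold.map_tangent {j : L → M}
    (hj : IsIntegralManifold (W := U) (D0 G i S) j) (l : L) (u : TangentSpace 𝓘(ℝ, U) l) :
    dmap (W := W) (V := V) i (j l) (dmap (W := U) (V := W) j l u) ∈
      (D0 G i S (j l)).map (dmap (W := W) (V := V) i (j l)) :=
  ⟨_, hj.tangent l ▸ LinearMap.mem_range_self _ u, rfl⟩

theorem IsIntegralManifold.range_comp {j : L → M}
    (hj : IsIntegralManifold (W := U) (D0 G i S) j) (l : L) :
    LinearMap.range (dmap (W := W) (V := V) i (j l) ∘ₗ dmap (W := U) j l) =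
      (D0 G i S (j l)).map (dmap (W := W) (V := V) i (j l)) := by
  rw [LinearMap.range_comp, hj.tangent]

end IntegralManifold

/-! ### The four minimality statements -/

section Minimality

open Filter Topology

/-- Hides the choice of extension in `covAlong`: the later arguments hold for any differentiable
extension, so no independence statement is required. -/
theorem covAlong_spec {V : Type*} [NormedAddCommGroup V] [NormedSpace ℝ V]
    {N : Type*} [TopologicalSpace N] [ChartedSpace V N] [IsManifold 𝓘(ℝ, V) 1 N]
    {W : Type*} [NormedAddCommGroup W] [NormedSpace ℝ W]
    {M : Type*} [TopologicalSpace M] [ChartedSpace W M] (nab : DiffOp V N) {f : M → N}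
    {Y : ∀ p : M, TangentSpace 𝓘(ℝ, V) (f p)} {p : M}
    (h : ∃ Z : VField V N, DiffAt Z (f p) ∧ ∀ᶠ q in 𝓝 p, Z (f q) = Y q) :
    ∃ Z : VField V N, DiffAt Z (f p) ∧ (∀ᶠ q in 𝓝 p, Z (f q) = Y q) ∧
      ∀ u : TangentSpace 𝓘(ℝ, W) p, covAlong nab f Y p u = nab Z (f p) (dmap f p u) := by
  refine ⟨h.choose, h.choose_spec.1, h.choose_spec.2, fun u => ?_⟩
  rw [covAlong, dif_pos h]
  rfl

variable {V : Type*} [NormedAddCommGroup V] [NormedSpace ℝ V] [FiniteDimensional ℝ V]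
  {N : Type*} [TopologicalSpace N] [ChartedSpace V N] [IsManifold 𝓘(ℝ, V) ∞ N]
  {W : Type*} [NormedAddCommGroup W] [NormedSpace ℝ W] [FiniteDimensional ℝ W]
  {M : Type*} [TopologicalSpace M] [ChartedSpace W M] [IsManifold 𝓘(ℝ, W) ∞ M]
  {r : ℕ} {G : IndefiniteGFF V N r}
  {nab : CovariantDerivative 𝓘(ℝ, V) V (TangentSpace 𝓘(ℝ, V) : N → Type _)}
  {i : M → N} {S : TangentDistribution W M}

theorem IsNullPair.isCompl_ltr (hi : IsCharacteristic (W := W) G i)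
    (hS : IsCharacteristicScreen G i S) {p : M} {e n : TangentSpace 𝓘(ℝ, V) (i p)}
    (h : IsNullPair G i S p e n) :
    IsCompl (LinearMap.range (dmap (W := W) (V := V) i p)) (ltr G.metric i S p) := by
  rw [h.ltr_eq hi.toIsLightlikeHypersurface hS.toIsScreen]
  exact h.isCompl_span hi.toIsLightlikeHypersurface

variable (G i S) in
/-- The projection of `TN|_M` onto `F` along `D₀ ⊕ ltr(M)`. -/
def projF (p : M) : TangentSpace 𝓘(ℝ, V) (i p) →ₗ[ℝ] TangentSpace 𝓘(ℝ, W) p :=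
  projAlong (Fdist G i S p) (D0 G i S p) ∘ₗ tangentialPart (dmap i p) (ltr G.metric i S p)

/-- `projF` annihilates `D₀`, and `v` differs from its `E`-component by a vector of `D₀`. -/
theorem IsNullPair.projF_nullComponent (hi : IsCharacteristic (W := W) G i)
    (hS : IsCharacteristicScreen G i S) {p : M} {e n : TangentSpace 𝓘(ℝ, V) (i p)}
    (h : IsNullPair G i S p e n) (v : TangentSpace 𝓘(ℝ, V) (i p)) :
    projF G i S p (nullComponent G e n v) = projF G i S p v := by
  obtain ⟨d, hd, hdv⟩ := h.sub_nullComponent_mem hi hS v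
  have h1 : projF G i S p (dmap i p d) = 0 := by
    have h2 := tangentialPart_add (dmap_injective hi.immersion p) (h.isCompl_ltr hi hS) d
      (Submodule.zero_mem _)
    rw [add_zero] at h2
    rw [projF, LinearMap.comp_apply, h2]
    exact projAlong_of_mem_right (h.isCompl_D0_Fdist hi hS).symm hd
  rw [hdv, map_sub, sub_eq_zero] at h1
  exact h1.symm

variable (hr : 0 < r) (hG : G.IsSManifold) (hnab : IsLeviCivita G.metric nab)
  (hi : IsCharacteristic (W := W) G i) (hS : IsCharacteristicScreen G i S)
  (hD0 : IsIntegrable (D0 G i S))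

include hnab hi hS in
/-- The covariant derivative of sections of `D₀` along the hypersurface. -/
theorem nullComponent_covAlong_sectionThrough {p : M} {e n : VField V N} (he : DiffAt e (i p))
    (hn : DiffAt n (i p)) (hen : ∀ᶠ q in 𝓝 p, IsNullPair G i S q (e (i q)) (n (i q)))
    {y : TangentSpace 𝓘(ℝ, W) p} (hy : y ∈ D0 G i S p) (x : TangentSpace 𝓘(ℝ, W) p) :
    nullComponent G (e (i p)) (n (i p)) (covAlong (W := W) (opOf nab) i
      (fun q : M => dmap (W := W) (V := V) i q (sectionThrough (D0 G i S) (Fdist G i S) p y q)) p x) =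
      nullSecondForm G nab e n (i p) (dmap (W := W) i p x) (dmap (W := W) i p y) := by
  obtain ⟨Z₀, hZ₀, hZ₀y⟩ := exists_extension_sectionThrough hi hS p y
  obtain ⟨Z, hZ, hZy, hcov⟩ := covAlong_spec (W := W) (opOf nab) ⟨Z₀, hZ₀.diffAt, hZ₀y⟩
  rw [hcov]
  exact nullComponent_nab_sectionThrough hnab hi hS he hn hen hy hZ hZy x

include hr hG hnab hi hS hD0

theorem metricTrace_hTilde (p : M) :
    metricTrace (fun x y : D0 G i S p => pullbackMetric (W := W) G.metric i p x y)
      (hTilde G i S (opOf nab) p) = 0 := by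
  obtain ⟨e, n, he, hn, hen⟩ := exists_null_frame hi.toIsLightlikeHypersurface hS.toIsScreen p
  have hp := hen.self_of_nhds
  have h1 : hTilde G i S (opOf nab) p = fun x y : D0 G i S p =>
      (LinearMap.id : TangentSpace 𝓘(ℝ, V) (i p) →ₗ[ℝ] _) (nullSecondForm G nab e n (i p)
        ((dmap (W := W) i p ∘ₗ (D0 G i S p).subtype) x)
        ((dmap (W := W) i p ∘ₗ (D0 G i S p).subtype) y)) := by
    ext x y
    rw [hTilde, hp.projAlong_eq hi hS,
      nullComponent_covAlong_sectionThrough hnab hi hS he.diffAt hn.diffAt hen y.2]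
    rfl
  rw [h1]
  refine metricTrace_nullSecondForm hr hG hnab hi hS hD0 he.diffAt hn.diffAt hen
    (dmap (W := W) (V := V) i p ∘ₗ (D0 G i S p).subtype) ?_ ?_ LinearMap.id
  · exact (dmap_injective hi.immersion p).comp Subtype.val_injective
  · rw [LinearMap.range_comp, Submodule.range_subtype]

theorem isMinimalDistribution_D0 :
    IsMinimalDistribution (inducedConnection G.metric (opOf nab) i S)
      (pullbackMetric G.metric i) (D0 G i S) (Fdist G i S) := by
  intro p
  obtain ⟨e, n, he, hn, hen⟩ := exists_null_frame hi.toIsLightlikeHypersurface hS.toIsScreen p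
  have hp := hen.self_of_nhds
  have h0 : ∀ x y : D0 G i S p, unsymSecondFF (inducedConnection G.metric (opOf nab) i S)
      (D0 G i S) (Fdist G i S) p x y =
      projF G i S p (nullSecondForm G nab e n (i p) (dmap (W := W) i p x) (dmap (W := W) i p y)) := by
    intro x y
    rw [unsymSecondFF, projAlong_of_mem_left (hp.isCompl_D0_Fdist hi hS) x.2,
      ← nullComponent_covAlong_sectionThrough hnab hi hS he.diffAt hn.diffAt hen y.2,
      hp.projF_nullComponent hi hS]
    rfl
  have h1 : (fun x y : D0 G i S p => symSecondFF (inducedConnection G.metric (opOf nab) i S)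
      (D0 G i S) (Fdist G i S) p x y) = fun x y : D0 G i S p =>
      projF G i S p (nullSecondForm G nab e n (i p)
        ((dmap (W := W) i p ∘ₗ (D0 G i S p).subtype) x)
        ((dmap (W := W) i p ∘ₗ (D0 G i S p).subtype) y)) := by
    ext x y
    -- The form is already symmetric on `D₀`, so symmetrizing changes nothing.
    rw [symSecondFF, h0, h0, nullSecondForm_symm hnab hi hS hD0 he.diffAt hn.diffAt hen
      ⟨y, y.2, rfl⟩ ⟨x, x.2, rfl⟩, ← two_smul ℝ, smul_smul, inv_mul_cancel₀ two_ne_zero, one_smul]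
    rfl
  rw [distributionMeanCurvature, h1]
  have h2 := metricTrace_nullSecondForm hr hG hnab hi hS hD0 he.diffAt hn.diffAt hen
    (dmap (W := W) (V := V) i p ∘ₗ (D0 G i S p).subtype)
    ((dmap_injective hi.immersion p).comp Subtype.val_injective)
    (by rw [LinearMap.range_comp, Submodule.range_subtype]) (projF G i S p)
  exact (congrArg _ h2).trans (smul_zero _)

variable {U : Type*} [NormedAddCommGroup U] [NormedSpace ℝ U] [FiniteDimensional ℝ U]
  {L : Type*} [TopologicalSpace L] [ChartedSpace U L] [IsManifold 𝓘(ℝ, U) ∞ L]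
  {j : L → M} (hj : IsIntegralManifold (W := U) (D0 G i S) j)

include hj

theorem isMinimalSubmanifold_inducedConnection :
    IsMinimalSubmanifold (W := U) (inducedConnection G.metric (opOf nab) i S)
      (pullbackMetric G.metric i) j (fun l => Fdist G i S (j l)) := by
  intro l
  obtain ⟨e, n, he, hn, hen⟩ :=
    exists_null_frame hi.toIsLightlikeHypersurface hS.toIsScreen (j l)
  have hp := hen.self_of_nhds
  have hjd : MDifferentiableAt 𝓘(ℝ, U) 𝓘(ℝ, W) j l :=
    hj.immersion.contMDiff.contMDiffAt.mdifferentiableAt (by simp)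
  have h1 : secondFundamentalForm (W := U) (inducedConnection G.metric (opOf nab) i S) j
      (fun l => Fdist G i S (j l)) l = fun u v => projF G i S (j l)
        (nullSecondForm G nab e n (i (j l)) ((dmap (W := W) i (j l) ∘ₗ dmap j l) u)
          ((dmap (W := W) i (j l) ∘ₗ dmap j l) v)) := by
    ext u v
    obtain ⟨Y₀, -, hY₀, hY₀v⟩ := exists_extension hj.immersion l
      (FiberBundle.extend U (E := (TangentSpace 𝓘(ℝ, U) : L → Type _)) v)
    obtain ⟨Y, hY, hYv, hcov⟩ := covAlong_spec (W := U)
      (inducedConnection G.metric (opOf nab) i S) (f := j) (p := l)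
      ⟨Y₀, hY₀ (smoothNear_extend v).diffAt, hY₀v⟩
    -- Two successive extensions, from `L` to `M` and from `M` to `N`. The field `Y` need not lie in
    -- `D₀` off the integral manifold, but `Z` is tangent to `D₀` along `L`, which is enough.
    obtain ⟨Z₀, -, hZ₀, hZ₀Y⟩ := exists_extension hi.immersion (j l) Y
    obtain ⟨Z, hZ, hZY, hcov'⟩ := covAlong_spec (W := W) (opOf nab) ⟨Z₀, hZ₀ hY, hZ₀Y⟩
    have hZD : ∀ᶠ q in 𝓝 l, Z (i (j q)) =
        dmap (W := W) (V := V) i (j q) (dmap (W := U) (V := W) j q (FiberBundle.extend U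
          (E := (TangentSpace 𝓘(ℝ, U) : L → Type _)) v q)) := by
      filter_upwards [hYv, hjd.continuousAt.eventually hZY] with q hq hq'
      rw [hq', hq]
    have h2 := nullComponent_nab hnab hi hS hjd he.diffAt hn.diffAt hen hZ
      (hZD.mono fun q hq => hq ▸ hj.map_tangent q _) u
    have h3 := hZD.self_of_nhds
    rw [FiberBundle.extend_apply_self] at h3
    rw [h3] at h2
    rw [secondFundamentalForm, hj.tangent, hcov, LinearMap.comp_apply, LinearMap.comp_apply, ← h2,
      hp.projF_nullComponent hi hS]
    exact congrArg (fun w => projAlong (Fdist G i S (j l)) (D0 G i S (j l))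
      (tangentialPart (dmap i (j l)) (ltr G.metric i S (j l)) w)) (hcov' (dmap j l u))
  rw [submanifoldMeanCurvature, h1]
  have h2 := metricTrace_nullSecondForm hr hG hnab hi hS hD0 he.diffAt hn.diffAt hen
    (dmap (W := W) i (j l) ∘ₗ dmap j l)
    ((dmap_injective hi.immersion (j l)).comp (dmap_injective hj.immersion l))
    (hj.range_comp l) (projF G i S (j l))
  exact (congrArg _ h2).trans (smul_zero _)

theorem isMinimalSubmanifold_ambient :
    IsMinimalSubmanifold (W := U) (opOf nab) G.metric (i ∘ j)
      (normalSpace (W := U) G.metric (i ∘ j)) := by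
  intro l
  obtain ⟨e, n, he, hn, hen⟩ :=
    exists_null_frame hi.toIsLightlikeHypersurface hS.toIsScreen (j l)
  have hp := hen.self_of_nhds
  have hjd : ∀ q, MDifferentiableAt 𝓘(ℝ, U) 𝓘(ℝ, W) j q := fun q =>
    hj.immersion.contMDiff.contMDiffAt.mdifferentiableAt (by simp)
  have hid : ∀ q, MDifferentiableAt 𝓘(ℝ, W) 𝓘(ℝ, V) i q := fun q =>
    hi.immersion.contMDiff.contMDiffAt.mdifferentiableAt (by simp)
  have hcomp : ∀ q, dmap (W := U) (V := V) (i ∘ j) q =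
      dmap (W := W) (V := V) i (j q) ∘ₗ dmap (W := U) (V := W) j q := fun q =>
    LinearMap.ext fun u => dmap_comp (hid (j q)) (hjd q) u
  have hrange : LinearMap.range (dmap (W := U) (V := V) (i ∘ j) l) =
      (D0 G i S (j l)).map (dmap (W := W) (V := V) i (j l)) := by
    rw [hcomp]
    exact hj.range_comp l
  -- The normal space of the integral manifold is the orthogonal complement of `D₀`, so its second
  -- fundamental form in `N` is again the `E`-component.
  have hnormal : normalSpace (W := U) G.metric (i ∘ j) l = Ebundle G i S (j l) := by
    apply le_antisymm
    · intro w hw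
      refine hp.mem_Ebundle_of_g_eq_zero hi hS fun v hv => ?_
      rw [← hrange] at hv
      obtain ⟨u, rfl⟩ := hv
      exact hw u
    · intro w hw u
      have h1 := hp.g_D0_Ebundle hi hS (hrange ▸ LinearMap.mem_range_self _ u) hw
      exact (G.g_symm _ _ _).trans h1
  have h1 : secondFundamentalForm (W := U) (opOf nab) (i ∘ j)
      (normalSpace (W := U) G.metric (i ∘ j)) l = fun u v =>
        (LinearMap.id : TangentSpace 𝓘(ℝ, V) (i (j l)) →ₗ[ℝ] _)
        (nullSecondForm G nab e n (i (j l)) ((dmap (W := W) i (j l) ∘ₗ dmap j l) u)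
          ((dmap (W := W) i (j l) ∘ₗ dmap j l) v)) := by
    ext u v
    obtain ⟨Y, hY, -, hYv⟩ := exists_extension hj.immersion l
      (FiberBundle.extend U (E := (TangentSpace 𝓘(ℝ, U) : L → Type _)) v)
    obtain ⟨Z₀, hZ₀, -, hZ₀Y⟩ := exists_extension hi.immersion (j l) Y
    have hZ₀v : ∀ᶠ q in 𝓝 l, Z₀ ((i ∘ j) q) = dmap (W := U) (i ∘ j) q (FiberBundle.extend U
          (E := (TangentSpace 𝓘(ℝ, U) : L → Type _)) v q) := by
      filter_upwards [hYv, (hjd l).continuousAt.eventually hZ₀Y] with q hq hq'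
      rw [hcomp, LinearMap.comp_apply, ← hq]
      exact hq'
    obtain ⟨Z, hZ, hZv, hcov⟩ := covAlong_spec (W := U) (opOf nab) (f := i ∘ j) (p := l)
      ⟨Z₀, (hZ₀ (hY (smoothNear_extend v))).diffAt, hZ₀v⟩
    have hZD : ∀ᶠ q in 𝓝 l, Z (i (j q)) ∈ (D0 G i S (j q)).map (dmap (W := W) (V := V) i (j q)) := by
      filter_upwards [hZv] with q hq
      rw [hcomp] at hq
      exact hq ▸ hj.map_tangent q _
    have h2 := nullComponent_nab hnab hi hS (hjd l) he.diffAt hn.diffAt hen hZ hZD u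
    have h3 := hZv.self_of_nhds
    rw [FiberBundle.extend_apply_self, hcomp] at h3
    rw [secondFundamentalForm, hnormal, hrange, hcov, hcomp]
    refine (hp.projAlong_eq hi hS _).trans (h2.trans ?_)
    exact congrArg _ h3
  rw [submanifoldMeanCurvature, h1]
  have h2 := metricTrace_nullSecondForm hr hG hnab hi hS hD0 he.diffAt hn.diffAt hen
    (dmap (W := W) i (j l) ∘ₗ dmap j l)
    ((dmap_injective hi.immersion (j l)).comp (dmap_injective hj.immersion l))
    (hj.range_comp l) LinearMap.id
  have h3 : (fun u v => pullbackMetric (W := U) G.metric (i ∘ j) l u v) =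
      fun u v => G.metric (i (j l)) ((dmap (W := W) i (j l) ∘ₗ dmap j l) u)
        ((dmap (W := W) i (j l) ∘ₗ dmap j l) v) := by
    ext u v
    simp only [pullbackMetric, hcomp]
    rfl
  rw [h3]
  exact (congrArg _ h2).trans (smul_zero _)

end Minimality

end LightlikeGeometry

end

theorem mainTheorem9
    {V : Type*} [NormedAddCommGroup V] [NormedSpace ℝ V] [FiniteDimensional ℝ V]
    {N : Type*} [TopologicalSpace N] [T2Space N] [SecondCountableTopology N]
    [ChartedSpace V N] [IsManifold 𝓘(ℝ, V) ∞ N]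
    {W : Type*} [NormedAddCommGroup W] [NormedSpace ℝ W] [FiniteDimensional ℝ W]
    {M : Type*} [TopologicalSpace M] [T2Space M] [SecondCountableTopology M]
    [ChartedSpace W M] [IsManifold 𝓘(ℝ, W) ∞ M]
    {r : ℕ} (hr : 0 < r)
    (G : IndefiniteGFF V N r) (hG : G.IsSManifold)
    (nab : CovariantDerivative 𝓘(ℝ, V) V (TangentSpace 𝓘(ℝ, V) : N → Type _))
    (hnab : IsLeviCivita G.metric nab)
    (i : M → N) (hi : IsCharacteristic (W := W) G i)
    (S : TangentDistribution W M) (hS : IsCharacteristicScreen G i S)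
    (hD0 : IsIntegrable (D0 G i S)) :
    -- the decompositions `TN|_M = TM ⊕ ltr(M) = D₀ ⊕ E` and `TM = D₀ ⊕ F` hold,
    -- and `g` is nondegenerate on `D₀`
    (∀ p, IsCompl (LinearMap.range (dmap (W := W) i p)) (ltr G.metric i S p) ∧
      IsCompl ((D0 G i S p).map (dmap i p)) (Ebundle G i S p) ∧
      IsCompl (D0 G i S p) (Fdist G i S p) ∧
      NondegenerateOn (fun v w => pullbackMetric (W := W) G.metric i p v w) (D0 G i S p)) ∧
    -- `D₀` is minimal with respect to the induced connection `∇` on `M`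
    IsMinimalDistribution (inducedConnection G.metric (opOf nab) i S)
      (pullbackMetric G.metric i) (D0 G i S) (Fdist G i S) ∧
    -- all integral manifolds of `D₀` are minimal submanifolds of `M` with respect to `∇`
    (∀ (U : Type*) [NormedAddCommGroup U] [NormedSpace ℝ U] [FiniteDimensional ℝ U]
      (L : Type*) [TopologicalSpace L] [ChartedSpace U L] [IsManifold 𝓘(ℝ, U) ∞ L]
      (j : L → M), IsIntegralManifold (W := U) (D0 G i S) j →
      IsMinimalSubmanifold (W := U) (inducedConnection G.metric (opOf nab) i S)
        (pullbackMetric G.metric i) j (fun l => Fdist G i S (j l))) ∧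
    -- the trace of `h̃` vanishes
    (∀ p, metricTrace (fun x y : D0 G i S p => pullbackMetric (W := W) G.metric i p x y)
      (hTilde G i S (opOf nab) p) = 0) ∧
    -- all integral manifolds of `D₀` are minimal submanifolds of `N`
    (∀ (U : Type*) [NormedAddCommGroup U] [NormedSpace ℝ U] [FiniteDimensional ℝ U]
      (L : Type*) [TopologicalSpace L] [ChartedSpace U L] [IsManifold 𝓘(ℝ, U) ∞ L]
      (j : L → M), IsIntegralManifold (W := U) (D0 G i S) j →
      IsMinimalSubmanifold (W := U) (opOf nab) G.metric (i ∘ j)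
        (normalSpace (W := U) G.metric (i ∘ j))) := by
  refine ⟨fun p => ?_, isMinimalDistribution_D0 hr hG hnab hi hS hD0, ?_,
    metricTrace_hTilde hr hG hnab hi hS hD0, ?_⟩
  · obtain ⟨e, n, h⟩ := exists_isNullPair hi.toIsLightlikeHypersurface hS.toIsScreen p
    exact ⟨h.isCompl_ltr hi hS, h.isCompl_D0_Ebundle hi hS, h.isCompl_D0_Fdist hi hS,
      h.nondegenerateOn_D0 hi hS⟩
  · intro U _ _ _ L _ _ _ j hj
    exact isMinimalSubmanifold_inducedConnection hr hG hnab hi hS hD0 hj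
  · intro U _ _ _ L _ _ _ j hj
    exact isMinimalSubmanifold_ambient hr hG hnab hi hS hD0 hj
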